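/- A \emph{partial field} is a set $P$ with distinguished elements $0,1$, a multiplication, and a partially defined addition, such that: $P\setminus\{0\}$ is an abelian group under multiplication with identity $1$ (and $0\cdot p=0$); $p+0=p$; every $p$ has a unique $-p$ with $p+(-p)=0$; if $p+q$ is defined, then $q+p$ is defined and equal to it; for $p\neq 0$, $p(q+r)$ is defined if and only if $pq+pr$ is defined, and then they are equal; and addition is associative in the following sense: whenever a finite multiset $S$ can be summed along some binary tree (all intermediate sums being defined) with result $r$, and $u$, $w$ are results of summing the two parts of a partition of $S$ into two non-empty multisets along binary trees, then $u+w$ is defined and equal to $r$. Every field is a partial field. For a commutative ring $R\ne 0$ and a set $S$ of units of $R$, $\mathbb{P}(R,S)$ denotes the partial field with underlying set $\langle S\cup\{-1\}\rangle\cup\{0\}$ (where $\langle\cdot\rangle$ is the generated multiplicative group), with the operations of $R$, where $p+q$ is defined if and only if the sum in $R$ lies in this set. For partial fields $\mathbb{P}_1,\mathbb{P}_2$, the partial field $\mathbb{P}_1\otimes\mathbb{P}_2$ has underlying set $\{(p_1,p_2)\in \mathbb{P}_1\times \mathbb{P}_2 : p_1\ne 0 \Leftrightarrow p_2\neq 0\}$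 and componentwise operations, where $(p_1,p_2)+(q_1,q_2)$ is defined if and only if $p_1+q_1$ and $p_2+q_2$ are both defined and they are either both zero or both nonzero. A sum $p_1+\cdots+p_n$ in a partial field $\mathbb{P}$ is \emph{defined}, with value $r$, if for some finite multiset $Z=\{z_1,-z_1,\ldots,z_k,-z_k\}$ the multiset $\{p_1,\ldots,p_n\}\cup Z$ can be summed along some binary tree with result $r$; the determinant of a square matrix $A$ over $\mathbb{P}$ is defined if the sum $\sum_\sigma \operatorname{sgn}(\sigma)\prod_i a_{i\sigma(i)}$ is. A \emph{$\mathbb{P}$-matrix} is a matrix over $\mathbb{P}$ all of whose square submatrices have a defined determinant; its rank is the largest size of a square submatrix with nonzero determinant. A matroid $M$ (on a finite ground set $E$) is \emph{representable over $\mathbb{P}$} if, for some $r$, there is an $r\times E$ $\mathbb{P}$-matrix $A$ of rank $r$ such that the bases of $M$ are precisely the sets $B\subseteq E$ with $|B|=r$ for which the $r\times r$ submatrix of $A$ with columns $B$ has nonzero determinant. Let $\mathbb{H}_2:=\mathbb{P}(\mathbb{C},\{i,1-i\})$ with $i^2=-1$, and let $\mathbb{K}_2:=\mathbb{P}(\mathbb{Q}(\alpha),\{\alpha,\alpha-1,\alpha+1\})$,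 where $\alpha$ is an indeterminate. \textbf{Theorem.} Let $M$ be a matroid. The following are equivalent: (i) $M$ is representable over $\mathrm{GF}(4)\otimes\mathbb{H}_2$; (ii) $M$ is representable over $\mathbb{K}_2$. -/

import Mathlib

/-- An association of a finite multiset `S` with root label `r`, for a partial binary operation
`padd` on `P`: there is a binary tree whose leaves are labelled by the elements of `S`, in which
each inner node is labelled by the (defined) sum of the labels of its two children, and whose root
is labelled `r`. -/
inductive Association {P : Type*} (padd : P → P → Part P) : Multiset P → P → Prop
  | leaf (p : P) : Association padd {p} p
  | node {S T : Multiset P} {u w r : P} :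
      Association padd S u → Association padd T w → r ∈ padd u w → Association padd (S + T) r

/-- A partial field: `P \ {0}` is an abelian group under multiplication (and `0 * p = 0`), and
addition is a partial binary operation `padd`. The statement `r ∈ padd p q` reads
"`p + q` is defined and equal to `r`". -/
class PartialField (P : Type*) extends CommGroupWithZero P, Neg P where
  /-- The partial addition. -/
  padd : P → P → Part P
  padd_zero : ∀ p : P, padd p 0 = Part.some p
  zero_mem_padd_neg : ∀ p : P, 0 ∈ padd p (-p)
  eq_neg_of_zero_mem_padd : ∀ p q : P, 0 ∈ padd p q → q = -p
  padd_comm : ∀ p q : P, padd p q = padd q p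
  mul_padd : ∀ p q r : P, p ≠ 0 → padd (p * q) (p * r) = (padd q r).map (fun s => p * s)
  /-- The associative law: if `S` has an association with root `r`, and a pre-association of `S`
  has labels `u` and `w` at the two children of its root, then `u + w` is defined and equals `r`. -/
  associative_law : ∀ (S T : Multiset P) (r u w : P), Association padd (S + T) r →
    Association padd S u → Association padd T w → r ∈ padd u w

namespace PartialField

/-! ### Sums, determinants, matrices -/

/-- The sum of the elements of the multiset `S` is defined, with value `r`: there is a finite
multiset `{z₁, -z₁, …, zₖ, -zₖ}` whose union with `S` has an association with root `r`. -/
def SumIs {P : Type*} [PartialField P] (S : Multiset P) (r : P) : Prop :=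
  ∃ Z : Multiset P, Association padd (S + (Z + Z.map (fun z => -z))) r

/-- The determinant of the square matrix `A` is defined, with value `d`. -/
def DetIs {P : Type*} [PartialField P] {k : ℕ} (A : Matrix (Fin k) (Fin k) P) (d : P) : Prop :=
  SumIs ((Finset.univ : Finset (Equiv.Perm (Fin k))).val.map (fun σ =>
    if Equiv.Perm.sign σ = 1 then ∏ i, A i (σ i) else -∏ i, A i (σ i))) d

/-- The determinant of `A` is defined and nonzero. -/
def DetNeZero {P : Type*} [PartialField P] {k : ℕ} (A : Matrix (Fin k) (Fin k) P) : Prop :=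
  ∃ d : P, d ≠ 0 ∧ DetIs A d

/-- `A` is a matrix over the partial field `P` in the strong sense ("`P`-matrix"): the determinant
of every square submatrix is defined. -/
def IsPMatrix {P : Type*} [PartialField P] {X Y : Type*} (A : Matrix X Y P) : Prop :=
  ∀ (k : ℕ) (f : Fin k → X) (g : Fin k → Y), Function.Injective f → Function.Injective g →
    ∃ d : P, DetIs (A.submatrix f g) d

/-- The rank of a matrix with finitely many rows: the largest `k` such that there is a `k × k`
submatrix with nonzero determinant. -/
noncomputable def rank {P : Type*} [PartialField P] {r : ℕ} {Y : Type*}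
    (A : Matrix (Fin r) Y P) : ℕ :=
  sSup {k : ℕ | ∃ (f : Fin k → Fin r) (g : Fin k → Y), Function.Injective f ∧
    Function.Injective g ∧ DetNeZero (A.submatrix f g)}

/-- For an `r × E` matrix `A`, the family of those `B ⊆ E` with `|B| = r` for which the
determinant of the submatrix with columns `B` is nonzero. -/
def basesOf {P : Type*} [PartialField P] {α : Type*} {E : Set α} {r : ℕ}
    (A : Matrix (Fin r) E P) : Set (Set α) :=
  {B : Set α | ∃ g : Fin r → E, Function.Injective g ∧ Set.range (fun i => (g i : α)) = B ∧
    DetNeZero (A.submatrix id g)}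

/-- `M` is representable over the partial field `P`: there is an `r × E(M)` `P`-matrix `A` of
rank `r` such that `M = M[A]`. -/
def IsRepresentable (P : Type*) [PartialField P] {α : Type*} (M : Matroid α) : Prop :=
  ∃ (r : ℕ) (A : Matrix (Fin r) M.E P), IsPMatrix A ∧ rank A = r ∧
    ∀ B : Set α, M.IsBase B ↔ B ∈ basesOf A

/-! ### Fields -/

/-- If the partial addition is the restriction of an addition along `f`, the root of an
association is the sum of its leaves. -/
theorem map_association {P M : Type*} [AddCommMonoid M] {padd : P → P → Part P} (f : P → M)
    (hf : ∀ p q r : P, r ∈ padd p q → f r = f p + f q) {S : Multiset P} {r : P}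
    (h : Association padd S r) : f r = (S.map f).sum := by
  induction h with
  | leaf p => simp
  | node _ _ h ih₁ ih₂ => rw [hf _ _ _ h, ih₁, ih₂, Multiset.map_add, Multiset.sum_add]

/-- Every field is a partial field, with addition defined everywhere. -/
instance ofField (F : Type*) [Field F] : PartialField F where
  padd p q := Part.some (p + q)
  padd_zero p := by simp
  zero_mem_padd_neg p := by simp
  eq_neg_of_zero_mem_padd p q h := by
    rw [Part.mem_some_iff] at h
    exact eq_neg_of_add_eq_zero_right h.symm
  padd_comm p q := by rw [add_comm]
  mul_padd p q r _ := by simp [mul_add]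
  associative_law S T r u w h hS hT := by
    have key : ∀ p q r : F, r ∈ Part.some (p + q) → id r = id p + id q := by
      intro p q r h
      simpa using h
    have h₁ := map_association id key h
    have h₂ := map_association id key hS
    have h₃ := map_association id key hT
    simp only [id_eq, Multiset.map_id', Multiset.sum_add] at h₁ h₂ h₃
    rw [Part.mem_some_iff, h₁, h₂, h₃]

end PartialField

/-! ### Partial fields from rings -/

/-- The underlying set `⟨S ∪ {-1}⟩ ∪ {0}` of the partial field `ℙ(R, S)`, where `S` is a set of
units of the commutative ring `R`. -/
@[ext]
structure RingPartialField (R : Type*) [CommRing R] (S : Set Rˣ) where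
  /-- The element as an element of `R`. -/
  val : R
  property : val = 0 ∨ ∃ u ∈ Subgroup.closure (S ∪ {-1}), (u : R) = val

namespace RingPartialField

variable {R : Type*} [CommRing R] {S : Set Rˣ}

theorem closed_mul {x y : R} (hx : x = 0 ∨ ∃ u ∈ Subgroup.closure (S ∪ {-1}), (u : R) = x)
    (hy : y = 0 ∨ ∃ u ∈ Subgroup.closure (S ∪ {-1}), (u : R) = y) :
    x * y = 0 ∨ ∃ u ∈ Subgroup.closure (S ∪ {-1}), (u : R) = x * y := by
  rcases hx with rfl | ⟨u, hu, rfl⟩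
  · simp
  rcases hy with rfl | ⟨v, hv, rfl⟩
  · simp
  exact Or.inr ⟨u * v, Subgroup.mul_mem _ hu hv, by simp⟩

theorem closed_neg {x : R} (hx : x = 0 ∨ ∃ u ∈ Subgroup.closure (S ∪ {-1}), (u : R) = x) :
    -x = 0 ∨ ∃ u ∈ Subgroup.closure (S ∪ {-1}), (u : R) = -x := by
  rcases hx with rfl | ⟨u, hu, rfl⟩
  · simp
  refine Or.inr ⟨-1 * u, Subgroup.mul_mem _ (Subgroup.subset_closure (by simp)) hu, by simp⟩

theorem closed_inv {x : R} (hx : x = 0 ∨ ∃ u ∈ Subgroup.closure (S ∪ {-1}), (u : R) = x) :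
    Ring.inverse x = 0 ∨ ∃ u ∈ Subgroup.closure (S ∪ {-1}), (u : R) = Ring.inverse x := by
  rcases hx with rfl | ⟨u, hu, rfl⟩
  · simp
  exact Or.inr ⟨u⁻¹, Subgroup.inv_mem _ hu, by simp⟩

/-- The partial addition of `ℙ(R, S)`: `x + y` is defined if and only if the sum in `R` lies in
`⟨S ∪ {-1}⟩ ∪ {0}`. -/
def add (x y : RingPartialField R S) : Part (RingPartialField R S) :=
  ⟨x.val + y.val = 0 ∨ ∃ u ∈ Subgroup.closure (S ∪ {-1}), (u : R) = x.val + y.val,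
    fun h => ⟨x.val + y.val, h⟩⟩

theorem mem_add {x y z : RingPartialField R S} : z ∈ add x y ↔ z.val = x.val + y.val :=
  by
  constructor
  · rintro ⟨_, rfl⟩
    rfl
  · intro h
    have hz := z.property
    rw [h] at hz
    exact ⟨hz, RingPartialField.ext h.symm⟩

/-- The partial field `ℙ(R, S)`: multiplication and addition are the restrictions of those
of `R`. -/
noncomputable instance [Nontrivial R] : PartialField (RingPartialField R S) where
  zero := ⟨0, Or.inl rfl⟩
  one := ⟨1, Or.inr ⟨1, one_mem _, by simp⟩⟩
  mul x y := ⟨x.val * y.val, closed_mul x.property y.property⟩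
  neg x := ⟨-x.val, closed_neg x.property⟩
  inv x := ⟨Ring.inverse x.val, closed_inv x.property⟩
  padd := add
  mul_assoc x y z := RingPartialField.ext (mul_assoc x.val y.val z.val)
  mul_comm x y := RingPartialField.ext (mul_comm x.val y.val)
  one_mul x := RingPartialField.ext (one_mul x.val)
  mul_one x := RingPartialField.ext (mul_one x.val)
  zero_mul x := RingPartialField.ext (zero_mul x.val)
  mul_zero x := RingPartialField.ext (mul_zero x.val)
  exists_pair_ne := ⟨⟨0, Or.inl rfl⟩, ⟨1, Or.inr ⟨1, one_mem _, by simp⟩⟩,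
    fun h => zero_ne_one (congrArg RingPartialField.val h)⟩
  inv_zero := RingPartialField.ext (Ring.inverse_zero R)
  mul_inv_cancel x hx := by
    obtain ⟨x, rfl | ⟨u, hu, rfl⟩⟩ := x
    · exact absurd rfl hx
    · exact RingPartialField.ext (Ring.mul_inverse_cancel _ u.isUnit)
  padd_zero x := Part.eq_some_iff.2 (mem_add.2 (add_zero x.val).symm)
  zero_mem_padd_neg x := mem_add.2 (add_neg_cancel x.val).symm
  eq_neg_of_zero_mem_padd x y h :=
    RingPartialField.ext (eq_neg_of_add_eq_zero_right (mem_add.1 h).symm)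
  padd_comm x y := Part.ext fun z => by rw [mem_add, mem_add, add_comm]
  mul_padd p q r hp := by
    obtain ⟨p, rfl | ⟨u, hu, rfl⟩⟩ := p
    · exact absurd rfl hp
    refine Part.ext' ⟨fun h => ?_, fun h => ?_⟩ fun h₁ h₂ => RingPartialField.ext (mul_add _ _ _).symm
    · have h' : (u : R) * q.val + u * r.val = 0 ∨
          ∃ v ∈ Subgroup.closure (S ∪ {-1}), (v : R) = u * q.val + u * r.val := h
      have hinv : ((u⁻¹ : Rˣ) : R) = 0 ∨
          ∃ v ∈ Subgroup.closure (S ∪ {-1}), (v : R) = (u⁻¹ : Rˣ) :=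
        Or.inr ⟨u⁻¹, Subgroup.inv_mem _ hu, rfl⟩
      have key := closed_mul hinv h'
      rw [← mul_add, Units.inv_mul_cancel_left] at key
      exact key
    · have key := closed_mul (Or.inr ⟨u, hu, rfl⟩) h
      rw [mul_add] at key
      exact key
  associative_law A B r u w h hA hB := by
    have key : ∀ p q r : RingPartialField R S, r ∈ add p q → r.val = p.val + q.val :=
      fun p q r => mem_add.1
    have hr : r.val = u.val + w.val := by
      rw [PartialField.map_association _ key h, PartialField.map_association _ key hA,
        PartialField.map_association _ key hB, Multiset.map_add, Multiset.sum_add]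
    exact mem_add.2 hr

end RingPartialField

/-! ### The direct product -/

/-- The underlying set of the direct product `ℙ₁ ⊗ ℙ₂` of two partial fields. -/
@[ext]
structure ProdPartialField (P₁ P₂ : Type*) [PartialField P₁] [PartialField P₂] where
  /-- The first component. -/
  fst : P₁
  /-- The second component. -/
  snd : P₂
  ne_zero_iff : fst ≠ 0 ↔ snd ≠ 0

namespace ProdPartialField

variable {P₁ P₂ : Type*} [PartialField P₁] [PartialField P₂]

theorem neg_ne_zero_iff {P : Type*} [PartialField P] (p : P) : -p ≠ 0 ↔ p ≠ 0 := by
  refine not_congr ⟨fun h => ?_, fun h => ?_⟩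
  · have h₀ := PartialField.zero_mem_padd_neg p
    rw [h, PartialField.padd_zero, Part.mem_some_iff] at h₀
    exact h₀.symm
  · subst h
    refine (PartialField.eq_neg_of_zero_mem_padd (0 : P) 0 ?_).symm
    rw [PartialField.padd_zero]
    exact Part.mem_some 0

/-- Addition in `ℙ₁ ⊗ ℙ₂` is componentwise; `(p₁, p₂) + (q₁, q₂)` is defined if and only if both
`p₁ + q₁` and `p₂ + q₂` are defined, and one of these sums is `0` exactly when the other is. -/
def add (x y : ProdPartialField P₁ P₂) : Part (ProdPartialField P₁ P₂) :=
  (PartialField.padd x.fst y.fst).bind fun a =>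
    (PartialField.padd x.snd y.snd).bind fun b =>
      Part.assert (a ≠ 0 ↔ b ≠ 0) fun h => Part.some ⟨a, b, h⟩

theorem mem_add {x y z : ProdPartialField P₁ P₂} : z ∈ add x y ↔
    z.fst ∈ PartialField.padd x.fst y.fst ∧ z.snd ∈ PartialField.padd x.snd y.snd := by
  simp only [add, Part.mem_bind_iff, Part.mem_assert_iff]
  constructor
  · rintro ⟨a, ha, b, hb, h, hz⟩
    rw [Part.mem_some_iff] at hz
    subst hz
    exact ⟨ha, hb⟩
  · rintro ⟨h₁, h₂⟩
    exact ⟨_, h₁, _, h₂, z.ne_zero_iff, Part.mem_some _⟩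

theorem association_fst_snd {S : Multiset (ProdPartialField P₁ P₂)} {r : ProdPartialField P₁ P₂}
    (h : Association add S r) :
    Association PartialField.padd (S.map ProdPartialField.fst) r.fst ∧
      Association PartialField.padd (S.map ProdPartialField.snd) r.snd := by
  induction h with
  | leaf p => exact ⟨.leaf _, .leaf _⟩
  | node _ _ h ih₁ ih₂ =>
    rw [Multiset.map_add, Multiset.map_add]
    exact ⟨.node ih₁.1 ih₂.1 (mem_add.1 h).1, .node ih₁.2 ih₂.2 (mem_add.1 h).2⟩

theorem ne_zero_and_ne_zero {x : ProdPartialField P₁ P₂} (hx : x ≠ ⟨0, 0, by simp⟩) :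
    x.fst ≠ 0 ∧ x.snd ≠ 0 := by
  by_contra hc
  have hx₁ := x.ne_zero_iff
  have e₁ : x.fst = 0 := by tauto
  have e₂ : x.snd = 0 := by tauto
  exact hx (ProdPartialField.ext e₁ e₂)

/-- The direct product `ℙ₁ ⊗ ℙ₂`, with componentwise operations. -/
noncomputable instance : PartialField (ProdPartialField P₁ P₂) where
  zero := ⟨0, 0, by simp⟩
  one := ⟨1, 1, by simp⟩
  mul x y := ⟨x.fst * y.fst, x.snd * y.snd, by
    have hx := x.ne_zero_iff
    have hy := y.ne_zero_iff
    simp only [mul_ne_zero_iff]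
    rw [hx, hy]⟩
  neg x := ⟨-x.fst, -x.snd, by
    have hx := x.ne_zero_iff
    simpa only [neg_ne_zero_iff] using hx⟩
  inv x := ⟨x.fst⁻¹, x.snd⁻¹, by
    have hx := x.ne_zero_iff
    simpa only [ne_eq, inv_eq_zero] using hx⟩
  padd := add
  mul_assoc x y z := ProdPartialField.ext (mul_assoc _ _ _) (mul_assoc _ _ _)
  mul_comm x y := ProdPartialField.ext (mul_comm _ _) (mul_comm _ _)
  one_mul x := ProdPartialField.ext (one_mul _) (one_mul _)
  mul_one x := ProdPartialField.ext (mul_one _) (mul_one _)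
  zero_mul x := ProdPartialField.ext (zero_mul _) (zero_mul _)
  mul_zero x := ProdPartialField.ext (mul_zero _) (mul_zero _)
  exists_pair_ne := ⟨⟨0, 0, by simp⟩, ⟨1, 1, by simp⟩,
    fun h => zero_ne_one (congrArg ProdPartialField.fst h)⟩
  inv_zero := ProdPartialField.ext inv_zero inv_zero
  mul_inv_cancel x hx := ProdPartialField.ext (mul_inv_cancel₀ (ne_zero_and_ne_zero hx).1)
    (mul_inv_cancel₀ (ne_zero_and_ne_zero hx).2)
  padd_zero x := by
    refine Part.eq_some_iff.2 (mem_add.2 ⟨?_, ?_⟩)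
    · exact (PartialField.padd_zero x.fst).symm ▸ Part.mem_some _
    · exact (PartialField.padd_zero x.snd).symm ▸ Part.mem_some _
  zero_mem_padd_neg x := mem_add.2
    ⟨PartialField.zero_mem_padd_neg x.fst, PartialField.zero_mem_padd_neg x.snd⟩
  eq_neg_of_zero_mem_padd x y h := ProdPartialField.ext
    (PartialField.eq_neg_of_zero_mem_padd _ _ (mem_add.1 h).1)
    (PartialField.eq_neg_of_zero_mem_padd _ _ (mem_add.1 h).2)
  padd_comm x y := Part.ext fun z => by
    rw [mem_add, mem_add, PartialField.padd_comm x.fst, PartialField.padd_comm x.snd]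
  mul_padd p q r hp := by
    obtain ⟨h₁, h₂⟩ := ne_zero_and_ne_zero hp
    ext z
    rw [mem_add, Part.mem_map_iff]
    change z.fst ∈ PartialField.padd (p.fst * q.fst) (p.fst * r.fst) ∧
      z.snd ∈ PartialField.padd (p.snd * q.snd) (p.snd * r.snd) ↔ _
    rw [PartialField.mul_padd _ _ _ h₁, PartialField.mul_padd _ _ _ h₂, Part.mem_map_iff,
      Part.mem_map_iff]
    constructor
    · rintro ⟨⟨a, ha, hza⟩, b, hb, hzb⟩
      have hz := z.ne_zero_iff
      rw [← hza, ← hzb, mul_ne_zero_iff, mul_ne_zero_iff] at hz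
      exact ⟨⟨a, b, by tauto⟩, mem_add.2 ⟨ha, hb⟩, ProdPartialField.ext hza hzb⟩
    · rintro ⟨a, ha, rfl⟩
      exact ⟨⟨_, (mem_add.1 ha).1, rfl⟩, _, (mem_add.1 ha).2, rfl⟩
  associative_law A B r u w h hA hB := by
    have h' := association_fst_snd h
    rw [Multiset.map_add, Multiset.map_add] at h'
    exact mem_add.2
      ⟨PartialField.associative_law _ _ _ _ _ h'.1 (association_fst_snd hA).1
        (association_fst_snd hB).1,
      PartialField.associative_law _ _ _ _ _ h'.2 (association_fst_snd hA).2
        (association_fst_snd hB).2⟩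

end ProdPartialField

/-! ### The partial fields of the theorem -/

/-- The field `GF(4)`. -/
abbrev GF4 : Type := GaloisField 2 2

/-- The Gaussian partial field `ℍ₂ = ℙ(ℂ, {i, 1 - i})`. -/
abbrev GaussianPF : Type :=
  RingPartialField ℂ {Units.mk0 Complex.I Complex.I_ne_zero,
    Units.mk0 (1 - Complex.I) (fun h => by simpa using congrArg Complex.re h)}

theorem ratFunc_X_sub_one_ne_zero : (RatFunc.X - 1 : RatFunc ℚ) ≠ 0 := by
  have h : (RatFunc.X - 1 : RatFunc ℚ) =
      algebraMap (Polynomial ℚ) (RatFunc ℚ) (Polynomial.X - Polynomial.C 1) := by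
    simp
  rw [h]
  exact RatFunc.algebraMap_ne_zero (Polynomial.X_sub_C_ne_zero 1)

theorem ratFunc_X_add_one_ne_zero : (RatFunc.X + 1 : RatFunc ℚ) ≠ 0 := by
  have h : (RatFunc.X + 1 : RatFunc ℚ) =
      algebraMap (Polynomial ℚ) (RatFunc ℚ) (Polynomial.X + Polynomial.C 1) := by
    simp
  rw [h]
  exact RatFunc.algebraMap_ne_zero (Polynomial.X_add_C_ne_zero 1)

/-- The 2-cyclotomic partial field `𝕂₂ = ℙ(ℚ(α), {α, α - 1, α + 1})`. -/
abbrev TwoCyclotomicPF : Type :=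
  RingPartialField (RatFunc ℚ) {Units.mk0 RatFunc.X RatFunc.X_ne_zero,
    Units.mk0 (RatFunc.X - 1) ratFunc_X_sub_one_ne_zero,
    Units.mk0 (RatFunc.X + 1) ratFunc_X_add_one_ne_zero}

/-! This is an instance of the Lift Theorem of Pendavingh and Van Zwam. Evaluating `α` at a
generator `ω` of `GF(4)ˣ` and at `i` is a homomorphism of partial fields `𝕂₂ → GF(4) ⊗ ℍ₂`, so it
suffices to lift every matrix over `GF(4) ⊗ ℍ₂` entrywise to a matrix over `𝕂₂`.

A homomorphism `φ : Q → P` lifts matrices as soon as it lifts the fundamental elements of `P`, those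
`p` for which `1 - p` is defined, compatibly with quotients. The proof is by induction on the set of
rows and columns. If some row or column has at most one nonzero entry, or if the support, seen as a
bipartite graph, is disconnected or a cycle of length `4`, then lifts are easy to find. Otherwise,
possibly after a pivot, there are two columns (or two rows) `u`, `w` whose removal does not
disconnect the support. The lifts obtained by deleting `u` and by deleting `w` agree, up to scaling,
outside `u` and `w`, so they are the restrictions of a single matrix. Pivoting turns each of its
remaining minors into a 2×2 minor in the columns `u` and `w`. Further pivots shorten a path between
its two rows until these have a common nonzero position, and there the condition on quotients
applies.

Determinants are computed in a ring: a partial field embeds in the ring presented by its sums, and a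
sum is defined exactly when its value in that ring is in the partial field.

The fundamental elements of `𝕂₂` are found by evaluating `α` at `2`, `1/2` and `3`, which gives
solutions of `x + y = 1` in rational numbers `± 2 ^ m * 3 ^ n`. Those of `GF(4) ⊗ ℍ₂` correspond to
solutions of `x + y = 1` in complex numbers `i ^ k * (1 + i) ^ n`. In both cases they are `0`, `1`
and the associates of `α`, `-α` and `α ^ 2`, and the conditions on them become finite checks on
exponents. -/

/-! ### Minors and pivoting -/

namespace PartialField

open MonoidHom (mrange)
open scoped Matrix

section Minors

variable {P R X Y : Type*} [CommGroupWithZero P] [CommRing R] (v : P →*₀ R)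

/-- The minor of `A` with rows `f` and columns `g`, computed in the ring `R` along `v`. -/
def minor (A : Matrix X Y P) {k : ℕ} (f : Fin k → X) (g : Fin k → Y) : R :=
  ((A.submatrix f g).map v).det

/-- All minors of `A`, computed in the ring `R`, come from `P`. If `v` is an embedding of partial
fields then these are the `P`-matrices; see `isPMatrix_iff_minorsInRange`. -/
def MinorsInRange (A : Matrix X Y P) : Prop :=
  ∀ (k : ℕ) (f : Fin k → X) (g : Fin k → Y), minor v A f g ∈ mrange v

/-- `A'` is obtained from `A` by pivoting on the nonzero entry `(x, y)`. As `P` has neither negation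
nor addition, the relations that involve them are stated in `R`. -/
structure IsPivot (A : Matrix X Y P) (x : X) (y : Y) (A' : Matrix X Y P) : Prop where
  ne_zero : A x y ≠ 0
  entry : v (A' x y) * v (A x y) = -1
  row : ∀ j, j ≠ y → A' x j = A x j * (A x y)⁻¹
  col : ∀ i, i ≠ x → A' i y = A i y * (A x y)⁻¹
  other : ∀ i j, i ≠ x → j ≠ y → v (A' i j) = v (A i j) - v (A i y) * v (A x j) * v (A x y)⁻¹

/-- The class `𝒮` is closed under pivoting on nonzero entries outside the columns in `U`. -/
def PivotClosed (U : Set Y) (𝒮 : Set (Matrix X Y P)) : Prop :=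
  ∀ A ∈ 𝒮, ∀ x, ∀ y ∉ U, A x y ≠ 0 → ∃ A' ∈ 𝒮, IsPivot v A x y A'

variable {v}

theorem zero_mem_mrange : (0 : R) ∈ mrange v := ⟨0, map_zero v⟩

theorem map_mem_mrange (p : P) : v p ∈ mrange v := ⟨p, rfl⟩

theorem neg_mem_mrange (hneg : -1 ∈ mrange v) {r : R} (hr : r ∈ mrange v) : -r ∈ mrange v := by
  simpa using mul_mem hneg hr

theorem map_mul_map_inv {p : P} (hp : p ≠ 0) : v p * v p⁻¹ = 1 := by
  rw [← map_mul, mul_inv_cancel₀ hp, map_one]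

theorem map_mul_mem_mrange_iff {p : P} (hp : p ≠ 0) {r : R} :
    v p * r ∈ mrange v ↔ r ∈ mrange v := by
  refine ⟨fun h => ?_, mul_mem (map_mem_mrange p)⟩
  have h' := mul_mem (map_mem_mrange (v := v) p⁻¹) h
  rwa [← mul_assoc, mul_comm (v p⁻¹), map_mul_map_inv hp, one_mul] at h'

theorem minor_transpose (A : Matrix X Y P) {k : ℕ} (f : Fin k → X) (g : Fin k → Y) :
    minor v Aᵀ g f = minor v A f g :=
  Matrix.det_transpose ((A.submatrix f g).map v)

theorem minor_congr {A B : Matrix X Y P} {k : ℕ} {f : Fin k → X} {g : Fin k → Y}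
    (h : ∀ i j, A (f i) (g j) = B (f i) (g j)) : minor v A f g = minor v B f g :=
  congrArg (fun M : Matrix (Fin k) (Fin k) P => (M.map v).det) (Matrix.ext h)

theorem minor_eq_zero_of_row {A : Matrix X Y P} {k : ℕ} {f : Fin k → X} {g : Fin k → Y} (i : Fin k)
    (h : ∀ j, A (f i) (g j) = 0) : minor v A f g = 0 :=
  Matrix.det_eq_zero_of_row_eq_zero i fun j => by simp [h]

theorem minor_eq_zero_of_col {A : Matrix X Y P} {k : ℕ} {f : Fin k → X} {g : Fin k → Y} (j : Fin k)
    (h : ∀ i, A (f i) (g j) = 0) : minor v A f g = 0 :=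
  Matrix.det_eq_zero_of_column_eq_zero j fun i => by simp [h]

theorem minor_eq_zero_of_not_injective_left (A : Matrix X Y P) {k : ℕ} {f : Fin k → X}
    (hf : ¬ f.Injective) (g : Fin k → Y) : minor v A f g = 0 := by
  obtain ⟨i, j, h, hij⟩ := Function.not_injective_iff.1 hf
  exact Matrix.det_zero_of_row_eq hij (by ext; simp [h])

theorem minor_eq_zero_of_not_injective_right (A : Matrix X Y P) {k : ℕ} (f : Fin k → X)
    {g : Fin k → Y} (hg : ¬ g.Injective) : minor v A f g = 0 := by
  rw [← minor_transpose, minor_eq_zero_of_not_injective_left _ hg]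

theorem minor_fin_two (A : Matrix X Y P) (f : Fin 2 → X) (g : Fin 2 → Y) : minor v A f g =
    v (A (f 0) (g 0)) * v (A (f 1) (g 1)) - v (A (f 0) (g 1)) * v (A (f 1) (g 0)) :=
  Matrix.det_fin_two _

theorem minor_mem_of_injective {A : Matrix X Y P} {k : ℕ} {f : Fin k → X} {g : Fin k → Y}
    (h : f.Injective → g.Injective → minor v A f g ∈ mrange v) : minor v A f g ∈ mrange v := by
  by_cases hf : f.Injective
  · by_cases hg : g.Injective
    · exact h hf hg
    · rw [minor_eq_zero_of_not_injective_right _ _ hg]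
      exact zero_mem_mrange
  · rw [minor_eq_zero_of_not_injective_left _ hf]
    exact zero_mem_mrange

theorem minor_mem_of_mem_pair (hneg : -1 ∈ mrange v) {A : Matrix X Y P} {u w : Y}
    (h₂ : ∀ a b, v (A a u) * v (A b w) - v (A a w) * v (A b u) ∈ mrange v)
    {k : ℕ} (f : Fin k → X) (g : Fin k → Y) (hg : ∀ j, g j ∈ ({u, w} : Set Y)) :
    minor v A f g ∈ mrange v := by
  classical
  refine minor_mem_of_injective fun _ hinj => ?_
  have hk : k ≤ 2 := calc
    k = (Finset.univ.image g).card := by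
      rw [Finset.card_image_of_injective _ hinj, Finset.card_univ, Fintype.card_fin]
    _ ≤ ({u, w} : Finset Y).card := Finset.card_le_card fun y hy => by
      obtain ⟨j, -, rfl⟩ := Finset.mem_image.1 hy
      simpa using hg j
    _ ≤ 2 := Finset.card_le_two
  interval_cases k
  · rw [minor, Matrix.det_fin_zero]
    exact one_mem _
  · rw [minor, Matrix.det_fin_one]
    exact map_mem_mrange _
  · have hne : g 0 ≠ g 1 := fun h => by simpa using hinj h
    rw [minor_fin_two]
    rcases hg 0 with h0 | h0 <;> rcases hg 1 with h1 | h1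
    · exact absurd (h0.trans h1.symm) hne
    · rw [h0, h1]
      exact h₂ _ _
    · rw [h0, h1, ← neg_sub]
      exact neg_mem_mrange hneg (h₂ _ _)
    · exact absurd (h0.trans h1.symm) hne

end Minors

section MinorsInRange

variable {P R X Y : Type*} [CommGroupWithZero P] [CommRing R] {v : P →*₀ R} {A : Matrix X Y P}

namespace MinorsInRange

theorem transpose (hA : MinorsInRange v A) : MinorsInRange v Aᵀ := by
  intro k f g
  rw [minor_transpose]
  exact hA _ _ _

theorem submatrix {X' Y' : Type*} (hA : MinorsInRange v A) (a : X' → X) (b : Y' → Y) :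
    MinorsInRange v (A.submatrix a b) :=
  fun k f g => hA k (a ∘ f) (b ∘ g)

theorem scale (hA : MinorsInRange v A) (s : X → P) (t : Y → P) :
    MinorsInRange v (Matrix.of fun i j => s i * A i j * t j) := by
  intro k f g
  have hminor : minor v (Matrix.of fun i j => s i * A i j * t j) f g =
      (∏ i, v (s (f i))) * ((∏ j, v (t (g j))) * minor v A f g) := by
    simp only [minor]
    rw [← Matrix.det_mul_row, ← Matrix.det_mul_column]
    congr 1
    ext i j
    simp only [Matrix.map_apply, Matrix.submatrix_apply, Matrix.of_apply, map_mul]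
    ring
  rw [hminor]
  exact mul_mem (prod_mem fun _ _ => map_mem_mrange _)
    (mul_mem (prod_mem fun _ _ => map_mem_mrange _) (hA _ _ _))

theorem two_by_two (hA : MinorsInRange v A) (a b : X) (u w : Y) :
    v (A a u) * v (A b w) - v (A a w) * v (A b u) ∈ mrange v := by
  have h := hA 2 ![a, b] ![u, w]
  rwa [minor_fin_two] at h

end MinorsInRange

end MinorsInRange

theorem det_eq_mul_det_schurComplement {R : Type*} [CommRing R] {k : ℕ}
    (M : Matrix (Fin (k + 1)) (Fin (k + 1)) R) (p q : Fin (k + 1)) {a : R} (ha : M p q * a = 1) :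
    M.det = (-1) ^ (p + q : ℕ) * M p q * (Matrix.of fun i j =>
      M (p.succAbove i) (q.succAbove j) - M (p.succAbove i) q * a * M p (q.succAbove j)).det := by
  let B : Matrix (Fin (k + 1)) (Fin (k + 1)) R := Matrix.of fun i j =>
    if i = p then M p j else M i j - M i q * a * M p j
  have hdet : M.det = B.det := by
    refine Matrix.det_eq_of_forall_row_eq_smul_add_const
      (fun i => if i = p then 0 else M i q * a) p (by simp) fun i j => ?_
    by_cases hi : i = p
    · subst hi
      simp [B]
    · simp [B, hi]
  rw [hdet, Matrix.det_succ_column B q, Finset.sum_eq_single p]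
  · congr 2
    · simp [B]
    · ext i j
      simp [B, Fin.succAbove_ne]
  · intro i _ hi
    have hiq : B i q = 0 := by
      simp only [B, Matrix.of_apply, if_neg hi]
      linear_combination (-M i q) * ha
    simp [hiq]
  · simp

section Pivot

variable {P R X Y : Type*} [CommGroupWithZero P] [CommRing R] {v : P →*₀ R}
  {A A' : Matrix X Y P} {x : X} {y : Y}

namespace IsPivot

theorem transpose (h : IsPivot v A x y A') : IsPivot v Aᵀ y x A'ᵀ where
  ne_zero := h.ne_zero
  entry := h.entry
  row := h.col
  col := h.row
  other i j hi hj := by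
    simp only [Matrix.transpose_apply]
    rw [h.other j i hj hi, mul_comm (v (A j y))]

theorem minor_pivoted_of_row_of_col (h : IsPivot v A x y A') {k : ℕ} {f : Fin (k + 1) → X}
    {g : Fin (k + 1) → Y} (hf : f.Injective) (hg : g.Injective) {p q : Fin (k + 1)}
    (hp : f p = x) (hq : g q = y) :
    minor v A' f g = (-1) ^ (p + q : ℕ) * v (A' x y) *
      minor v A (f ∘ p.succAbove) (g ∘ q.succAbove) := by
  subst hp hq
  rw [minor, det_eq_mul_det_schurComplement _ p q (a := -v (A (f p) (g q))) (by
    simp only [Matrix.map_apply, Matrix.submatrix_apply]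
    linear_combination -h.entry)]
  simp only [Matrix.map_apply, Matrix.submatrix_apply, minor]
  congr 2
  ext i j
  have hi : f (p.succAbove i) ≠ f p := fun e => Fin.succAbove_ne p i (hf e)
  have hj : g (q.succAbove j) ≠ g q := fun e => Fin.succAbove_ne q j (hg e)
  simp only [Matrix.of_apply, Matrix.map_apply, Matrix.submatrix_apply, Function.comp_apply]
  rw [h.other _ _ hi hj, h.row _ hj, h.col _ hi, map_mul, map_mul]
  linear_combination (v (A (f (p.succAbove i)) (g q)) * v (A (f p) (g (q.succAbove j))) *
    v (A (f p) (g q))⁻¹) * map_mul_map_inv (v := v) h.ne_zero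

theorem minor_of_row_of_col (h : IsPivot v A x y A') {k : ℕ} {f : Fin (k + 1) → X}
    {g : Fin (k + 1) → Y} (hf : f.Injective) (hg : g.Injective) {p q : Fin (k + 1)}
    (hp : f p = x) (hq : g q = y) :
    minor v A f g = (-1) ^ (p + q : ℕ) * v (A x y) *
      minor v A' (f ∘ p.succAbove) (g ∘ q.succAbove) := by
  subst hp hq
  rw [minor, det_eq_mul_det_schurComplement _ p q (map_mul_map_inv h.ne_zero)]
  simp only [Matrix.map_apply, Matrix.submatrix_apply, minor]
  congr 2
  ext i j
  have hi : f (p.succAbove i) ≠ f p := fun e => Fin.succAbove_ne p i (hf e)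
  have hj : g (q.succAbove j) ≠ g q := fun e => Fin.succAbove_ne q j (hg e)
  simp only [Matrix.of_apply, Matrix.map_apply, Matrix.submatrix_apply, Function.comp_apply]
  rw [h.other _ _ hi hj]
  ring

theorem minor_pivoted_of_row (h : IsPivot v A x y A') {k : ℕ} {f : Fin k → X} {g : Fin k → Y}
    (hf : f.Injective) {p : Fin k} (hp : f p = x) (hy : ∀ j, g j ≠ y) :
    minor v A' f g = v (A x y)⁻¹ * minor v A f g := by
  subst hp
  let C : Matrix (Fin k) (Fin k) R := Matrix.of fun i j =>
    v (A (f i) (g j)) - if i = p then 0 else v (A (f i) y) * v (A (f p) (g j)) * v (A (f p) y)⁻¹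
  have hA : minor v A f g = C.det := by
    refine Matrix.det_eq_of_forall_row_eq_smul_add_const
      (fun i => if i = p then 0 else v (A (f i) y) * v (A (f p) y)⁻¹) p (by simp) fun i j => ?_
    by_cases hi : i = p
    · simp [C, hi]
    · simp only [C, hi, Matrix.of_apply, Matrix.map_apply, Matrix.submatrix_apply, if_false,
        if_true]
      ring
  have hA' : minor v A' f g = (Matrix.of fun i j =>
      (if i = p then v (A (f p) y)⁻¹ else 1) * C i j).det := by
    unfold minor
    congr 1
    ext i j
    by_cases hi : i = p
    · subst hi
      simp [C, h.row _ (hy j), mul_comm]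
    · have hfi : f i ≠ f p := fun e => hi (hf e)
      simp [C, hi, h.other _ _ hfi (hy j)]
  rw [hA', Matrix.det_mul_column, hA]
  congr 1
  simp

theorem minor_pivoted_of_col (h : IsPivot v A x y A') {k : ℕ} {f : Fin k → X} {g : Fin k → Y}
    (hg : g.Injective) {q : Fin k} (hq : g q = y) (hx : ∀ i, f i ≠ x) :
    minor v A' f g = v (A x y)⁻¹ * minor v A f g := by
  rw [← minor_transpose, h.transpose.minor_pivoted_of_row hg hq hx, minor_transpose,
    Matrix.transpose_apply]

theorem minor_cons_cons (h : IsPivot v A x y A') {k : ℕ} {f : Fin k → X} {g : Fin k → Y}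
    (hf : f.Injective) (hg : g.Injective) (hx : ∀ i, f i ≠ x) (hy : ∀ j, g j ≠ y) :
    minor v A (Fin.cons x f : Fin (k + 1) → X) (Fin.cons y g : Fin (k + 1) → Y) =
      v (A x y) * minor v A' f g := by
  rw [h.minor_of_row_of_col (p := 0) (q := 0) (Fin.cons_injective_iff.2 ⟨by simpa using hx, hf⟩)
    (Fin.cons_injective_iff.2 ⟨by simpa using hy, hg⟩) rfl rfl]
  simp [Function.comp_def]

end IsPivot

theorem MinorsInRange.of_isPivot (hneg : -1 ∈ mrange v) (hA : MinorsInRange v A)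
    (h : IsPivot v A x y A') : MinorsInRange v A' := by
  refine fun k f g => minor_mem_of_injective fun hf hg => ?_
  by_cases hx : ∃ p, f p = x <;> by_cases hy : ∃ q, g q = y
  · obtain ⟨p, hp⟩ := hx
    obtain ⟨q, hq⟩ := hy
    obtain _ | k := k
    · exact p.elim0
    rw [h.minor_pivoted_of_row_of_col hf hg hp hq]
    exact mul_mem (mul_mem (pow_mem hneg _) (map_mem_mrange _)) (hA _ _ _)
  · obtain ⟨p, hp⟩ := hx
    rw [h.minor_pivoted_of_row hf hp (not_exists.1 hy)]
    exact mul_mem (map_mem_mrange _) (hA _ _ _)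
  · obtain ⟨q, hq⟩ := hy
    rw [h.minor_pivoted_of_col hg hq (not_exists.1 hx)]
    exact mul_mem (map_mem_mrange _) (hA _ _ _)
  · rw [← map_mul_mem_mrange_iff h.ne_zero,
      ← h.minor_cons_cons hf hg (not_exists.1 hx) (not_exists.1 hy)]
    exact hA _ _ _

theorem exists_isPivot_of_two_by_two (hneg : -1 ∈ mrange v) (hxy : A x y ≠ 0)
    (h₂ : ∀ i j, v (A x y) * v (A i j) - v (A x j) * v (A i y) ∈ mrange v) :
    ∃ A', IsPivot v A x y A' := by
  classical
  obtain ⟨m, hm⟩ := hneg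
  have hother : ∀ i j, ∃ r : P, v r = v (A i j) - v (A i y) * v (A x j) * v (A x y)⁻¹ := by
    intro i j
    refine (map_mul_mem_mrange_iff hxy).1 ?_
    convert h₂ i j using 1
    linear_combination (-v (A i y) * v (A x j)) * map_mul_map_inv (v := v) hxy
  choose r hr using hother
  refine ⟨Matrix.of fun i j => if i = x then if j = y then m * (A x y)⁻¹ else A x j * (A x y)⁻¹ else
    if j = y then A i y * (A x y)⁻¹ else r i j, hxy, ?_, ?_, ?_, ?_⟩
  · have hm' : v m = -1 := hm
    simp only [Matrix.of_apply, if_true, map_mul, hm']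
    linear_combination -(map_mul_map_inv (v := v) hxy)
  · intro j hj
    simp [hj]
  · intro i hi
    simp [hi]
  · intro i j hi hj
    simp [hi, hj, hr]

theorem MinorsInRange.exists_isPivot (hneg : -1 ∈ mrange v) (hA : MinorsInRange v A)
    (hxy : A x y ≠ 0) : ∃ A', IsPivot v A x y A' :=
  exists_isPivot_of_two_by_two hneg hxy fun i j => hA.two_by_two x i y j

/-- Expanding along a pivot in a column outside `U` lowers the order of a minor, until only columns
in `U` are left. -/
theorem PivotClosed.minorsInRange (hneg : -1 ∈ mrange v) {U : Set Y} {𝒮 : Set (Matrix X Y P)}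
    (h𝒮 : PivotClosed v U 𝒮) (hU : ∀ A ∈ 𝒮, ∀ (k : ℕ) (f : Fin k → X) (g : Fin k → Y),
      (∀ j, g j ∈ U) → minor v A f g ∈ mrange v) (hA : A ∈ 𝒮) : MinorsInRange v A := by
  intro k
  induction k generalizing A with
  | zero => exact fun f g => hU A hA 0 f g fun j => j.elim0
  | succ k ih =>
    refine fun f g => minor_mem_of_injective fun hf hg => ?_
    by_cases hgU : ∀ j, g j ∈ U
    · exact hU A hA _ f g hgU
    push Not at hgU
    obtain ⟨q, hq⟩ := hgU
    by_cases hcol : ∀ i, A (f i) (g q) = 0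
    · rw [minor_eq_zero_of_col q hcol]
      exact zero_mem_mrange
    · push Not at hcol
      obtain ⟨p, hp⟩ := hcol
      obtain ⟨A', hA', hpivot⟩ := h𝒮 A hA _ _ hq hp
      rw [hpivot.minor_of_row_of_col hf hg rfl rfl]
      exact mul_mem (mul_mem (pow_mem hneg _) (map_mem_mrange _)) (ih hA' _ _)

theorem PivotClosed.minorsInRange_of_empty (hneg : -1 ∈ mrange v) {𝒮 : Set (Matrix X Y P)}
    (h𝒮 : PivotClosed v ∅ 𝒮) (hA : A ∈ 𝒮) : MinorsInRange v A := by
  refine h𝒮.minorsInRange hneg (fun A _ k f g hg => ?_) hA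
  obtain _ | k := k
  · rw [minor, Matrix.det_fin_zero]
    exact one_mem _
  · exact (hg 0).elim

end Pivot

end PartialField

/-! ### Masks, supports and blocks -/

namespace PartialField

open Sum
open MonoidHom (mrange)
open scoped Matrix

section Mask

variable {P X Y : Type*} [Zero P]

open Classical in
/-- The matrix `A` with all entries outside the rows and columns in `W` replaced by `0`. Rows and
columns are deleted in this way so that the index types do not change. -/
noncomputable def mask (W : Set (X ⊕ Y)) (A : Matrix X Y P) : Matrix X Y P :=
  Matrix.of fun x y => if inl x ∈ W ∧ inr y ∈ W then A x y else 0

/-- All nonzero entries of `A` are in rows and columns in `W`. -/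
def SupportedOn (A : Matrix X Y P) (W : Set (X ⊕ Y)) : Prop :=
  ∀ x y, A x y ≠ 0 → inl x ∈ W ∧ inr y ∈ W

/-- `A` is a block diagonal matrix whose blocks have rows and columns in `C` and in `Cᶜ`. -/
def IsBlockDiagonal (A : Matrix X Y P) (C : Set (X ⊕ Y)) : Prop :=
  ∀ x y, A x y ≠ 0 → (inl x ∈ C ↔ inr y ∈ C)

variable {A A' : Matrix X Y P} {W : Set (X ⊕ Y)} {x : X} {y : Y}

theorem mask_of_mem (hx : inl x ∈ W) (hy : inr y ∈ W) : mask W A x y = A x y := if_pos ⟨hx, hy⟩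

theorem mask_of_row_notMem (hx : inl x ∉ W) : mask W A x y = 0 := if_neg fun h => hx h.1

theorem mask_of_col_notMem (hy : inr y ∉ W) : mask W A x y = 0 := if_neg fun h => hy h.2

theorem mask_compl_of_ne {u : Y} (hy : y ≠ u) : mask {inr u}ᶜ A x y = A x y :=
  mask_of_mem (by simp) (by simpa using hy)

theorem mask_ne_zero_iff : mask W A x y ≠ 0 ↔ inl x ∈ W ∧ inr y ∈ W ∧ A x y ≠ 0 := by
  simp only [mask, Matrix.of_apply, ne_eq, ite_eq_right_iff, Classical.not_imp, and_assoc]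

theorem mask_congr (h : ∀ x y, inl x ∈ W → inr y ∈ W → A x y = A' x y) : mask W A = mask W A' := by
  classical
  ext x y
  exact if_ctx_congr Iff.rfl (fun hW => h x y hW.1 hW.2) fun _ => rfl

theorem mask_transpose (A : Matrix X Y P) (W : Set (X ⊕ Y)) :
    mask (Sum.swap ⁻¹' W) Aᵀ = (mask W A)ᵀ := by
  classical
  ext j i
  exact if_congr and_comm rfl rfl

theorem map_mask {Q F : Type*} [Zero Q] [FunLike F Q P] [ZeroHomClass F Q P] (φ : F)
    (W : Set (X ⊕ Y)) (B : Matrix X Y Q) : (mask W B).map φ = mask W (B.map φ) := by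
  classical
  ext x y
  exact (apply_ite φ _ _ _).trans (if_congr Iff.rfl rfl (map_zero φ))

theorem SupportedOn.mask (hA : SupportedOn A W) (W' : Set (X ⊕ Y)) :
    SupportedOn (mask W' A) (W ∩ W') := by
  intro x y hxy
  obtain ⟨hx, hy, hne⟩ := mask_ne_zero_iff.1 hxy
  exact ⟨⟨(hA x y hne).1, hx⟩, (hA x y hne).2, hy⟩

theorem SupportedOn.transpose (hA : SupportedOn A W) : SupportedOn Aᵀ (Sum.swap ⁻¹' W) :=
  fun y x hxy => (hA x y hxy).symm

theorem SupportedOn.mask_eq_self (hA : SupportedOn A W) : PartialField.mask W A = A := by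
  ext x y
  by_cases hxy : A x y = 0
  · simp [PartialField.mask, hxy]
  · exact mask_of_mem (hA x y hxy).1 (hA x y hxy).2

theorem IsBlockDiagonal.compl {C : Set (X ⊕ Y)} (hA : IsBlockDiagonal A C) :
    IsBlockDiagonal A Cᶜ :=
  fun x y hxy => not_congr (hA x y hxy)

end Mask

section Pivot

variable {P R X Y : Type*} [CommGroupWithZero P] [CommRing R] {v : P →*₀ R}
  {A A' : Matrix X Y P} {x : X} {y : Y}

namespace IsPivot

theorem mask (h : IsPivot v A x y A') {W : Set (X ⊕ Y)} (hx : inl x ∈ W) (hy : inr y ∈ W) :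
    IsPivot v (mask W A) x y (mask W A') where
  ne_zero := by
    rw [mask_of_mem hx hy]
    exact h.ne_zero
  entry := by
    rw [mask_of_mem hx hy, mask_of_mem hx hy]
    exact h.entry
  row j hj := by
    by_cases hW : inr j ∈ W
    · simp only [mask_of_mem hx, hW, hy, h.row j hj]
    · simp only [mask_of_col_notMem hW, zero_mul]
  col i hi := by
    by_cases hW : inl i ∈ W
    · simp only [mask_of_mem _ hy, hW, hx, h.col i hi]
    · simp only [mask_of_row_notMem hW, zero_mul]
  other i j hi hj := by
    by_cases hW : inl i ∈ W
    · by_cases hW' : inr j ∈ W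
      · simp only [mask_of_mem, hW, hW', hx, hy, h.other i j hi hj]
      · simp [mask_of_col_notMem hW']
    · simp [mask_of_row_notMem hW]

theorem unique (hinj : Function.Injective v) {A₁ A₂ : Matrix X Y P} (h₁ : IsPivot v A x y A₁)
    (h₂ : IsPivot v A x y A₂) : A₁ = A₂ := by
  ext i j
  by_cases hi : i = x
  · subst hi
    by_cases hj : j = y
    · subst hj
      apply hinj
      linear_combination v (A i j)⁻¹ * (h₁.entry - h₂.entry) -
        (v (A₁ i j) - v (A₂ i j)) * map_mul_map_inv (v := v) h₁.ne_zero
    · rw [h₁.row j hj, h₂.row j hj]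
  · by_cases hj : j = y
    · subst hj
      rw [h₁.col i hi, h₂.col i hi]
    · apply hinj
      rw [h₁.other i j hi hj, h₂.other i j hi hj]

theorem pivoted_ne_zero (hinj : Function.Injective v) (h : IsPivot v A x y A') : A' x y ≠ 0 := by
  intro h0
  have hentry := h.entry
  rw [h0, map_zero, zero_mul] at hentry
  have hone : v 1 = v 0 := by
    rw [map_one, map_zero]
    linear_combination hentry
  exact one_ne_zero (hinj hone)

theorem row_ne_zero_iff (hinj : Function.Injective v) (h : IsPivot v A x y A') (j : Y) :
    A' x j ≠ 0 ↔ A x j ≠ 0 := by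
  by_cases hj : j = y
  · subst hj
    exact iff_of_true (h.pivoted_ne_zero hinj) h.ne_zero
  · rw [h.row j hj, mul_ne_zero_iff, and_iff_left (inv_ne_zero h.ne_zero)]

theorem col_ne_zero_iff (hinj : Function.Injective v) (h : IsPivot v A x y A') (i : X) :
    A' i y ≠ 0 ↔ A i y ≠ 0 :=
  h.transpose.row_ne_zero_iff hinj i

theorem row_eq (hinj : Function.Injective v) (h : IsPivot v A x y A') {i : X} (hi : A i y = 0)
    (j : Y) : A' i j = A i j := by
  have hix : i ≠ x := by
    rintro rfl
    exact h.ne_zero hi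
  by_cases hj : j = y
  · subst hj
    rw [h.col i hix, hi, zero_mul]
  · apply hinj
    rw [h.other i j hix hj, hi, map_zero]
    ring

theorem col_eq (hinj : Function.Injective v) (h : IsPivot v A x y A') {j : Y} (hj : A x j = 0)
    (i : X) : A' i j = A i j :=
  h.transpose.row_eq hinj hj i

theorem ne_zero_of_eq_zero (hinj : Function.Injective v) (h : IsPivot v A x y A') {i : X} {j : Y}
    (hij : A i j = 0) (hi : A i y ≠ 0) (hj : A x j ≠ 0) : A' i j ≠ 0 := by
  have hix : i ≠ x := by
    rintro rfl
    exact hj hij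
  have hjy : j ≠ y := by
    rintro rfl
    exact hi hij
  intro h0
  have hother := h.other i j hix hjy
  rw [h0, hij, map_zero, zero_sub, eq_comm, neg_eq_zero, ← map_mul, ← map_mul,
    map_eq_zero_iff v hinj] at hother
  exact mul_ne_zero (mul_ne_zero hi hj) (inv_ne_zero h.ne_zero) hother

theorem supportedOn (hinj : Function.Injective v) (h : IsPivot v A x y A') {W : Set (X ⊕ Y)}
    (hA : SupportedOn A W) : SupportedOn A' W := by
  intro i j hij
  constructor
  · by_cases hi : A i y = 0
    · rw [h.row_eq hinj hi] at hij
      exact (hA i j hij).1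
    · exact (hA i y hi).1
  · by_cases hj : A x j = 0
    · rw [h.col_eq hinj hj] at hij
      exact (hA i j hij).2
    · exact (hA x j hj).2

theorem isPivot_pivoted (hinj : Function.Injective v) [DecidableEq X] [DecidableEq Y] {m : P}
    (hm : v m = -1) (h : IsPivot v A x y A') : IsPivot v A' x y
      (Matrix.of fun i j => (if i = x then m else 1) * A i j * (if j = y then m else 1)) := by
  have hinv := map_mul_map_inv (v := v) h.ne_zero
  have hentry : (A' x y)⁻¹ = m * A x y := by
    refine inv_eq_of_mul_eq_one_right (hinj ?_)
    simp only [map_mul, hm, map_one]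
    linear_combination -h.entry
  refine ⟨h.pivoted_ne_zero hinj, ?_, fun j hj => ?_, fun i hi => ?_, fun i j hi hj => ?_⟩
  · simp only [Matrix.of_apply, if_true, map_mul, hm]
    linear_combination h.entry
  · simp only [Matrix.of_apply, hj, if_true, if_false, mul_one]
    rw [hentry, h.row j hj]
    field_simp [h.ne_zero]
  · simp only [Matrix.of_apply, hi, if_true, if_false, one_mul]
    rw [hentry, h.col i hi]
    field_simp [h.ne_zero]
  · simp only [Matrix.of_apply, hi, hj, if_false, one_mul, mul_one]
    rw [hentry, h.row j hj, h.col i hi, h.other i j hi hj]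
    simp only [map_mul, hm]
    linear_combination (-v (A i y) * v (A x j) * v (A x y)⁻¹) * hinv

open Classical in
theorem of_isBlockDiagonal {C : Set (X ⊕ Y)} {D : Matrix X Y P} (hA : IsBlockDiagonal A C)
    (hx : inl x ∈ C) (hxy : A x y ≠ 0) (hD : IsPivot v (PartialField.mask C A) x y D) :
    IsPivot v A x y (Matrix.of fun i j => if inl i ∈ C ∧ inr j ∈ C then D i j else A i j) := by
  have hy : inr y ∈ C := (hA x y hxy).1 hx
  have hrow : ∀ j, inr j ∉ C → A x j = 0 := fun j hj =>
    of_not_not fun hne => hj ((hA x j hne).1 hx)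
  have hcol : ∀ i, inl i ∉ C → A i y = 0 := fun i hi =>
    of_not_not fun hne => hi ((hA i y hne).2 hy)
  refine ⟨hxy, ?_, fun j hj => ?_, fun i hi => ?_, fun i j hi hj => ?_⟩
  · simpa [hx, hy, mask_of_mem] using hD.entry
  · by_cases hC : inr j ∈ C
    · simpa [hx, hy, hC, mask_of_mem] using hD.row j hj
    · simp [hC, hrow j hC]
  · by_cases hC : inl i ∈ C
    · simpa [hx, hy, hC, mask_of_mem] using hD.col i hi
    · simp [hC, hcol i hC]
  · by_cases hC : inl i ∈ C
    · by_cases hC' : inr j ∈ C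
      · simpa [hx, hy, hC, hC', mask_of_mem] using hD.other i j hi hj
      · simp [hC', hrow j hC']
    · simp [hC, hcol i hC]

end IsPivot

namespace MinorsInRange

theorem mask (hA : MinorsInRange v A) (W : Set (X ⊕ Y)) : MinorsInRange v (mask W A) := by
  intro k f g
  by_cases hf : ∀ i, inl (f i) ∈ W
  · by_cases hg : ∀ j, inr (g j) ∈ W
    · rw [minor_congr fun i j => mask_of_mem (hf i) (hg j)]
      exact hA _ _ _
    · push Not at hg
      obtain ⟨j, hj⟩ := hg
      rw [minor_eq_zero_of_col j fun i => mask_of_col_notMem hj]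
      exact zero_mem_mrange
  · push Not at hf
    obtain ⟨i, hi⟩ := hf
    rw [minor_eq_zero_of_row i fun j => mask_of_row_notMem hi]
    exact zero_mem_mrange

theorem zero : MinorsInRange v (0 : Matrix X Y P) := by
  intro k f g
  obtain _ | k := k
  · rw [minor, Matrix.det_fin_zero]
    exact one_mem _
  · rw [minor_eq_zero_of_row 0 fun _ => rfl]
    exact zero_mem_mrange

theorem exists_isPivot_of_isBlockDiagonal (hneg : -1 ∈ mrange v) {C : Set (X ⊕ Y)}
    (hA : IsBlockDiagonal A C) (h₁ : MinorsInRange v (PartialField.mask C A))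
    (h₂ : MinorsInRange v (PartialField.mask Cᶜ A)) (hx : inl x ∈ C) (hxy : A x y ≠ 0) :
    ∃ A', (IsBlockDiagonal A' C ∧ MinorsInRange v (PartialField.mask C A') ∧
      MinorsInRange v (PartialField.mask Cᶜ A')) ∧ IsPivot v A x y A' := by
  classical
  have hy := (hA x y hxy).1 hx
  obtain ⟨D, hD⟩ := h₁.exists_isPivot hneg (x := x) (y := y) (by rwa [mask_of_mem hx hy])
  refine ⟨_, ⟨fun i j hij => ?_, ?_, ?_⟩, hD.of_isBlockDiagonal hA hx hxy⟩
  · by_cases hC : inl i ∈ C ∧ inr j ∈ C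
    · exact iff_of_true hC.1 hC.2
    · rw [Matrix.of_apply, if_neg hC] at hij
      exact hA i j hij
  · convert (h₁.of_isPivot hneg hD).mask C using 1
    exact mask_congr fun i j hi hj => if_pos ⟨hi, hj⟩
  · convert h₂ using 1
    exact mask_congr fun i j hi _ => if_neg fun hC => hi hC.1

theorem of_isBlockDiagonal (hneg : -1 ∈ mrange v) {C : Set (X ⊕ Y)} (hA : IsBlockDiagonal A C)
    (h₁ : MinorsInRange v (PartialField.mask C A)) (h₂ : MinorsInRange v (PartialField.mask Cᶜ A)) :
    MinorsInRange v A := by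
  refine PivotClosed.minorsInRange_of_empty hneg (𝒮 := {A | IsBlockDiagonal A C ∧
    MinorsInRange v (PartialField.mask C A) ∧ MinorsInRange v (PartialField.mask Cᶜ A)}) ?_
    ⟨hA, h₁, h₂⟩
  rintro A ⟨hA, h₁, h₂⟩ x y - hxy
  by_cases hx : inl x ∈ C
  · exact exists_isPivot_of_isBlockDiagonal hneg hA h₁ h₂ hx hxy
  · obtain ⟨A', ⟨hA', h₁', h₂'⟩, hp⟩ := exists_isPivot_of_isBlockDiagonal hneg hA.compl h₂
      (by rwa [compl_compl]) hx hxy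
    rw [compl_compl] at h₂'
    exact ⟨A', ⟨by simpa only [compl_compl] using hA'.compl, h₂', h₁'⟩, hp⟩

end MinorsInRange

theorem minor_eq_mul_minor_of_col {k : ℕ} {f : Fin (k + 1) → X} {g : Fin (k + 1) → Y}
    (p q : Fin (k + 1)) (h : ∀ i, i ≠ p → A (f i) (g q) = 0) :
    minor v A f g = (-1) ^ (p + q : ℕ) * v (A (f p) (g q)) *
      minor v A (f ∘ p.succAbove) (g ∘ q.succAbove) := by
  rw [minor, Matrix.det_succ_column _ q, Finset.sum_eq_single p]
  · rfl
  · intro i _ hi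
    simp [h i hi]
  · simp

theorem MinorsInRange.of_unit_col (hneg : -1 ∈ mrange v) {u : Y} {x₀ : X}
    (hA : MinorsInRange v (PartialField.mask {inr u}ᶜ A)) (hu : ∀ x, x ≠ x₀ → A x u = 0) :
    MinorsInRange v A := by
  have avoiding : ∀ {k : ℕ} (f : Fin k → X) (g : Fin k → Y), (∀ j, g j ≠ u) →
      minor v A f g ∈ mrange v := fun f g hg => by
    rw [← minor_congr fun i j => mask_compl_of_ne (hg j)]
    exact hA _ f g
  refine fun k f g => minor_mem_of_injective fun hf hg => ?_
  by_cases hgu : ∀ j, g j ≠ u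
  · exact avoiding f g hgu
  push Not at hgu
  obtain ⟨q, rfl⟩ := hgu
  by_cases hfx : ∃ p, f p = x₀
  · obtain ⟨p, rfl⟩ := hfx
    obtain _ | k := k
    · exact q.elim0
    rw [minor_eq_mul_minor_of_col p q fun i hi => hu _ (hf.ne hi)]
    exact mul_mem (mul_mem (pow_mem hneg _) (map_mem_mrange _))
      (avoiding _ _ fun j => hg.ne (Fin.succAbove_ne q j))
  · rw [minor_eq_zero_of_col q fun i => hu _ (not_exists.1 hfx i)]
    exact zero_mem_mrange

end Pivot

end PartialField

/-! ### Connectivity -/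

namespace PartialField

open Sum
open MonoidHom (mrange)
open scoped Matrix

section InducedSubgraph

variable {V : Type*} {G : SimpleGraph V} {K W : Set V}

theorem exists_adj_of_preconnected_induce (hW : (G.induce W).Preconnected)
    (hne : (W ∩ K).Nonempty) (hK : ¬ W ⊆ K) : ∃ a ∈ W ∩ K, ∃ b ∈ W \ K, G.Adj a b := by
  obtain ⟨a, haW, haK⟩ := hne
  obtain ⟨b, hbW, hbK⟩ := Set.not_subset.1 hK
  obtain ⟨p⟩ := hW ⟨a, haW⟩ ⟨b, hbW⟩
  obtain ⟨d, -, hfst, hsnd⟩ := p.exists_boundary_dart (Subtype.val ⁻¹' K) haK hbK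
  exact ⟨d.fst, ⟨d.fst.2, hfst⟩, d.snd, ⟨d.snd.2, hsnd⟩, d.adj⟩

theorem preconnected_induce_iff : (G.induce W).Preconnected ↔
    ∀ C, (W ∩ C).Nonempty → (∀ a ∈ W, ∀ b ∈ W, G.Adj a b → a ∈ C → b ∈ C) → W ⊆ C := by
  refine ⟨fun hW C hne hC => ?_, fun h a b => ?_⟩
  · by_contra hWC
    obtain ⟨a, ⟨haW, haC⟩, b, ⟨hbW, hbC⟩, hab⟩ := exists_adj_of_preconnected_induce hW hne hWC
    exact hbC (hC a haW b hbW hab haC)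
  · have hreach := h {c | ∃ hc : c ∈ W, (G.induce W).Reachable a ⟨c, hc⟩}
      ⟨a, a.2, a.2, SimpleGraph.Reachable.refl a⟩ (fun c hc d hd hcd ⟨_, hac⟩ =>
        ⟨hd, hac.trans (SimpleGraph.Adj.reachable (G := G.induce W) (u := ⟨c, hc⟩) hcd)⟩) b.2
    exact hreach.2

theorem preconnected_induce_of_dominating (hK : (G.induce K).Preconnected) (hKW : K ⊆ W)
    (hdom : ∀ w ∈ W \ K, ∃ k ∈ K, G.Adj k w) : (G.induce W).Preconnected := by
  refine preconnected_induce_iff.2 fun C hne hC => ?_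
  have hKC : K ⊆ C := by
    refine preconnected_induce_iff.1 hK C ?_ fun a ha b hb => hC a (hKW ha) b (hKW hb)
    obtain ⟨w, hw, hwC⟩ := hne
    by_cases hwK : w ∈ K
    · exact ⟨w, hwK, hwC⟩
    · obtain ⟨k, hk, hkw⟩ := hdom w ⟨hw, hwK⟩
      exact ⟨k, hk, hC w hw k (hKW hk) hkw.symm hwC⟩
  intro w hw
  by_cases hwK : w ∈ K
  · exact hKC hwK
  · obtain ⟨k, hk, hkw⟩ := hdom w ⟨hw, hwK⟩
    exact hC k (hKW hk) w hw hkw (hKC hk)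

theorem preconnected_induce_insert (hK : (G.induce K).Preconnected) {k b : V} (hk : k ∈ K)
    (hkb : G.Adj k b) : (G.induce (insert b K)).Preconnected := by
  refine preconnected_induce_of_dominating hK (Set.subset_insert b K) ?_
  rintro w ⟨rfl | hw, hwK⟩
  · exact ⟨k, hk, hkb⟩
  · exact absurd hw hwK

/-- The neighbours in `W` of the set `K` that are outside `K`. -/
def outerBoundary (G : SimpleGraph V) (W K : Set V) : Set V :=
  {b ∈ W \ K | ∃ k ∈ K, G.Adj k b}

theorem ncard_outerBoundary_le_insert [Finite V] {a b : V} (ha : a ∈ outerBoundary G W K)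
    (hab : G.Adj a b) (hbW : b ∈ W) (hbK : b ∉ K) (hb : b ∉ outerBoundary G W K) :
    (outerBoundary G W K).ncard ≤ (outerBoundary G W (insert a K)).ncard := by
  have hsub : insert b (outerBoundary G W K \ {a}) ⊆ outerBoundary G W (insert a K) := by
    rintro c (rfl | ⟨⟨⟨hcW, hcK⟩, k, hk, hkc⟩, hca⟩)
    · exact ⟨⟨hbW, by simp [hbK, hab.ne.symm]⟩, a, Set.mem_insert a K, hab⟩
    · exact ⟨⟨hcW, not_or_intro hca hcK⟩, k, Or.inr hk, hkc⟩
  calc (outerBoundary G W K).ncard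
    _ = (outerBoundary G W K \ {a}).ncard + 1 := (Set.ncard_sdiff_singleton_add_one ha).symm
    _ = (insert b (outerBoundary G W K \ {a})).ncard :=
      (Set.ncard_insert_of_notMem fun h => hb h.1).symm
    _ ≤ _ := Set.ncard_le_ncard hsub

theorem exists_dominating_of_mem [Finite V] (hW : (G.induce W).Preconnected) {z : V} (hz : z ∈ W) :
    ∃ K ⊆ W, (G.induce K).Preconnected ∧
      (G.neighborSet z ∩ W).ncard ≤ (outerBoundary G W K).ncard ∧
        W \ K ⊆ outerBoundary G W K := by
  have hz' : (G.neighborSet z ∩ W).ncard ≤ (outerBoundary G W {z}).ncard :=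
    Set.ncard_le_ncard fun b hb => ⟨⟨hb.2, hb.1.ne'⟩, z, rfl, hb.1⟩
  obtain ⟨K, ⟨hKW, hzK, hKc, hcard⟩, hmax⟩ := (Set.toFinite {K : Set V | K ⊆ W ∧ z ∈ K ∧
    (G.induce K).Preconnected ∧ (G.neighborSet z ∩ W).ncard ≤
      (outerBoundary G W K).ncard}).exists_maximal ⟨{z}, by simpa using hz, rfl,
        SimpleGraph.Preconnected.of_subsingleton, hz'⟩
  refine ⟨K, hKW, hKc, hcard, fun w hw => ?_⟩
  by_contra hwb
  obtain ⟨a, ⟨haW, haK⟩, b, ⟨hbW, hb⟩, hab⟩ := exists_adj_of_preconnected_induce hW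
    (K := K ∪ outerBoundary G W K) ⟨z, hz, Or.inl hzK⟩ fun h => (h hw.1).elim hw.2 hwb
  obtain ⟨hbK, hbb⟩ := not_or.1 hb
  obtain haK | ha := haK
  · exact hbb ⟨⟨hbW, hbK⟩, a, haK, hab⟩
  obtain ⟨k, hk, hka⟩ := ha.2
  exact ha.1.2 (hmax ⟨Set.insert_subset haW hKW, Or.inr hzK, preconnected_induce_insert hKc hk hka,
    hcard.trans (ncard_outerBoundary_le_insert ha hab hbW hbK hbb)⟩ (Set.subset_insert a K)
      (Set.mem_insert a K))

theorem exists_removable_of_mem [Finite V] (hW : (G.induce W).Preconnected) {z : V} (hz : z ∈ W) :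
    ∃ D ⊆ W, (G.neighborSet z ∩ W).ncard ≤ D.ncard ∧
      ∀ S ⊆ D, (G.induce (W \ S)).Preconnected := by
  obtain ⟨K, hKW, hKc, hcard, hdom⟩ := exists_dominating_of_mem hW hz
  refine ⟨outerBoundary G W K, fun b hb => hb.1.1, hcard, fun S hS => ?_⟩
  exact preconnected_induce_of_dominating hKc (fun k hk => ⟨hKW hk, fun h => (hS h).1.2 hk⟩)
    fun w hw => (hdom ⟨hw.1.1, hw.2⟩).2

end InducedSubgraph

theorem exists_ne_inl_or_inr_of_two_lt_ncard {X Y : Type*} {D : Set (X ⊕ Y)} (hD : 2 < D.ncard) :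
    (∃ u w : X, u ≠ w ∧ inl u ∈ D ∧ inl w ∈ D) ∨ ∃ u w : Y, u ≠ w ∧ inr u ∈ D ∧ inr w ∈ D := by
  obtain ⟨a, ha, b, hb, hne, hab⟩ := Set.exists_ne_map_eq_of_ncard_lt_of_maps_to
    (s := D) (t := Set.univ) (f := Sum.isLeft) (by simpa [Set.ncard_univ] using hD)
    fun _ _ => Set.mem_univ _
  rcases a with a | a <;> rcases b with b | b
  · exact Or.inl ⟨a, b, by simpa using hne, ha, hb⟩
  · simp at hab
  · simp at hab
  · exact Or.inr ⟨a, b, by simpa using hne, ha, hb⟩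

section SupportGraph

variable {P X Y : Type*} [Zero P] {A A' : Matrix X Y P} {W : Set (X ⊕ Y)}

/-- The bipartite graph on the rows and columns of `A` whose edges are the nonzero entries. -/
def supportGraph (A : Matrix X Y P) : SimpleGraph (X ⊕ Y) where
  Adj
    | inl x, inr y => A x y ≠ 0
    | inr y, inl x => A x y ≠ 0
    | _, _ => False
  symm := ⟨by rintro (x | y) (x' | y') h <;> exact h⟩
  loopless := ⟨by rintro (x | y) h <;> exact h⟩

theorem preconnected_induce_supportGraph_iff : ((supportGraph A).induce W).Preconnected ↔
    ∀ C, (W ∩ C).Nonempty → IsBlockDiagonal (mask W A) C → W ⊆ C := by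
  refine preconnected_induce_iff.trans (forall₂_congr fun C _ => imp_congr_left ?_)
  refine ⟨fun hC x y hxy => ?_, fun hC a ha b hb hab haC => ?_⟩
  · obtain ⟨hx, hy, hne⟩ := mask_ne_zero_iff.1 hxy
    exact ⟨hC _ hx _ hy hne, hC _ hy _ hx hne⟩
  · rcases a with x | y <;> rcases b with x' | y'
    · exact hab.elim
    · exact (hC x y' (mask_ne_zero_iff.2 ⟨ha, hb, hab⟩)).1 haC
    · exact (hC x' y (mask_ne_zero_iff.2 ⟨hb, ha, hab⟩)).2 haC
    · exact hab.elim

theorem preconnected_induce_supportGraph_transpose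
    (hW : ((supportGraph A).induce W).Preconnected) :
    ((supportGraph Aᵀ).induce (Sum.swap ⁻¹' W)).Preconnected := by
  refine preconnected_induce_supportGraph_iff.2 fun C hne hC => ?_
  rw [mask_transpose] at hC
  have hC' : IsBlockDiagonal (mask W A) (Sum.swap ⁻¹' C) := fun x y hxy => (hC y x hxy).symm
  obtain ⟨c, hcW, hcC⟩ := hne
  intro d hd
  simpa using preconnected_induce_supportGraph_iff.1 hW _ ⟨c.swap, hcW, by simpa using hcC⟩ hC' hd

end SupportGraph

section Pivot

variable {P R X Y : Type*} [CommGroupWithZero P] [CommRing R] {v : P →*₀ R}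
  {A A' : Matrix X Y P} {x : X} {y : Y}

theorem IsBlockDiagonal.of_isPivot (hinj : Function.Injective v) (h : IsPivot v A x y A')
    {C : Set (X ⊕ Y)} (hA' : IsBlockDiagonal A' C) : IsBlockDiagonal A C := by
  intro i j hij
  by_cases hij' : A' i j = 0
  · have hiy : A i y ≠ 0 := fun h0 => hij (by rwa [← h.row_eq hinj h0])
    have hxj : A x j ≠ 0 := fun h0 => hij (by rwa [← h.col_eq hinj h0])
    rw [hA' i y ((h.col_ne_zero_iff hinj i).2 hiy), ← hA' x y (h.pivoted_ne_zero hinj),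
      hA' x j ((h.row_ne_zero_iff hinj j).2 hxj)]
  · exact hA' i j hij'

theorem IsPivot.preconnected_induce_supportGraph (hinj : Function.Injective v)
    (h : IsPivot v A x y A') {W : Set (X ⊕ Y)} (hx : inl x ∈ W) (hy : inr y ∈ W)
    (hW : ((supportGraph A).induce W).Preconnected) :
    ((supportGraph A').induce W).Preconnected :=
  preconnected_induce_supportGraph_iff.2 fun C hne hC =>
    preconnected_induce_supportGraph_iff.1 hW C hne (hC.of_isPivot hinj (h.mask hx hy))

end Pivot

section RowChain

variable {P R X Y : Type*} [CommGroupWithZero P] [CommRing R] {v : P →*₀ R}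
  {A A' : Matrix X Y P} {U : Set Y} {a b : X}

/-- There is a chain of `n + 1` rows from `a` to `b`, in which consecutive rows have a common
nonzero position outside the columns in `U`. -/
def RowChain (A : Matrix X Y P) (U : Set Y) : ℕ → X → X → Prop
  | 0, a, b => a = b
  | n + 1, a, b => ∃ c, (∃ y ∉ U, A a y ≠ 0 ∧ A c y ≠ 0) ∧ RowChain A U n c b

theorem exists_rowChain {W : Set (X ⊕ Y)} (hW : ((supportGraph A).induce W).Preconnected)
    (hU : ∀ y, inr y ∈ W → y ∉ U) (ha : inl a ∈ W) (hb : inl b ∈ W) :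
    ∃ n, RowChain A U n a b := by
  have hreach := preconnected_induce_iff.1 hW (Sum.elim (fun x => ∃ n, RowChain A U n x b)
    fun y => ∃ x, A x y ≠ 0 ∧ ∃ n, RowChain A U n x b) ⟨inl b, hb, 0, rfl⟩ (by
      rintro (i | j) ha (i' | j') _ hab hC
      · exact hab.elim
      · exact ⟨i, hab, hC⟩
      · obtain ⟨x, hx, n, hn⟩ := hC
        exact ⟨n + 1, x, ⟨j, hU j ha, hab, hx⟩, hn⟩
      · exact hab.elim) ha
  exact hreach

namespace RowChain

theorem congr : ∀ {k : ℕ} {a : X}, (∀ j ≤ k, ∀ x, RowChain A U j x b → A' x = A x) →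
    RowChain A U k a b → RowChain A' U k a b
  | 0, _, _, h => h
  | k + 1, a, hrow, ⟨c, ⟨y, hy, hay, hcy⟩, hc⟩ => by
    refine ⟨c, ⟨y, hy, ?_, ?_⟩, congr (fun j hj => hrow j (hj.trans k.le_succ)) hc⟩
    · rwa [hrow (k + 1) le_rfl a ⟨c, ⟨y, hy, hay, hcy⟩, hc⟩]
    · rwa [hrow k k.le_succ c hc]

/-- The pivot is on an entry in the second and third rows of the chain. It makes the first and
third rows adjacent, and fixes the rows after the third one as the chain is a shortest one. -/
theorem exists_shortening (hinj : Function.Injective v) {k : ℕ} (hab : RowChain A U (k + 3) a b)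
    (hmin : ∀ m < k + 3, ¬ RowChain A U m a b) :
    ∃ x, ∃ y ∉ U, A x y ≠ 0 ∧ ∀ A', IsPivot v A x y A' →
      A' a = A a ∧ A' b = A b ∧ RowChain A' U (k + 2) a b := by
  obtain ⟨c, ⟨y₁, hy₁, ha₁, hc₁⟩, d, ⟨y₂, hy₂, hc₂, hd₂⟩, e, ⟨y₃, hy₃, hd₃, he₃⟩, heb⟩ := hab
  refine ⟨c, y₂, hy₂, hc₂, fun A' hp => ?_⟩
  have hdb : RowChain A U (k + 1) d b := ⟨e, ⟨y₃, hy₃, hd₃, he₃⟩, heb⟩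
  have ha₂ : A a y₂ = 0 := by
    by_contra h
    exact hmin (k + 2) (by lia) ⟨d, ⟨y₂, hy₂, h, hd₂⟩, hdb⟩
  have hd₁ : A d y₁ = 0 := by
    by_contra h
    exact hmin (k + 2) (by lia) ⟨d, ⟨y₁, hy₁, ha₁, h⟩, hdb⟩
  have hc₃ : A c y₃ = 0 := by
    by_contra h
    exact hmin (k + 2) (by lia) ⟨c, ⟨y₁, hy₁, ha₁, hc₁⟩, e, ⟨y₃, hy₃, h, he₃⟩, heb⟩
  have hrow : ∀ j ≤ k, ∀ x, RowChain A U j x b → A' x = A x := by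
    intro j hj x hx
    have hx₂ : A x y₂ = 0 := by
      by_contra h
      exact hmin (j + 2) (by lia) ⟨c, ⟨y₁, hy₁, ha₁, hc₁⟩, x, ⟨y₂, hy₂, hc₂, h⟩, hx⟩
    exact funext (hp.row_eq hinj hx₂)
  have ha : A' a = A a := funext (hp.row_eq hinj ha₂)
  refine ⟨ha, hrow 0 k.zero_le b rfl, d, ⟨y₁, hy₁, by rwa [ha], ?_⟩, e, ⟨y₃, hy₃, ?_, ?_⟩,
    congr hrow heb⟩
  · exact hp.ne_zero_of_eq_zero hinj hd₁ hd₂ hc₁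
  · rwa [hp.col_eq hinj hc₃]
  · rwa [hrow k le_rfl e heb]

theorem rel_of_forall_le_two (hinj : Function.Injective v) {𝒮 : Set (Matrix X Y P)}
    (h𝒮 : PivotClosed v U 𝒮) {Φ : (Y → P) → (Y → P) → Prop}
    (hΦ : ∀ A ∈ 𝒮, ∀ n ≤ 2, ∀ a b, RowChain A U n a b → Φ (A a) (A b)) {n : ℕ} (hA : A ∈ 𝒮)
    (hab : RowChain A U n a b) : Φ (A a) (A b) := by
  induction n using Nat.strong_induction_on generalizing A with
  | _ n ih =>
  by_cases hshort : ∃ m < n, RowChain A U m a b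
  · obtain ⟨m, hm, hmab⟩ := hshort
    exact ih m hm hA hmab
  push Not at hshort
  obtain hn | hn := le_or_gt n 2
  · exact hΦ A hA n hn a b hab
  obtain ⟨k, rfl⟩ := Nat.exists_eq_add_of_le' hn
  obtain ⟨x, y, hy, hxy, hpivot⟩ := hab.exists_shortening hinj hshort
  obtain ⟨A', hA', hp⟩ := h𝒮 A hA x y hy hxy
  obtain ⟨ha, hb, hab'⟩ := hpivot A' hp
  rw [← ha, ← hb]
  exact ih (k + 2) (by lia) hA' hab'

end RowChain

end RowChain

end PartialField

/-! ### Liftings -/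

namespace PartialField

open MonoidHom (mrange)

section Fundamental

variable {P R : Type*} [CommGroupWithZero P] [CommRing R] {v : P →*₀ R}

variable (v) in
/-- `p` is a fundamental element of the partial field embedded by `v`: the difference `1 - p` is
defined. -/
def IsFundamental (p : P) : Prop := 1 - v p ∈ mrange v

theorem sub_mem_mrange_comm (hneg : -1 ∈ mrange v) {r s : R} :
    r - s ∈ mrange v ↔ s - r ∈ mrange v := by
  constructor <;> intro h <;> simpa using neg_mem_mrange hneg h

theorem isFundamental_div_iff {p s : P} (hs : s ≠ 0) :
    IsFundamental v (p / s) ↔ v s - v p ∈ mrange v := by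
  have hmul : v s * (1 - v (p / s)) = v s - v p := by
    rw [mul_sub, mul_one, ← map_mul, mul_div_cancel₀ _ hs]
  rw [IsFundamental, ← map_mul_mem_mrange_iff hs, hmul]

end Fundamental

/-- `φ : Q → P` is a homomorphism of partial fields along which the fundamental elements of `P` can
be lifted in a consistent way. The partial fields `P` and `Q` are given by the embeddings `vP` and
`vQ` in the rings `RP` and `RQ`. -/
structure IsLifting {P Q RP RQ : Type*} [CommGroupWithZero P] [CommGroupWithZero Q] [CommRing RP]
    [CommRing RQ] (vQ : Q →*₀ RQ) (vP : P →*₀ RP) (φ : Q →*₀ P) : Prop where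
  source_injective : Function.Injective vQ
  target_injective : Function.Injective vP
  source_neg_one_mem : -1 ∈ mrange vQ
  target_neg_one_mem : -1 ∈ mrange vP
  map_add : ∀ p q r, vQ r = vQ p + vQ q → vP (φ r) = vP (φ p) + vP (φ q)
  surjective : Function.Surjective φ
  exists_isFundamental : ∀ p, IsFundamental vP p → ∃ q, IsFundamental vQ q ∧ φ q = p
  eq_of_isFundamental : ∀ p q, IsFundamental vQ p → IsFundamental vQ q → φ p = φ q → p = q
  isFundamental_div : ∀ p q, p ≠ 0 → q ≠ 0 → IsFundamental vQ p → IsFundamental vQ q →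
    IsFundamental vP (φ (p / q)) → IsFundamental vQ (p / q)
  isFundamental_of_one_add_mem : ∀ t, 1 + vQ t ∈ mrange vQ → IsFundamental vP (φ t) →
    IsFundamental vQ t

namespace IsLifting

variable {P Q RP RQ X Y : Type*} [CommGroupWithZero P] [CommGroupWithZero Q] [CommRing RP]
  [CommRing RQ] {vQ : Q →*₀ RQ} {vP : P →*₀ RP} {φ : Q →*₀ P} (h : IsLifting vQ vP φ)

include h

theorem map_sub_mul {r p q s t : Q} (hr : vQ r = vQ p * vQ q - vQ s * vQ t) :
    vP (φ r) = vP (φ p) * vP (φ q) - vP (φ s) * vP (φ t) := by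
  have hadd := h.map_add r (s * t) (p * q) (by
    rw [map_mul, map_mul]
    linear_combination -hr)
  simp only [map_mul] at hadd
  linear_combination -hadd

theorem map_neg_one {m : Q} (hm : vQ m = -1) : vP (φ m) = -1 := by
  have hadd := h.map_add m 1 0 (by simp [hm])
  simp only [map_zero, map_one] at hadd
  linear_combination -hadd

theorem map_isPivot {B B' : Matrix X Y Q} {x : X} {y : Y} (hp : IsPivot vQ B x y B') :
    IsPivot vP (B.map φ) x y (B'.map φ) where
  ne_zero := (map_ne_zero φ).2 hp.ne_zero
  entry := by
    have hentry := hp.entry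
    rw [← map_mul] at hentry
    rw [Matrix.map_apply, Matrix.map_apply, ← map_mul, ← map_mul, h.map_neg_one hentry]
  row j hj := by simp only [Matrix.map_apply, hp.row j hj, map_mul, map_inv₀]
  col i hi := by simp only [Matrix.map_apply, hp.col i hi, map_mul, map_inv₀]
  other i j hi hj := by
    have hother := h.map_sub_mul (r := B' i j) (p := B i j) (q := 1) (s := B i y * B x j)
      (t := (B x y)⁻¹) (by rw [hp.other i j hi hj, map_one, mul_one, map_mul])
    simpa only [Matrix.map_apply, map_mul, map_one, mul_one, map_inv₀] using hother

/-- The rows `a` and `b` have a common nonzero position in a column `y`, apart from the columns `u`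
and `w` of the minor. -/
theorem minor_mem_of_common {au aw ay bu bw b_y : Q} (hay : ay ≠ 0) (hby : b_y ≠ 0)
    (hu : vQ ay * vQ bu - vQ au * vQ b_y ∈ mrange vQ)
    (hw : vQ ay * vQ bw - vQ aw * vQ b_y ∈ mrange vQ)
    (hP : vP (φ au) * vP (φ bw) - vP (φ aw) * vP (φ bu) ∈ mrange vP) :
    vQ au * vQ bw - vQ aw * vQ bu ∈ mrange vQ := by
  rw [sub_mem_mrange_comm h.target_neg_one_mem] at hP
  rw [sub_mem_mrange_comm h.source_neg_one_mem]
  simp only [← map_mul] at hu hw hP ⊢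
  by_cases had : au * bw = 0
  · rw [had, map_zero, sub_zero]
    exact map_mem_mrange _
  by_cases hbc : aw * bu = 0
  · rw [hbc, map_zero, zero_sub]
    exact neg_mem_mrange h.source_neg_one_mem (map_mem_mrange _)
  obtain ⟨hau, hbw⟩ := mul_ne_zero_iff.1 had
  obtain ⟨haw, hbu⟩ := mul_ne_zero_iff.1 hbc
  have hdiv := h.isFundamental_div (au * b_y / (ay * bu)) (aw * b_y / (ay * bw))
    (by simp [hau, hay, hbu, hby]) (by simp [haw, hay, hbw, hby])
    ((isFundamental_div_iff (mul_ne_zero hay hbu)).2 hu)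
    ((isFundamental_div_iff (mul_ne_zero hay hbw)).2 hw)
  have hratio : au * b_y / (ay * bu) / (aw * b_y / (ay * bw)) = au * bw / (aw * bu) := by
    field_simp
  rw [hratio, isFundamental_div_iff hbc, map_div₀, isFundamental_div_iff ((map_ne_zero φ).2 hbc)]
    at hdiv
  exact hdiv hP

/-- The rows `a` and `b` have nonzero positions in columns `1` and `2` in common with a third row
`c`, but not with each other. The elements `g` and `k` are the entries of the row `a` after pivoting
on `c1`, and `d`, `e`, `f` are further minors in the columns `u` and `w`. -/
theorem minor_mem_of_path {au aw a1 cu cw c1 bu bw g k d e f : Q} (ha1 : a1 ≠ 0) (hc1 : c1 ≠ 0)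
    (hcu : cu ≠ 0) (hg0 : g ≠ 0) (hg : vQ g = vQ au * vQ c1 - vQ a1 * vQ cu)
    (hk : vQ k = vQ aw * vQ c1 - vQ a1 * vQ cw) (hd : vQ d = vQ au * vQ cw - vQ aw * vQ cu)
    (he : vQ e = vQ cu * vQ bw - vQ cw * vQ bu) (hf : vQ f = vQ g * vQ bw - vQ k * vQ bu)
    (hP : vP (φ au) * vP (φ bw) - vP (φ aw) * vP (φ bu) ∈ mrange vP) :
    vQ au * vQ bw - vQ aw * vQ bu ∈ mrange vQ := by
  have hneg := h.source_neg_one_mem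
  have hgQ : vQ g * (vQ au * vQ bw - vQ aw * vQ bu) = vQ (au * f) - vQ (bu * a1 * d) := by
    simp only [map_mul, hf, hd, hk, hg]
    ring
  have hgP : vP (φ g) * (vP (φ au) * vP (φ bw) - vP (φ aw) * vP (φ bu)) =
      vP (φ (au * f)) - vP (φ (bu * a1 * d)) := by
    simp only [map_mul, h.map_sub_mul hf, h.map_sub_mul hd, h.map_sub_mul hk, h.map_sub_mul hg]
    ring
  rw [← map_mul_mem_mrange_iff hg0, hgQ]
  rw [← map_mul_mem_mrange_iff ((map_ne_zero φ).2 hg0), hgP] at hP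
  by_cases hauf : au * f = 0
  · rw [hauf, map_zero, zero_sub]
    exact neg_mem_mrange hneg (map_mem_mrange _)
  by_cases hbad : bu * a1 * d = 0
  · rw [hbad, map_zero, sub_zero]
    exact map_mem_mrange _
  obtain ⟨hau, hf0⟩ := mul_ne_zero_iff.1 hauf
  obtain ⟨hbua, hd0⟩ := mul_ne_zero_iff.1 hbad
  have hbu : bu ≠ 0 := left_ne_zero_of_mul hbua
  have hcuf : vQ (cu * f) - vQ (bu * d * c1) ∈ mrange vQ := ⟨e * g, by
    change vQ (e * g) = _
    simp only [map_mul, hf, hd, he, hk, hg]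
    ring⟩
  have hacu : vQ (a1 * cu) - vQ (au * c1) ∈ mrange vQ := by
    rw [sub_mem_mrange_comm hneg, map_mul, map_mul, ← hg]
    exact map_mem_mrange _
  have hdiv := h.isFundamental_div (bu * d * c1 / (cu * f)) (au * c1 / (a1 * cu))
    (by simp [hbu, hd0, hc1, hcu, hf0]) (by simp [hau, hc1, ha1, hcu])
    ((isFundamental_div_iff (mul_ne_zero hcu hf0)).2 hcuf)
    ((isFundamental_div_iff (mul_ne_zero ha1 hcu)).2 hacu)
  have hratio : bu * d * c1 / (cu * f) / (au * c1 / (a1 * cu)) = bu * a1 * d / (au * f) := by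
    field_simp
  rw [hratio, isFundamental_div_iff hauf, map_div₀,
    isFundamental_div_iff ((map_ne_zero φ).2 hauf)] at hdiv
  exact hdiv hP

/-- As `minor_mem_of_path`, when the minors of `a`, `c` in the columns `u`, `1` and of `b`, `c` in
the columns `u`, `2` vanish. -/
theorem minor_mem_of_path_of_eq {au aw a1 cu c1 c2 bu bw b2 : Q} (hc1 : c1 ≠ 0) (hc2 : c2 ≠ 0)
    (hcu : cu ≠ 0) (hb2 : b2 ≠ 0) (hau : au * c1 = a1 * cu) (hbu : bu * c2 = b2 * cu)
    (hs : vQ aw * vQ c1 * vQ b2 + vQ a1 * vQ c2 * vQ bw ∈ mrange vQ)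
    (hP : vP (φ au) * vP (φ bw) - vP (φ aw) * vP (φ bu) ∈ mrange vP) :
    vQ au * vQ bw - vQ aw * vQ bu ∈ mrange vQ := by
  by_cases haw : aw = 0
  · rw [haw, map_zero, zero_mul, sub_zero, ← map_mul]
    exact map_mem_mrange _
  have hne : aw * b2 * c1 ≠ 0 := mul_ne_zero (mul_ne_zero haw hb2) hc1
  have hcc : c1 * c2 ≠ 0 := mul_ne_zero hc1 hc2
  have hsum : 1 + vQ (a1 * c2 * bw / (aw * b2 * c1)) ∈ mrange vQ := by
    rw [← map_mul_mem_mrange_iff hne, mul_add, ← map_mul, mul_div_cancel₀ _ hne, mul_one]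
    convert hs using 1
    simp only [map_mul]
    ring
  have hQ : vQ (c1 * c2) * (vQ au * vQ bw - vQ aw * vQ bu) =
      vQ cu * (vQ (a1 * c2 * bw) - vQ (aw * b2 * c1)) := by
    have hau' := congrArg vQ hau
    have hbu' := congrArg vQ hbu
    simp only [map_mul] at hau' hbu' ⊢
    linear_combination (vQ c2 * vQ bw) * hau' - (vQ aw * vQ c1) * hbu'
  have hP' : vP (φ (c1 * c2)) * (vP (φ au) * vP (φ bw) - vP (φ aw) * vP (φ bu)) =
      vP (φ cu) * (vP (φ (a1 * c2 * bw)) - vP (φ (aw * b2 * c1))) := by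
    have hau' := congrArg (fun q => vP (φ q)) hau
    have hbu' := congrArg (fun q => vP (φ q)) hbu
    simp only [map_mul] at hau' hbu' ⊢
    linear_combination (vP (φ c2) * vP (φ bw)) * hau' - (vP (φ aw) * vP (φ c1)) * hbu'
  have hfund := h.isFundamental_of_one_add_mem _ hsum
  rw [isFundamental_div_iff hne, map_div₀, isFundamental_div_iff ((map_ne_zero φ).2 hne)] at hfund
  rw [← map_mul_mem_mrange_iff hcc, hQ, map_mul_mem_mrange_iff hcu,
    sub_mem_mrange_comm h.source_neg_one_mem]
  rw [← map_mul_mem_mrange_iff ((map_ne_zero φ).2 hcc), hP',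
    map_mul_mem_mrange_iff ((map_ne_zero φ).2 hcu), sub_mem_mrange_comm h.target_neg_one_mem] at hP
  exact hfund hP

end IsLifting

end PartialField

/-! ### Matrices with two exceptional columns -/

namespace PartialField

open Sum
open MonoidHom (mrange)

variable {P Q RP RQ X Y : Type*} [CommGroupWithZero P] [CommGroupWithZero Q] [CommRing RP]
  [CommRing RQ] {vQ : Q →*₀ RQ} {vP : P →*₀ RP} {φ : Q →*₀ P}

/-- The rows `a`, `c`, `b` and the columns `y₁`, `y₂` outside `U` form an induced path in the
support graph of `B`. -/
structure IsInducedPath (B : Matrix X Y Q) (U : Set Y) (a : X) (y₁ : Y) (c : X) (y₂ : Y) (b : X) :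
    Prop where
  fst_notMem : y₁ ∉ U
  snd_notMem : y₂ ∉ U
  left_fst : B a y₁ ≠ 0
  mid_fst : B c y₁ ≠ 0
  mid_snd : B c y₂ ≠ 0
  right_snd : B b y₂ ≠ 0
  left_snd : B a y₂ = 0
  right_fst : B b y₁ = 0

theorem IsInducedPath.symm {B : Matrix X Y Q} {U : Set Y} {a c b : X} {y₁ y₂ : Y}
    (hp : IsInducedPath B U a y₁ c y₂ b) : IsInducedPath B U b y₂ c y₁ a :=
  ⟨hp.snd_notMem, hp.fst_notMem, hp.right_snd, hp.mid_snd, hp.mid_fst, hp.left_fst, hp.right_fst,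
    hp.left_snd⟩

theorem IsInducedPath.left_ne_mid {B : Matrix X Y Q} {U : Set Y} {a c b : X} {y₁ y₂ : Y}
    (hp : IsInducedPath B U a y₁ c y₂ b) : a ≠ c := by
  rintro rfl
  exact hp.mid_snd hp.left_snd

/-- `B` is a matrix over `Q` for which the image under `φ` has its minors in `P`, and all minors
of `B` that avoid one of the columns `u` and `w` are in `Q`. The matrix obtained by deleting both
columns is connected, with set of rows and columns `W`. -/
structure TwoColumns (vQ : Q →*₀ RQ) (vP : P →*₀ RP) (φ : Q →*₀ P) (W : Set (X ⊕ Y)) (u w : Y)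
    (B : Matrix X Y Q) : Prop where
  ne : u ≠ w
  fst_notMem : inr u ∉ W
  snd_notMem : inr w ∉ W
  image : MinorsInRange vP (B.map φ)
  fst : MinorsInRange vQ (mask {inr u}ᶜ B)
  snd : MinorsInRange vQ (mask {inr w}ᶜ B)
  connected : ((supportGraph B).induce W).Preconnected
  supportedOn : SupportedOn B (W ∪ {inr u, inr w})

namespace TwoColumns

variable {W : Set (X ⊕ Y)} {u w : Y} {B : Matrix X Y Q} {a b c x : X} {y y₁ y₂ : Y}

theorem symm (hB : TwoColumns vQ vP φ W u w B) : TwoColumns vQ vP φ W w u B :=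
  ⟨hB.ne.symm, hB.snd_notMem, hB.fst_notMem, hB.image, hB.snd, hB.fst, hB.connected,
    Set.pair_comm (inr u : X ⊕ Y) (inr w) ▸ hB.supportedOn⟩

theorem row_mem (hB : TwoColumns vQ vP φ W u w B) (hxy : B x y ≠ 0) : inl x ∈ W := by
  simpa using (hB.supportedOn x y hxy).1

theorem col_mem (hB : TwoColumns vQ vP φ W u w B) (hy : y ∉ ({u, w} : Set Y)) (hxy : B x y ≠ 0) :
    inr y ∈ W := by
  exact (hB.supportedOn x y hxy).2.resolve_right (by simpa using hy)

theorem two_by_two (hB : TwoColumns vQ vP φ W u w B) (a b : X) {y z : Y} (hy : y ≠ w) (hz : z ≠ w) :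
    vQ (B a y) * vQ (B b z) - vQ (B a z) * vQ (B b y) ∈ mrange vQ := by
  simpa only [mask_compl_of_ne hy, mask_compl_of_ne hz] using hB.snd.two_by_two a b y z

theorem exists_isPivot (h : IsLifting vQ vP φ) (hB : TwoColumns vQ vP φ W u w B)
    (hy : y ∉ ({u, w} : Set Y)) (hxy : B x y ≠ 0) :
    ∃ B', TwoColumns vQ vP φ W u w B' ∧ IsPivot vQ B x y B' := by
  obtain ⟨hyu, hyw⟩ : y ≠ u ∧ y ≠ w := by simpa using hy
  obtain ⟨B', hp⟩ := exists_isPivot_of_two_by_two h.source_neg_one_mem hxy fun i j => by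
    by_cases hj : j = w
    · subst hj
      exact hB.symm.two_by_two x i hyu hB.ne.symm
    · exact hB.two_by_two x i hyw hj
  exact ⟨B', ⟨hB.ne, hB.fst_notMem, hB.snd_notMem,
    hB.image.of_isPivot h.target_neg_one_mem (h.map_isPivot hp),
    hB.fst.of_isPivot h.source_neg_one_mem (hp.mask (by simp) (by simpa using hyu)),
    hB.snd.of_isPivot h.source_neg_one_mem (hp.mask (by simp) (by simpa using hyw)),
    hp.preconnected_induce_supportGraph h.source_injective (hB.row_mem hxy) (hB.col_mem hy hxy)
      hB.connected,
    hp.supportedOn h.source_injective hB.supportedOn⟩, hp⟩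

theorem minor_mem_of_common (h : IsLifting vQ vP φ) (hB : TwoColumns vQ vP φ W u w B)
    (hy : y ∉ ({u, w} : Set Y)) (ha : B a y ≠ 0) (hb : B b y ≠ 0) :
    vQ (B a u) * vQ (B b w) - vQ (B a w) * vQ (B b u) ∈ mrange vQ := by
  obtain ⟨hyu, hyw⟩ : y ≠ u ∧ y ≠ w := by simpa using hy
  exact h.minor_mem_of_common ha hb (hB.two_by_two a b hyw hB.ne)
    (hB.symm.two_by_two a b hyu hB.ne.symm) (hB.image.two_by_two a b u w)

/-- Pivoting on the entry `(c, y₁)` turns `y₂` into a common nonzero position of `a` and `b`. -/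
theorem exists_pivoted_minor (h : IsLifting vQ vP φ) (hB : TwoColumns vQ vP φ W u w B)
    (hpath : IsInducedPath B {u, w} a y₁ c y₂ b) :
    ∃ B', TwoColumns vQ vP φ W u w B' ∧ IsPivot vQ B c y₁ B' ∧
      vQ (B' a u) * vQ (B b w) - vQ (B' a w) * vQ (B b u) ∈ mrange vQ := by
  obtain ⟨B', hB', hp⟩ := hB.exists_isPivot h hpath.fst_notMem hpath.mid_fst
  have hrow : ∀ z, B' b z = B b z := hp.row_eq h.source_injective hpath.right_fst
  have hminor := hB'.minor_mem_of_common h (a := a) (b := b) hpath.snd_notMem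
    (hp.ne_zero_of_eq_zero h.source_injective hpath.left_snd hpath.left_fst hpath.mid_snd)
    (by rw [hrow]; exact hpath.right_snd)
  rw [hrow, hrow] at hminor
  exact ⟨B', hB', hp, hminor⟩

theorem minor_mem_of_ne_left (h : IsLifting vQ vP φ) (hB : TwoColumns vQ vP φ W u w B)
    (hpath : IsInducedPath B {u, w} a y₁ c y₂ b) (hcu : B c u ≠ 0)
    (hne : B a u * B c y₁ ≠ B a y₁ * B c u) :
    vQ (B a u) * vQ (B b w) - vQ (B a w) * vQ (B b u) ∈ mrange vQ := by
  obtain ⟨B', -, hp, hminor⟩ := hB.exists_pivoted_minor h hpath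
  have hpivoted : ∀ z, z ≠ y₁ →
      vQ (B' a z * B c y₁) = vQ (B a z) * vQ (B c y₁) - vQ (B a y₁) * vQ (B c z) := by
    intro z hz
    rw [map_mul, hp.other a z hpath.left_ne_mid hz]
    linear_combination (-vQ (B a y₁) * vQ (B c z)) * map_mul_map_inv (v := vQ) hpath.mid_fst
  obtain ⟨huy, hwy⟩ : u ≠ y₁ ∧ w ≠ y₁ := by simpa [eq_comm] using hpath.fst_notMem
  obtain ⟨f, hf⟩ := mul_mem hminor (map_mem_mrange (B c y₁))
  obtain ⟨d, hd⟩ := hB.minor_mem_of_common h hpath.fst_notMem hpath.left_fst hpath.mid_fst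
  obtain ⟨e, he⟩ := hB.minor_mem_of_common h hpath.snd_notMem hpath.mid_snd hpath.right_snd
  refine h.minor_mem_of_path hpath.left_fst hpath.mid_fst hcu (fun h0 => hne ?_) (hpivoted u huy)
    (hpivoted w hwy) hd he (f := f) ?_ (hB.image.two_by_two a b u w)
  · apply h.source_injective
    have hu := hpivoted u huy
    rw [h0, map_zero] at hu
    rw [map_mul, map_mul]
    linear_combination -hu
  · refine hf.trans ?_
    rw [map_mul, map_mul]
    ring

theorem minor_mem_of_not_and (h : IsLifting vQ vP φ) (hB : TwoColumns vQ vP φ W u w B)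
    (hpath : IsInducedPath B {u, w} a y₁ c y₂ b) (hcu : B c u ≠ 0)
    (hne : ¬ (B a u * B c y₁ = B a y₁ * B c u ∧ B b u * B c y₂ = B b y₂ * B c u)) :
    vQ (B a u) * vQ (B b w) - vQ (B a w) * vQ (B b u) ∈ mrange vQ := by
  by_cases hleft : B a u * B c y₁ = B a y₁ * B c u
  · have hminor := hB.minor_mem_of_ne_left h hpath.symm hcu fun hright => hne ⟨hleft, hright⟩
    rw [sub_mem_mrange_comm h.source_neg_one_mem]
    simpa only [mul_comm] using hminor
  · exact hB.minor_mem_of_ne_left h hpath hcu hleft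

theorem minor_mem_of_mid_eq_zero (h : IsLifting vQ vP φ) (hB : TwoColumns vQ vP φ W u w B)
    (hpath : IsInducedPath B {u, w} a y₁ c y₂ b) (hcu : B c u = 0) (hcw : B c w = 0) :
    vQ (B a u) * vQ (B b w) - vQ (B a w) * vQ (B b u) ∈ mrange vQ := by
  obtain ⟨B', -, hp, hminor⟩ := hB.exists_pivoted_minor h hpath
  rwa [hp.col_eq h.source_injective hcu, hp.col_eq h.source_injective hcw] at hminor

theorem minor_mem_of_mid_snd_eq_zero (h : IsLifting vQ vP φ) (hB : TwoColumns vQ vP φ W u w B)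
    (hpath : IsInducedPath B {u, w} a y₁ c y₂ b) (hcu : B c u ≠ 0) (hcw : B c w = 0) :
    vQ (B a u) * vQ (B b w) - vQ (B a w) * vQ (B b u) ∈ mrange vQ := by
  by_cases heq : B a u * B c y₁ = B a y₁ * B c u ∧ B b u * B c y₂ = B b y₂ * B c u
  swap
  · exact hB.minor_mem_of_not_and h hpath hcu heq
  obtain ⟨B', hB', hp⟩ := hB.exists_isPivot h hpath.fst_notMem hpath.mid_fst
  have hy₂₁ : y₂ ≠ y₁ := by
    rintro rfl
    exact hpath.left_fst hpath.left_snd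
  have hy₂u : y₂ ≠ u := by
    rintro rfl
    exact hpath.snd_notMem (Set.mem_insert _ _)
  have hminor := mul_mem (hB'.symm.two_by_two a b hB.ne.symm hy₂u) (map_mem_mrange (B c y₁))
  rw [hp.row_eq h.source_injective hpath.right_fst, hp.row_eq h.source_injective hpath.right_fst,
    hp.col_eq h.source_injective hcw, hp.other a y₂ hpath.left_ne_mid hy₂₁, hpath.left_snd,
    map_zero] at hminor
  refine h.minor_mem_of_path_of_eq hpath.mid_fst hpath.mid_snd hcu hpath.right_snd heq.1 heq.2 ?_
    (hB.image.two_by_two a b u w)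
  convert hminor using 1
  linear_combination (-vQ (B a y₁) * vQ (B c y₂) * vQ (B b w)) *
    map_mul_map_inv (v := vQ) hpath.mid_fst

theorem minor_mem_of_isInducedPath (h : IsLifting vQ vP φ) (hB : TwoColumns vQ vP φ W u w B)
    (hpath : IsInducedPath B {u, w} a y₁ c y₂ b) :
    vQ (B a u) * vQ (B b w) - vQ (B a w) * vQ (B b u) ∈ mrange vQ := by
  have hpath' : IsInducedPath B {w, u} a y₁ c y₂ b := by rwa [Set.pair_comm]
  have hcomm := sub_mem_mrange_comm h.source_neg_one_mem (r := vQ (B a u) * vQ (B b w))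
    (s := vQ (B a w) * vQ (B b u))
  by_cases hcu : B c u = 0 <;> by_cases hcw : B c w = 0
  · exact hB.minor_mem_of_mid_eq_zero h hpath hcu hcw
  · exact hcomm.2 (hB.symm.minor_mem_of_mid_snd_eq_zero h hpath' hcw hcu)
  · exact hB.minor_mem_of_mid_snd_eq_zero h hpath hcu hcw
  by_cases hu : B a u * B c y₁ = B a y₁ * B c u ∧ B b u * B c y₂ = B b y₂ * B c u
  swap
  · exact hB.minor_mem_of_not_and h hpath hcu hu
  by_cases hw : B a w * B c y₁ = B a y₁ * B c w ∧ B b w * B c y₂ = B b y₂ * B c w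
  swap
  · exact hcomm.2 (hB.symm.minor_mem_of_not_and h hpath' hcw hw)
  have hzero : B a u * B b w = B a w * B b u := by
    refine mul_right_cancel₀ (mul_ne_zero hpath.mid_fst hpath.mid_snd) ?_
    rw [mul_mul_mul_comm, hu.1, hw.2, mul_mul_mul_comm (B a w), hw.1, hu.2]
    ac_rfl
  rw [← map_mul, ← map_mul, hzero, sub_self]
  exact zero_mem_mrange

theorem minor_mem_of_rowChain (h : IsLifting vQ vP φ) (hB : TwoColumns vQ vP φ W u w B) {n : ℕ}
    (hn : n ≤ 2) (hab : RowChain B {u, w} n a b) :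
    vQ (B a u) * vQ (B b w) - vQ (B a w) * vQ (B b u) ∈ mrange vQ := by
  match n, hn, hab with
  | 0, _, hab =>
    obtain rfl : a = b := hab
    rw [mul_comm, sub_self]
    exact zero_mem_mrange
  | 1, _, ⟨c, ⟨y, hy, ha, hc⟩, hcb⟩ =>
    obtain rfl : c = b := hcb
    exact hB.minor_mem_of_common h hy ha hc
  | 2, _, ⟨c, ⟨y₁, hy₁, ha₁, hc₁⟩, d, ⟨y₂, hy₂, hc₂, hb₂⟩, hdb⟩ =>
    obtain rfl : d = b := hdb
    by_cases ha₂ : B a y₂ = 0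
    swap
    · exact hB.minor_mem_of_common h hy₂ ha₂ hb₂
    by_cases hb₁ : B d y₁ = 0
    swap
    · exact hB.minor_mem_of_common h hy₁ ha₁ hb₁
    exact hB.minor_mem_of_isInducedPath h ⟨hy₁, hy₂, ha₁, hc₁, hc₂, hb₂, ha₂, hb₁⟩

theorem pivotClosed (h : IsLifting vQ vP φ) (W : Set (X ⊕ Y)) (u w : Y) :
    PivotClosed vQ {u, w} {B | TwoColumns vQ vP φ W u w B} :=
  fun _ hB _ _ hy hxy => TwoColumns.exists_isPivot h hB hy hxy

theorem minor_mem (h : IsLifting vQ vP φ) (hB : TwoColumns vQ vP φ W u w B) (a b : X) :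
    vQ (B a u) * vQ (B b w) - vQ (B a w) * vQ (B b u) ∈ mrange vQ := by
  have hzero : ∀ x, inl x ∉ W → ∀ y, B x y = 0 := fun x hx y => of_not_not fun hxy =>
    hx (hB.row_mem hxy)
  by_cases ha : inl a ∈ W
  swap
  · simp only [hzero a ha, map_zero, zero_mul, sub_zero]
    exact zero_mem_mrange
  by_cases hb : inl b ∈ W
  swap
  · simp only [hzero b hb, map_zero, mul_zero, sub_zero]
    exact zero_mem_mrange
  obtain ⟨n, hn⟩ := exists_rowChain (U := {u, w}) hB.connected (by
    rintro y hy (rfl | rfl)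
    · exact hB.fst_notMem hy
    · exact hB.snd_notMem hy) ha hb
  exact RowChain.rel_of_forall_le_two h.source_injective (pivotClosed h W u w)
    (Φ := fun r s => vQ (r u) * vQ (s w) - vQ (r w) * vQ (s u) ∈ mrange vQ)
    (fun A hA _ hn _ _ hab => TwoColumns.minor_mem_of_rowChain h hA hn hab) hB hn

theorem minorsInRange (h : IsLifting vQ vP φ) (hB : TwoColumns vQ vP φ W u w B) :
    MinorsInRange vQ B :=
  (pivotClosed h W u w).minorsInRange h.source_neg_one_mem (fun _ hA _ f g hg =>
    minor_mem_of_mem_pair h.source_neg_one_mem (TwoColumns.minor_mem h hA) f g hg) hB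

end TwoColumns

end PartialField

/-! ### Lifts of matrices -/

namespace PartialField

open Sum
open MonoidHom (mrange)
open scoped Matrix

theorem mask_mask {P X Y : Type*} [Zero P] (A : Matrix X Y P) (W W' : Set (X ⊕ Y)) :
    mask W (mask W' A) = mask (W ∩ W') A := by
  classical
  ext x y
  simp only [mask, Matrix.of_apply, ← ite_and, Set.mem_inter_iff, and_and_and_comm]

theorem mask_compl_inl_transpose {P X Y : Type*} [Zero P] (A : Matrix X Y P) (u : X) :
    mask {inr u}ᶜ Aᵀ = (mask {inl u}ᶜ A)ᵀ := by
  rw [← mask_transpose]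
  congr 1
  ext (a | a) <;> simp

theorem preconnected_induce_supportGraph_map {P P' X X' Y Y' : Type*} [Zero P] [Zero P']
    {A : Matrix X Y P} {A' : Matrix X' Y' P'} {W : Set (X ⊕ Y)}
    (hW : ((supportGraph A).induce W).Preconnected) (f : X → X') (g : Y → Y')
    (h : ∀ x y, inl x ∈ W → inr y ∈ W → A x y ≠ 0 → A' (f x) (g y) ≠ 0) :
    ((supportGraph A').induce (Sum.map f g '' W)).Preconnected := by
  refine preconnected_induce_supportGraph_iff.2 ?_
  rintro C ⟨_, ⟨w, hw, rfl⟩, hwC⟩ hC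
  refine Set.image_subset_iff.2
    (preconnected_induce_supportGraph_iff.1 hW (Sum.map f g ⁻¹' C) ⟨w, hw, hwC⟩ fun x y hxy => ?_)
  obtain ⟨hx, hy, hne⟩ := mask_ne_zero_iff.1 hxy
  exact hC (f x) (g y) (mask_ne_zero_iff.2 ⟨⟨_, hx, rfl⟩, ⟨_, hy, rfl⟩, h x y hx hy hne⟩)

theorem preconnected_induce_supportGraph_mono {P P' X Y : Type*} [Zero P] [Zero P']
    {A : Matrix X Y P} {A' : Matrix X Y P'} {W : Set (X ⊕ Y)}
    (hW : ((supportGraph A).induce W).Preconnected)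
    (h : ∀ x y, inl x ∈ W → inr y ∈ W → A x y ≠ 0 → A' x y ≠ 0) :
    ((supportGraph A').induce W).Preconnected := by
  have hmap := preconnected_induce_supportGraph_map hW id id h
  rwa [Sum.map_id_id, Set.image_id] at hmap

theorem MinorsInRange.of_supportedOn_two_by_two {P R X Y : Type*} [CommGroupWithZero P]
    [CommRing R] {v : P →*₀ R} (hneg : -1 ∈ mrange v) {A : Matrix X Y P} {x x' : X} {y y' : Y}
    (hA : SupportedOn A {inl x, inl x', inr y, inr y'})
    (hminor : v (A x y) * v (A x' y') - v (A x y') * v (A x' y) ∈ mrange v) :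
    MinorsInRange v A := by
  have hrow : ∀ i, i ≠ x → i ≠ x' → ∀ j, A i j = 0 := fun i hi hi' j =>
    of_not_not fun hij => by simpa [hi, hi'] using (hA i j hij).1
  have hcol : ∀ i j, j ∉ ({y, y'} : Set Y) → A i j = 0 := fun i j hj =>
    of_not_not fun hij => hj (by simpa using (hA i j hij).2)
  have hclosed : PivotClosed v {y, y'} {A} := by
    rintro _ rfl i j hj hij
    exact absurd (hcol i j hj) hij
  refine hclosed.minorsInRange hneg ?_ rfl
  rintro _ rfl k f g hg
  refine minor_mem_of_mem_pair hneg (fun a b => ?_) f g hg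
  by_cases ha : a ≠ x ∧ a ≠ x'
  · simpa only [hrow a ha.1 ha.2, map_zero, zero_mul, sub_zero] using zero_mem_mrange
  by_cases hb : b ≠ x ∧ b ≠ x'
  · simpa only [hrow b hb.1 hb.2, map_zero, mul_zero, sub_zero] using zero_mem_mrange
  rw [not_and_or, not_ne_iff, not_ne_iff] at ha hb
  rcases ha with rfl | rfl <;> rcases hb with rfl | rfl
  · simpa only [mul_comm, sub_self] using zero_mem_mrange
  · exact hminor
  · rw [sub_mem_mrange_comm hneg]
    simpa only [mul_comm] using hminor
  · simpa only [mul_comm, sub_self] using zero_mem_mrange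

variable {P Q RP RQ X Y : Type*} [CommGroupWithZero P] [CommGroupWithZero Q] [CommRing RP]
  [CommRing RQ] {vQ : Q →*₀ RQ} {vP : P →*₀ RP} {φ : Q →*₀ P} {A A' : Matrix X Y P}
  {B B' : Matrix X Y Q} {W K : Set (X ⊕ Y)}

/-- On the rows and columns in `K`, the matrices `B` and `B'` agree up to scaling of rows and
columns by elements of the kernel of `φ`. -/
def AgreeUpToScaling (φ : Q →*₀ P) (B B' : Matrix X Y Q) (K : Set (X ⊕ Y)) : Prop :=
  ∃ (s : X → Q) (t : Y → Q), (∀ x, φ (s x) = 1) ∧ (∀ y, φ (t y) = 1) ∧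
    ∀ x y, inl x ∈ K → inr y ∈ K → B' x y = s x * B x y * t y

theorem AgreeUpToScaling.transpose (h : AgreeUpToScaling φ B B' K) :
    AgreeUpToScaling φ Bᵀ B'ᵀ (Sum.swap ⁻¹' K) := by
  obtain ⟨s, t, hs, ht, hst⟩ := h
  refine ⟨t, s, ht, hs, fun y x hy hx => ?_⟩
  rw [Matrix.transpose_apply, Matrix.transpose_apply, hst x y hx hy, mul_comm, mul_comm (s x),
    mul_assoc]

namespace IsLifting

theorem eq_of_sub_mem (h : IsLifting vQ vP φ) {p q : Q} (hsub : vQ p - vQ q ∈ mrange vQ)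
    (hpq : φ p = φ q) : p = q := by
  by_cases hq : q = 0
  · rwa [hq, map_zero, map_eq_zero, ← hq] at hpq
  refine (div_eq_one_iff_eq hq).1 (h.eq_of_isFundamental _ _
    ((isFundamental_div_iff hq).2 ((sub_mem_mrange_comm h.source_neg_one_mem).1 hsub)) ?_ ?_)
  · simpa only [IsFundamental, map_one, sub_self] using zero_mem_mrange
  · rw [map_div₀, hpq, div_self ((map_ne_zero φ).2 hq), map_one]

/-- The columns `u` of `B` and `B'` become two columns of one matrix, to which `TwoColumns`
applies. -/
theorem minor_mem_of_eqOn (h : IsLifting vQ vP φ) (hB : MinorsInRange vQ B)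
    (hB' : MinorsInRange vQ B') (hP : MinorsInRange vP (B.map φ)) (hφ : B.map φ = B'.map φ) {u : Y}
    (hu : inr u ∉ W) (hW : ((supportGraph B).induce W).Preconnected)
    (hBB' : ∀ x y, inl x ∈ W → inr y ∈ W → B x y = B' x y) {a b : X} (ha : inl a ∈ W)
    (hb : inl b ∈ W) : vQ (B a u) * vQ (B' b u) - vQ (B' a u) * vQ (B b u) ∈ mrange vQ := by
  let N : Matrix X (Option Y) Q := Matrix.of fun x y => y.elim (B' x u) (B x)
  let E : Set (X ⊕ Option Y) := Sum.map id some '' W ∪ {inr (some u), inr none}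
  have hrow : ∀ {x}, inl x ∈ E ↔ inl x ∈ W := by simp [E]
  have hcol : ∀ {y}, y ≠ u → (inr (some y) ∈ E ↔ inr y ∈ W) := by simp +contextual [E]
  have htwo : TwoColumns vQ vP φ (Sum.map id some '' W) (some u) none (mask E N) := by
    refine ⟨by simp, by simpa using hu, by simp, ?_, ?_, ?_, ?_, ?_⟩
    · have hN : N.map φ = (B.map φ).submatrix id (Option.getD · u) := by
        ext x (_ | y)
        · exact (congrFun (congrFun hφ x) u).symm
        · rfl
      rw [map_mask, hN]
      exact (hP.submatrix _ _).mask E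
    · rw [mask_mask, mask_congr (A' := B'.submatrix id (Option.getD · u)) fun x y hx hy => ?_]
      · exact (hB'.submatrix _ _).mask _
      · obtain _ | y := y
        · rfl
        · have hyu : y ≠ u := by simpa using hy.1
          exact hBB' x y (hrow.1 hx.2) ((hcol hyu).1 hy.2)
    · rw [mask_mask, mask_congr (A' := B.submatrix id (Option.getD · u)) fun x y _ hy => ?_]
      · exact (hB.submatrix _ _).mask _
      · obtain _ | y := y
        · simp at hy
        · rfl
    · refine preconnected_induce_supportGraph_map hW id some fun x y hx hy hxy => ?_
      exact mask_ne_zero_iff.2 ⟨hrow.2 hx, Or.inl ⟨_, hy, rfl⟩, hxy⟩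
    · exact fun x y hxy => ⟨(mask_ne_zero_iff.1 hxy).1, (mask_ne_zero_iff.1 hxy).2.1⟩
  have hminor := htwo.minor_mem h a b
  rwa [mask_of_mem (hrow.2 ha) (by simp [E]), mask_of_mem (hrow.2 hb) (by simp [E]),
    mask_of_mem (hrow.2 ha) (by simp [E]), mask_of_mem (hrow.2 hb) (by simp [E])] at hminor

theorem exists_col_eq_mul (h : IsLifting vQ vP φ) (hB : MinorsInRange vQ B)
    (hB' : MinorsInRange vQ B') (hP : MinorsInRange vP (B.map φ)) (hφ : B.map φ = B'.map φ) {u : Y}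
    (hu : inr u ∉ W) (hW : ((supportGraph B).induce W).Preconnected)
    (hBB' : ∀ x y, inl x ∈ W → inr y ∈ W → B x y = B' x y) :
    ∃ t, φ t = 1 ∧ ∀ x, inl x ∈ W → B' x u = B x u * t := by
  have hφu : ∀ x, φ (B x u) = φ (B' x u) := fun x => congrFun (congrFun hφ x) u
  by_cases h0 : ∃ a, inl a ∈ W ∧ B a u ≠ 0
  · obtain ⟨a, ha, hau⟩ := h0
    refine ⟨B' a u / B a u, ?_, fun b hb => ?_⟩
    · rw [map_div₀, ← hφu, div_self ((map_ne_zero φ).2 hau)]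
    · have hprod : B a u * B' b u = B' a u * B b u :=
        h.eq_of_sub_mem (by simpa only [map_mul] using
          h.minor_mem_of_eqOn hB hB' hP hφ hu hW hBB' ha hb) (by simp only [map_mul, hφu])
      rw [← mul_div_assoc, eq_div_iff hau, mul_comm, hprod, mul_comm]
  · push Not at h0
    refine ⟨1, map_one φ, fun x hx => ?_⟩
    rw [h0 x hx, zero_mul, ← map_eq_zero φ, ← hφu, h0 x hx, map_zero]

theorem agreeUpToScaling_insert_col (h : IsLifting vQ vP φ) (hB : MinorsInRange vQ B)
    (hB' : MinorsInRange vQ B') (hP : MinorsInRange vP (B.map φ)) (hφ : B.map φ = B'.map φ)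
    (hK : ((supportGraph B).induce K).Preconnected) (hBB' : AgreeUpToScaling φ B B' K) {u : Y}
    (hu : inr u ∉ K) : AgreeUpToScaling φ B B' (insert (inr u) K) := by
  classical
  obtain ⟨s, t, hs, ht, hst⟩ := hBB'
  have ne_zero_of_map {q : Q} (hq : φ q = 1) : q ≠ 0 :=
    (map_ne_zero φ).1 (hq.trans_ne one_ne_zero)
  let C : Matrix X Y Q := Matrix.of fun x y => s x * B x y * t y
  have hC : C.map φ = B.map φ := by
    ext x y
    simp [C, hs, ht]
  obtain ⟨r, hr, hcol⟩ := h.exists_col_eq_mul (hB.scale s t) hB' (hC ▸ hP) (hC.trans hφ) hu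
    (preconnected_induce_supportGraph_mono hK fun x y _ _ hxy =>
      mul_ne_zero (mul_ne_zero (ne_zero_of_map (hs x)) hxy) (ne_zero_of_map (ht y)))
    fun x y hx hy => (hst x y hx hy).symm
  refine ⟨s, Function.update t u (t u * r), hs, fun y => ?_, fun x y hx hy => ?_⟩
  · by_cases hyu : y = u
    · rw [hyu, Function.update_self, map_mul, ht, hr, one_mul]
    · rw [Function.update_of_ne hyu, ht]
  · have hxK : inl x ∈ K := by simpa using hx
    by_cases hyu : y = u
    · rw [hyu, Function.update_self, ← mul_assoc]
      exact hcol x hxK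
    · rw [Function.update_of_ne hyu]
      exact hst x y hxK (by simpa [hyu] using hy)

theorem agreeUpToScaling_insert (h : IsLifting vQ vP φ) (hB : MinorsInRange vQ B)
    (hB' : MinorsInRange vQ B') (hP : MinorsInRange vP (B.map φ)) (hφ : B.map φ = B'.map φ)
    (hK : ((supportGraph B).induce K).Preconnected) (hBB' : AgreeUpToScaling φ B B' K) :
    ∀ {b : X ⊕ Y}, b ∉ K → AgreeUpToScaling φ B B' (insert b K)
  | inr _, hb => h.agreeUpToScaling_insert_col hB hB' hP hφ hK hBB' hb
  | inl x, hb => by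
    have hinsert := (h.agreeUpToScaling_insert_col hB.transpose hB'.transpose hP.transpose
      (congrArg Matrix.transpose hφ) (preconnected_induce_supportGraph_transpose hK)
      hBB'.transpose (u := x) hb).transpose
    rwa [show Sum.swap ⁻¹' insert (inr x) (Sum.swap ⁻¹' K) = insert (inl x) K by
      ext (z | z) <;> simp] at hinsert

theorem agreeUpToScaling [Finite X] [Finite Y] (h : IsLifting vQ vP φ) (hB : MinorsInRange vQ B)
    (hB' : MinorsInRange vQ B') (hP : MinorsInRange vP (B.map φ)) (hφ : B.map φ = B'.map φ)
    (hW : ((supportGraph B).induce W).Preconnected) : AgreeUpToScaling φ B B' W := by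
  obtain rfl | ⟨w, hw⟩ := W.eq_empty_or_nonempty
  · exact ⟨1, 1, by simp, by simp, by simp⟩
  have hsingleton : AgreeUpToScaling φ B B' {w} := by
    refine ⟨1, 1, by simp, by simp, fun x y hx hy => ?_⟩
    exact absurd ((Set.mem_singleton_iff.1 hx).trans (Set.mem_singleton_iff.1 hy).symm)
      inl_ne_inr
  obtain ⟨K, ⟨hKW, ⟨k₀, hk₀⟩, hK, hKB⟩, hmax⟩ := (Set.toFinite {K | K ⊆ W ∧ K.Nonempty ∧
    ((supportGraph B).induce K).Preconnected ∧ AgreeUpToScaling φ B B' K}).exists_maximal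
      ⟨{w}, by simpa using hw, by simp, .of_subsingleton, hsingleton⟩
  by_cases hWK : W ⊆ K
  · rwa [Set.Subset.antisymm hKW hWK] at hKB
  obtain ⟨a, ⟨-, haK⟩, b, ⟨hbW, hbK⟩, hab⟩ :=
    exists_adj_of_preconnected_induce hW ⟨k₀, hKW hk₀, hk₀⟩ hWK
  exact absurd (hmax ⟨Set.insert_subset hbW hKW, Set.insert_nonempty b K,
    preconnected_induce_insert hK haK hab, h.agreeUpToScaling_insert hB hB' hP hφ hK hKB hbK⟩
      (Set.subset_insert b K) (Set.mem_insert b K)) hbK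

end IsLifting

/-- The matrix `A` lifts to a matrix with all its minors in `Q`. -/
def HasLift (vQ : Q →*₀ RQ) (φ : Q →*₀ P) (A : Matrix X Y P) : Prop :=
  ∃ B : Matrix X Y Q, MinorsInRange vQ B ∧ B.map φ = A

namespace HasLift

theorem transpose (hA : HasLift vQ φ A) : HasLift vQ φ Aᵀ := by
  obtain ⟨B, hB, rfl⟩ := hA
  exact ⟨Bᵀ, hB.transpose, rfl⟩

theorem of_isPivot (h : IsLifting vQ vP φ) {x : X} {y : Y} (hp : IsPivot vP A x y A')
    (hA' : HasLift vQ φ A') : HasLift vQ φ A := by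
  classical
  obtain ⟨B', hB', rfl⟩ := hA'
  obtain ⟨m, hm⟩ := h.source_neg_one_mem
  have hφm : φ m * φ m = 1 := h.target_injective (by simp [h.map_neg_one hm])
  have hxy : (B'.map φ) x y ≠ 0 := hp.pivoted_ne_zero h.target_injective
  obtain ⟨B, hB⟩ := hB'.exists_isPivot h.source_neg_one_mem ((map_ne_zero φ).1 hxy)
  have hφB := (h.map_isPivot hB).unique h.target_injective
    (hp.isPivot_pivoted h.target_injective (h.map_neg_one hm))
  refine ⟨Matrix.of fun i j => (if i = x then m else 1) * B i j * (if j = y then m else 1),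
    (hB'.of_isPivot h.source_neg_one_mem hB).scale _ _, ?_⟩
  ext i j
  have hij : φ (B i j) = (if i = x then φ m else 1) * A i j * (if j = y then φ m else 1) :=
    congrFun (congrFun hφB i) j
  simp only [Matrix.map_apply, Matrix.of_apply, map_mul, hij]
  split_ifs <;> grind

theorem of_unit_col (h : IsLifting vQ vP φ) {u : Y} {x₀ : X}
    (hA : HasLift vQ φ (mask {inr u}ᶜ A)) (hu : ∀ x, x ≠ x₀ → A x u = 0) : HasLift vQ φ A := by
  classical
  obtain ⟨B, hB, hφ⟩ := hA
  obtain ⟨q, hq⟩ := h.surjective (A x₀ u)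
  refine ⟨B.updateCol u (Pi.single x₀ q), ?_, ?_⟩
  · refine MinorsInRange.of_unit_col h.source_neg_one_mem (u := u) (x₀ := x₀) ?_ fun x hx => by
      rw [Matrix.updateCol_self, Pi.single_eq_of_ne hx]
    rw [mask_congr fun x y _ hy => Matrix.updateCol_ne (by simpa using hy)]
    exact hB.mask _
  · ext x y
    obtain rfl | hyu := eq_or_ne y u
    · obtain rfl | hx := eq_or_ne x x₀
      · simp [hq]
      · simp [hx, hu x hx]
    · rw [Matrix.map_apply, Matrix.updateCol_ne hyu, ← mask_compl_of_ne (A := A) hyu, ← hφ,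
        Matrix.map_apply]

theorem of_unit_row (h : IsLifting vQ vP φ) {u : X} {y₀ : Y}
    (hA : HasLift vQ φ (mask {inl u}ᶜ A)) (hu : ∀ y, y ≠ y₀ → A u y = 0) : HasLift vQ φ A :=
  (of_unit_col h (A := Aᵀ) (mask_compl_inl_transpose A u ▸ hA.transpose) hu).transpose

theorem of_isBlockDiagonal (h : IsLifting vQ vP φ) {C : Set (X ⊕ Y)} (hA : IsBlockDiagonal A C)
    (h₁ : HasLift vQ φ (mask C A)) (h₂ : HasLift vQ φ (mask Cᶜ A)) : HasLift vQ φ A := by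
  classical
  obtain ⟨B₁, hB₁, hφ₁⟩ := h₁
  obtain ⟨B₂, hB₂, hφ₂⟩ := h₂
  let B : Matrix X Y Q := Matrix.of fun x y => if inl x ∈ C then B₁ x y else B₂ x y
  have hφ : B.map φ = A := by
    ext x y
    have h₁ := congrFun (congrFun hφ₁ x) y
    have h₂ := congrFun (congrFun hφ₂ x) y
    have hblock := hA x y
    simp only [mask, Matrix.map_apply, Matrix.of_apply, Set.mem_compl_iff] at h₁ h₂
    simp only [B, Matrix.map_apply, Matrix.of_apply]
    grind
  refine ⟨B, MinorsInRange.of_isBlockDiagonal h.source_neg_one_mem (C := C) ?_ ?_ ?_, hφ⟩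
  · subst hφ
    exact fun x y hxy => hA x y ((map_ne_zero φ).2 hxy)
  · rw [mask_congr (A := B) (A' := B₁) fun x y hx _ => if_pos hx]
    exact hB₁.mask C
  · rw [mask_congr (A := B) (A' := B₂) fun x y hx _ => if_neg hx]
    exact hB₂.mask Cᶜ

theorem exists_agreeing_lifts [Finite X] [Finite Y] (h : IsLifting vQ vP φ)
    (hA : MinorsInRange vP A) (hsupp : SupportedOn A W) {u w : Y}
    (hconn : ((supportGraph A).induce (W \ {inr u, inr w})).Preconnected)
    (hu : HasLift vQ φ (mask {inr u}ᶜ A)) (hw : HasLift vQ φ (mask {inr w}ᶜ A)) :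
    ∃ B₁ B₂ : Matrix X Y Q, MinorsInRange vQ B₁ ∧ MinorsInRange vQ B₂ ∧
      (∀ x y, y ≠ u → φ (B₁ x y) = A x y) ∧ (∀ x y, y ≠ w → φ (B₂ x y) = A x y) ∧
        ∀ x y, y ≠ u → y ≠ w → B₁ x y = B₂ x y := by
  obtain ⟨B₁, hB₁, hmap₁⟩ := hu
  obtain ⟨B₂, hB₂, hmap₂⟩ := hw
  have hφ₁ : ∀ x y, y ≠ u → φ (B₁ x y) = A x y := fun x y hy =>
    (congrFun (congrFun hmap₁ x) y).trans (mask_compl_of_ne hy)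
  have hφ₂ : ∀ x y, y ≠ w → φ (B₂ x y) = A x y := fun x y hy =>
    (congrFun (congrFun hmap₂ x) y).trans (mask_compl_of_ne hy)
  let U : Set (X ⊕ Y) := {inr u, inr w}ᶜ
  have hU₁ : (mask U B₁).map φ = mask U A := by
    rw [map_mask, hmap₁, mask_mask, Set.inter_eq_left.2 (by simp [U])]
  have hU₂ : (mask U B₂).map φ = mask U A := by
    rw [map_mask, hmap₂, mask_mask, Set.inter_eq_left.2 (by simp [U])]
  have hconnU : ((supportGraph (mask U B₁)).induce (W \ {inr u, inr w})).Preconnected :=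
    preconnected_induce_supportGraph_mono hconn fun x y hx hy hxy => mask_ne_zero_iff.2
      ⟨hx.2, hy.2, (map_ne_zero φ).1 ((hφ₁ x y fun hyu => hy.2 (by simp [hyu])).trans_ne hxy)⟩
  obtain ⟨s, t, hs, ht, hst⟩ := h.agreeUpToScaling (hB₁.mask U) (hB₂.mask U) (hU₁ ▸ hA.mask U)
    (hU₁.trans hU₂.symm) hconnU
  refine ⟨Matrix.of fun x y => s x * B₁ x y * t y, B₂, hB₁.scale s t, hB₂, fun x y hyu => ?_,
    hφ₂, fun x y hyu hyw => ?_⟩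
  · simp [hs, ht, hφ₁ x y hyu]
  have hx : inl x ∈ U := by simp [U]
  have hy : inr y ∈ U := by simp [U, hyu, hyw]
  by_cases hxy : A x y = 0
  · have h₁ : B₁ x y = 0 := (map_eq_zero φ).1 ((hφ₁ x y hyu).trans hxy)
    have h₂ : B₂ x y = 0 := (map_eq_zero φ).1 ((hφ₂ x y hyw).trans hxy)
    simp [h₁, h₂]
  · have heq := hst x y ⟨(hsupp x y hxy).1, hx⟩ ⟨(hsupp x y hxy).2, hy⟩
    rw [mask_of_mem hx hy, mask_of_mem hx hy] at heq
    exact heq.symm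

theorem of_two_cols [Finite X] [Finite Y] (h : IsLifting vQ vP φ) (hA : MinorsInRange vP A)
    (hsupp : SupportedOn A W) {u w : Y} (huw : u ≠ w)
    (hconn : ((supportGraph A).induce (W \ {inr u, inr w})).Preconnected)
    (hu : HasLift vQ φ (mask {inr u}ᶜ A)) (hw : HasLift vQ φ (mask {inr w}ᶜ A)) :
    HasLift vQ φ A := by
  classical
  obtain ⟨B₁, B₂, hB₁, hB₂, hφ₁, hφ₂, hB₁₂⟩ := exists_agreeing_lifts h hA hsupp hconn hu hw
  let B : Matrix X Y Q := B₁.updateCol u fun x => B₂ x u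
  have hBu : ∀ x, B x u = B₂ x u := fun x => Matrix.updateCol_self
  have hB : ∀ x y, y ≠ u → B x y = B₁ x y := fun x y hy => Matrix.updateCol_ne hy
  have hφ : B.map φ = A := by
    ext x y
    by_cases hyu : y = u
    · rw [hyu, Matrix.map_apply, hBu, hφ₂ x u huw]
    · rw [Matrix.map_apply, hB x y hyu, hφ₁ x y hyu]
  refine ⟨B, TwoColumns.minorsInRange (W := W \ {inr u, inr w}) (u := u) (w := w) h
    ⟨huw, by simp, by simp, by rwa [hφ], ?_, ?_, ?_, ?_⟩, hφ⟩
  · rw [mask_congr (A' := B₁) fun x y _ hy => hB x y (by simpa using hy)]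
    exact hB₁.mask _
  · rw [mask_congr (A' := B₂) fun x y _ hy => ?_]
    · exact hB₂.mask _
    · by_cases hyu : y = u
      · rw [hyu, hBu]
      · rw [hB x y hyu, hB₁₂ x y hyu (by simpa using hy)]
  · subst hφ
    exact preconnected_induce_supportGraph_mono hconn fun x y _ _ => (map_ne_zero φ).1
  · subst hφ
    intro x y hxy
    rw [Set.sdiff_union_self]
    exact (hsupp x y ((map_ne_zero φ).2 hxy)).imp Or.inl Or.inl

theorem of_two_rows [Finite X] [Finite Y] (h : IsLifting vQ vP φ) (hA : MinorsInRange vP A)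
    (hsupp : SupportedOn A W) {u w : X} (huw : u ≠ w)
    (hconn : ((supportGraph A).induce (W \ {inl u, inl w})).Preconnected)
    (hu : HasLift vQ φ (mask {inl u}ᶜ A)) (hw : HasLift vQ φ (mask {inl w}ᶜ A)) :
    HasLift vQ φ A := by
  have hset : Sum.swap ⁻¹' (W \ {inl u, inl w}) = Sum.swap ⁻¹' W \ {inr u, inr w} := by
    ext (a | a) <;> simp
  exact (of_two_cols h hA.transpose hsupp.transpose huw
    (hset ▸ preconnected_induce_supportGraph_transpose hconn)
    (mask_compl_inl_transpose A u ▸ hu.transpose)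
    (mask_compl_inl_transpose A w ▸ hw.transpose)).transpose

theorem of_two_by_two (h : IsLifting vQ vP φ) (hA : MinorsInRange vP A) {x x' : X} {y y' : Y}
    (hx : x ≠ x') (hy : y ≠ y') (hsupp : SupportedOn A {inl x, inl x', inr y, inr y'})
    (hxy' : A x y' ≠ 0) (hx'y : A x' y ≠ 0) (hx'y' : A x' y' ≠ 0) : HasLift vQ φ A := by
  classical
  obtain ⟨r, hr, hφr⟩ := h.exists_isFundamental (A x y * A x' y' / (A x y' * A x' y))
    ((isFundamental_div_iff (mul_ne_zero hxy' hx'y)).2 (by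
      rw [sub_mem_mrange_comm h.target_neg_one_mem, map_mul, map_mul]
      exact hA.two_by_two x x' y y'))
  choose lift hlift using h.surjective
  have lift_ne_zero {p : P} (hp : p ≠ 0) : lift p ≠ 0 := (map_ne_zero φ).1 (by rwa [hlift])
  let q : Q := r * (lift (A x y') * lift (A x' y)) / lift (A x' y')
  have hq : φ q = A x y := by
    simp only [q, map_div₀, map_mul, hφr, hlift]
    field_simp
  let B : Matrix X Y Q := Matrix.of fun i j => if i = x ∧ j = y then q else lift (A i j)
  have hφ : B.map φ = A := by
    ext i j
    by_cases hij : i = x ∧ j = y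
    · simp [B, hij, hq]
    · simp [B, hij, hlift]
  refine ⟨B, .of_supportedOn_two_by_two (x := x) (x' := x') (y := y) (y' := y')
    h.source_neg_one_mem (fun i j hij => hsupp i j ?_) ?_, hφ⟩
  · rw [← hφ]
    exact (map_ne_zero φ).2 hij
  · have hcross : q * lift (A x' y') / (lift (A x y') * lift (A x' y)) = r := by
      have := lift_ne_zero hxy'
      have := lift_ne_zero hx'y
      have := lift_ne_zero hx'y'
      simp only [q]
      field_simp
    have hcorner : B x y = q := if_pos ⟨rfl, rfl⟩
    have hrow : ∀ j, B x' j = lift (A x' j) := fun j => if_neg fun hj => hx hj.1.symm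
    have hcol : B x y' = lift (A x y') := if_neg fun hj => hy hj.2.symm
    rw [sub_mem_mrange_comm h.source_neg_one_mem, ← map_mul, ← map_mul, hcorner, hrow, hrow, hcol,
      ← isFundamental_div_iff (mul_ne_zero (lift_ne_zero hxy') (lift_ne_zero hx'y)), hcross]
    exact hr

end HasLift

end PartialField

/-! ### The Lift Theorem -/

namespace PartialField

open Sum
open MonoidHom (mrange)

section Support

variable {P X Y : Type*} [Zero P] {A : Matrix X Y P} {W : Set (X ⊕ Y)}

theorem SupportedOn.mem_of_adj (hA : SupportedOn A W) :
    ∀ {a b : X ⊕ Y}, (supportGraph A).Adj a b → a ∈ W ∧ b ∈ W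
  | inl x, inr y, hxy => hA x y hxy
  | inr y, inl x, hxy => (hA x y hxy).symm

theorem supportedOn_four_cycle [Finite X] [Finite Y]
    (hdeg : ∀ z, ((supportGraph A).neighborSet z).ncard ≤ 2)
    (hW : ((supportGraph A).induce W).Preconnected) (hA : SupportedOn A W) {x x' : X} {y y' : Y}
    (hx : x ≠ x') (hy : y ≠ y') (hxy : A x y ≠ 0) (hxy' : A x y' ≠ 0) (hx'y : A x' y ≠ 0)
    (hx'y' : A x' y' ≠ 0) : SupportedOn A {inl x, inl x', inr y, inr y'} := by
  have neighborSet_eq {z a b : X ⊕ Y} (hab : a ≠ b) (ha : (supportGraph A).Adj z a)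
      (hb : (supportGraph A).Adj z b) : (supportGraph A).neighborSet z = {a, b} :=
    (Set.eq_of_subset_of_ncard_le (t := (supportGraph A).neighborSet z) (Set.pair_subset ha hb)
      ((hdeg z).trans_eq (Set.ncard_pair hab).symm)).symm
  have hrow {i : X} (hi : i = x ∨ i = x') :
      (supportGraph A).neighborSet (inl i) = {inr y, inr y'} := by
    rcases hi with rfl | rfl
    · exact neighborSet_eq (inr_injective.ne hy) hxy hxy'
    · exact neighborSet_eq (inr_injective.ne hy) hx'y hx'y'
  have hcol {j : Y} (hj : j = y ∨ j = y') :
      (supportGraph A).neighborSet (inr j) = {inl x, inl x'} := by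
    rcases hj with rfl | rfl
    · exact neighborSet_eq (inl_injective.ne hx) hxy hx'y
    · exact neighborSet_eq (inl_injective.ne hx) hxy' hx'y'
  have hsub : W ⊆ {inl x, inl x', inr y, inr y'} := by
    refine preconnected_induce_supportGraph_iff.1 hW _ ⟨inl x, (hA x y hxy).1, by simp⟩
      fun i j hij => ?_
    have hij : A i j ≠ 0 := (mask_ne_zero_iff.1 hij).2.2
    constructor
    · intro hi
      have hj : inr j ∈ (supportGraph A).neighborSet (inl i) := hij
      rw [hrow (by simpa using hi)] at hj
      exact Or.inr (Or.inr hj)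
    · intro hj
      have hi : inl i ∈ (supportGraph A).neighborSet (inr j) := hij
      rw [hcol (by simpa using hj)] at hi
      simp only [Set.mem_insert_iff, Set.mem_singleton_iff] at hi ⊢
      tauto
  exact fun i j hij => ⟨hsub (hA i j hij).1, hsub (hA i j hij).2⟩

end Support

section InductiveStep

variable {P Q RP RQ X Y : Type*} [CommGroupWithZero P] [CommGroupWithZero Q] [CommRing RP]
  [CommRing RQ] {vQ : Q →*₀ RQ} {vP : P →*₀ RP} {φ : Q →*₀ P} {A : Matrix X Y P}
  {W : Set (X ⊕ Y)}

namespace HasLift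

variable (h : IsLifting vQ vP φ) (hA : MinorsInRange vP A) (hsupp : SupportedOn A W)
  (ih : ∀ W' ⊂ W, ∀ A : Matrix X Y P, MinorsInRange vP A → SupportedOn A W' → HasLift vQ φ A)

include hA hsupp ih

theorem mask_of_exists_notMem {C : Set (X ⊕ Y)} (hC : ∃ z ∈ W, z ∉ C) :
    HasLift vQ φ (mask C A) := by
  obtain ⟨z, hz, hzC⟩ := hC
  exact ih (W ∩ C) ⟨Set.inter_subset_left, fun hW => hzC (hW hz).2⟩ _ (hA.mask C) (hsupp.mask C)

theorem mask_compl_singleton {z : X ⊕ Y} (hz : z ∈ W) : HasLift vQ φ (mask {z}ᶜ A) :=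
  mask_of_exists_notMem hA hsupp ih ⟨z, hz, by simp⟩

include h

theorem of_not_preconnected (hconn : ¬((supportGraph A).induce W).Preconnected) :
    HasLift vQ φ A := by
  rw [preconnected_induce_supportGraph_iff] at hconn
  push Not at hconn
  obtain ⟨C, ⟨w, hw, hwC⟩, hC, hsub⟩ := hconn
  rw [hsupp.mask_eq_self] at hC
  refine of_isBlockDiagonal h hC ?_ ?_
  · exact mask_of_exists_notMem hA hsupp ih (Set.not_subset.1 hsub)
  · exact mask_of_exists_notMem hA hsupp ih ⟨w, hw, not_not.2 hwC⟩

theorem of_two_lt_ncard_neighborSet [Finite X] [Finite Y] {z : X ⊕ Y}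
    (hz : 2 < ((supportGraph A).neighborSet z).ncard) : HasLift vQ φ A := by
  by_cases hconn : ((supportGraph A).induce W).Preconnected
  swap
  · exact of_not_preconnected h hA hsupp ih hconn
  have hdel {a : X ⊕ Y} (ha : a ∈ W) := mask_compl_singleton hA hsupp ih ha
  have hNW : (supportGraph A).neighborSet z ⊆ W := fun b hb => (hsupp.mem_of_adj hb).2
  obtain ⟨b, hb⟩ := Set.nonempty_of_ncard_ne_zero (zero_lt_two.trans hz).ne'
  obtain ⟨D, hDW, hcard, hD⟩ := exists_removable_of_mem hconn (hsupp.mem_of_adj hb).1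
  rw [Set.inter_eq_left.2 hNW] at hcard
  obtain ⟨u, w, huw, hu, hw⟩ | ⟨u, w, huw, hu, hw⟩ :=
    exists_ne_inl_or_inr_of_two_lt_ncard (hz.trans_le hcard)
  · exact of_two_rows h hA hsupp huw (hD _ (Set.pair_subset hu hw)) (hdel (hDW hu)) (hdel (hDW hw))
  · exact of_two_cols h hA hsupp huw (hD _ (Set.pair_subset hu hw)) (hdel (hDW hu)) (hdel (hDW hw))

/-- Pivoting on the middle edge `x y` of the path `y' x y x' z` gives `x'` the three neighbours
`y`, `y'` and `z`. -/
theorem of_path [Finite X] [Finite Y] {x x' : X} {y y' z : Y} (hyy' : y ≠ y') (hxy : A x y ≠ 0)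
    (hxy' : A x y' ≠ 0) (hx'y : A x' y ≠ 0) (hx'y' : A x' y' = 0) (hxz : A x z = 0)
    (hx'z : A x' z ≠ 0) : HasLift vQ φ A := by
  obtain ⟨A', hp⟩ := hA.exists_isPivot h.target_neg_one_mem hxy
  have hinj := h.target_injective
  have hy : A' x' y ≠ 0 := (hp.col_ne_zero_iff hinj x').2 hx'y
  have hy' : A' x' y' ≠ 0 := hp.ne_zero_of_eq_zero hinj hx'y' hx'y hxy'
  have hz : A' x' z ≠ 0 := by rwa [hp.col_eq hinj hxz]
  have hyz : y ≠ z := fun hyz => hxy (hyz ▸ hxz)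
  have hy'z : y' ≠ z := fun hy'z => hx'z (hy'z ▸ hx'y')
  refine of_isPivot h hp (of_two_lt_ncard_neighborSet (z := inl x') h
    (hA.of_isPivot h.target_neg_one_mem hp) (hp.supportedOn hinj hsupp) ih ?_)
  exact (Set.two_lt_ncard_iff (Set.toFinite _)).2 ⟨inr y, inr y', inr z, hy, hy', hz,
    inr_injective.ne hyy', inr_injective.ne hyz, inr_injective.ne hy'z⟩

theorem of_two_le_degrees [Finite X] [Finite Y] {x : X} {y : Y} (hxy : A x y ≠ 0)
    (hrow : ∀ x, inl x ∈ W → ∀ y, ∃ y', y' ≠ y ∧ A x y' ≠ 0)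
    (hcol : ∀ y, inr y ∈ W → ∀ x, ∃ x', x' ≠ x ∧ A x' y ≠ 0) : HasLift vQ φ A := by
  by_cases hconn : ((supportGraph A).induce W).Preconnected
  swap
  · exact of_not_preconnected h hA hsupp ih hconn
  by_cases hdeg : ∀ z, ((supportGraph A).neighborSet z).ncard ≤ 2
  swap
  · push Not at hdeg
    exact of_two_lt_ncard_neighborSet h hA hsupp ih hdeg.choose_spec
  obtain ⟨y', hy', hxy'⟩ := hrow x (hsupp x y hxy).1 y
  obtain ⟨x', hx', hx'y⟩ := hcol y (hsupp x y hxy).2 x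
  by_cases hx'y' : A x' y' = 0
  · obtain ⟨z, hzy, hx'z⟩ := hrow x' (hsupp x' y hx'y).1 y
    have hzy' : z ≠ y' := fun hz => hx'z (hz ▸ hx'y')
    refine of_path h hA hsupp ih hy'.symm hxy hxy' hx'y hx'y' ?_ hx'z
    by_contra hxz
    exact (hdeg (inl x)).not_gt ((Set.two_lt_ncard_iff (Set.toFinite _)).2 ⟨inr y, inr y', inr z,
      hxy, hxy', hxz, inr_injective.ne hy'.symm, inr_injective.ne hzy.symm,
      inr_injective.ne hzy'.symm⟩)
  · exact of_two_by_two h hA hx'.symm hy'.symm (supportedOn_four_cycle hdeg hconn hsupp hx'.symm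
      hy'.symm hxy hxy' hx'y hx'y') hxy' hx'y hx'y'

theorem of_forall_ssubset [Finite X] [Finite Y] : HasLift vQ φ A := by
  by_cases hcol : ∀ y, inr y ∈ W → ∀ x, ∃ x', x' ≠ x ∧ A x' y ≠ 0
  swap
  · push Not at hcol
    obtain ⟨u, hu, x₀, hux⟩ := hcol
    exact of_unit_col h (mask_compl_singleton hA hsupp ih hu) hux
  by_cases hrow : ∀ x, inl x ∈ W → ∀ y, ∃ y', y' ≠ y ∧ A x y' ≠ 0
  swap
  · push Not at hrow
    obtain ⟨u, hu, y₀, huy⟩ := hrow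
    exact of_unit_row h (mask_compl_singleton hA hsupp ih hu) huy
  by_cases h0 : A = 0
  · exact ⟨0, MinorsInRange.zero, by rw [h0, Matrix.map_zero _ (map_zero φ)]⟩
  obtain ⟨x, y, hxy⟩ : ∃ x y, A x y ≠ 0 := by
    by_contra! hA0
    exact h0 (Matrix.ext hA0)
  exact of_two_le_degrees h hA hsupp ih hxy hrow hcol

end HasLift

theorem IsLifting.hasLift [Finite X] [Finite Y] (h : IsLifting vQ vP φ)
    (hA : MinorsInRange vP A) : HasLift vQ φ A := by
  suffices hasLift_of_supportedOn : ∀ (W : Set (X ⊕ Y)) (A : Matrix X Y P), MinorsInRange vP A →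
      SupportedOn A W → HasLift vQ φ A from
    hasLift_of_supportedOn Set.univ A hA fun _ _ _ => ⟨trivial, trivial⟩
  intro W
  induction W using WellFoundedLT.induction with
  | _ W ih => exact fun A hA hsupp => HasLift.of_forall_ssubset h hA hsupp ih

end InductiveStep

end PartialField

/-! ### The universal ring of a partial field -/

namespace PartialField

section Sums

variable {P : Type*} [PartialField P]

protected theorem neg_zero : -(0 : P) = 0 := by
  refine (eq_neg_of_zero_mem_padd (0 : P) 0 ?_).symm
  rw [padd_zero]
  exact Part.mem_some 0

theorem mem_padd_mul {p q r s : P} (hp : p ≠ 0) (h : s ∈ padd q r) :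
    p * s ∈ padd (p * q) (p * r) := by
  rw [mul_padd p q r hp]
  exact Part.mem_map _ h

protected theorem mul_neg (p q : P) : p * -q = -(p * q) := by
  by_cases hp : p = 0
  · rw [hp, zero_mul, zero_mul, PartialField.neg_zero]
  · have hzero := mem_padd_mul hp (zero_mem_padd_neg q)
    rw [mul_zero] at hzero
    exact eq_neg_of_zero_mem_padd _ _ hzero

theorem association_map_mul {p : P} (hp : p ≠ 0) {S : Multiset P} {r : P}
    (h : Association padd S r) : Association padd (S.map fun q => p * q) (p * r) := by
  induction h with
  | leaf q => exact .leaf _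
  | node _ _ h ih₁ ih₂ =>
    rw [Multiset.map_add]
    exact .node ih₁ ih₂ (mem_padd_mul hp h)

theorem sumIs_singleton (p : P) : SumIs {p} p := ⟨0, by simpa using Association.leaf p⟩

theorem SumIs.add {S T : Multiset P} {r : P} (hS : SumIs S r) (hT : SumIs T 0) :
    SumIs (S + T) r := by
  obtain ⟨Z, hZ⟩ := hS
  obtain ⟨Z', hZ'⟩ := hT
  refine ⟨Z + Z', ?_⟩
  convert Association.node hZ hZ' (r := r) (by rw [padd_zero]; exact Part.mem_some r) using 1
  rw [Multiset.map_add]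
  abel

theorem SumIs.cancel {S W : Multiset P} {r : P} (h : SumIs (S + (W + W.map fun z => -z)) r) :
    SumIs S r := by
  obtain ⟨Z, hZ⟩ := h
  refine ⟨W + Z, ?_⟩
  convert hZ using 1
  rw [Multiset.map_add]
  abel

theorem sumIs_zero : SumIs (0 : Multiset P) 0 :=
  ⟨{0}, by simpa using Association.node (.leaf 0) (.leaf (-0)) (zero_mem_padd_neg (0 : P))⟩

theorem sumIs_pair_add_neg {p q r : P} (h : r ∈ padd p q) : SumIs ({p, q} + {-r}) 0 :=
  ⟨0, by simpa using (Association.node (.node (.leaf p) (.leaf q) h) (.leaf (-r))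
    (zero_mem_padd_neg r) : Association padd ({p} + {q} + {-r}) 0)⟩

theorem sumIs_add_neg (p : P) : SumIs ({p} + {-p}) 0 :=
  ⟨0, by simpa using Association.node (.leaf p) (.leaf (-p)) (zero_mem_padd_neg p)⟩

theorem SumIs.map_mul {S : Multiset P} (hS : SumIs S 0) (p : P) :
    SumIs (S.map fun q => p * q) 0 := by
  by_cases hp : p = 0
  · subst hp
    clear hS
    induction S using Multiset.induction with
    | empty => simpa using sumIs_zero
    | cons a S ih =>
      rw [Multiset.map_cons, zero_mul, ← Multiset.singleton_add]
      exact (sumIs_singleton 0).add ih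
  · obtain ⟨Z, hZ⟩ := hS
    refine ⟨Z.map fun q => p * q, ?_⟩
    have hmul := association_map_mul hp hZ
    rw [mul_zero] at hmul
    convert hmul using 1
    simp only [Multiset.map_add, Multiset.map_map, Function.comp_def, PartialField.mul_neg]

end Sums

section Universal

variable (P : Type*) [PartialField P]

/-- The ideal generated by the relations `p + q - r` for which `p + q = r` in `P`. -/
noncomputable def relIdeal : Ideal (MonoidAlgebra ℤ P) :=
  Ideal.span {x | ∃ p q r : P, r ∈ padd p q ∧
    x = MonoidAlgebra.of ℤ P p + MonoidAlgebra.of ℤ P q - MonoidAlgebra.of ℤ P r}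

/-- The map from `P` to the ring presented by the sums that are defined in `P`. -/
noncomputable def toUniversal : P →*₀ MonoidAlgebra ℤ P ⧸ relIdeal P where
  toFun p := Ideal.Quotient.mk _ (MonoidAlgebra.of ℤ P p)
  map_zero' := by
    rw [Ideal.Quotient.eq_zero_iff_mem]
    exact Ideal.subset_span ⟨0, 0, 0, by rw [padd_zero]; exact Part.mem_some 0, by abel⟩
  map_one' := by rw [map_one, map_one]
  map_mul' p q := by rw [map_mul, map_mul]

variable {P}

theorem toUniversal_of_mem {p q r : P} (h : r ∈ padd p q) :
    toUniversal P r = toUniversal P p + toUniversal P q := by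
  have hrel : Ideal.Quotient.mk (relIdeal P) (MonoidAlgebra.of ℤ P p + MonoidAlgebra.of ℤ P q -
      MonoidAlgebra.of ℤ P r) = 0 :=
    Ideal.Quotient.eq_zero_iff_mem.2 (Ideal.subset_span ⟨p, q, r, h, rfl⟩)
  rw [map_sub, map_add, sub_eq_zero] at hrel
  exact hrel.symm

theorem toUniversal_neg (p : P) : toUniversal P (-p) = -toUniversal P p := by
  have hsum := toUniversal_of_mem (zero_mem_padd_neg p)
  rw [map_zero] at hsum
  exact eq_neg_of_add_eq_zero_right hsum.symm

/-- The formal sum of a multiset of elements of `P`, an element of the ring that `toUniversal`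
takes a quotient of. -/
noncomputable def formalSum (S : Multiset P) : MonoidAlgebra ℤ P :=
  (S.map fun p => MonoidAlgebra.of ℤ P p).sum

theorem formalSum_add (S T : Multiset P) : formalSum (S + T) = formalSum S + formalSum T := by
  rw [formalSum, Multiset.map_add, Multiset.sum_add]
  rfl

theorem coeff_formalSum [DecidableEq P] (S : Multiset P) (p : P) :
    (formalSum S).coeff p = S.count p := by
  induction S using Multiset.induction with
  | empty => simp [formalSum]
  | cons a S ih =>
    rw [← Multiset.singleton_add, formalSum_add, MonoidAlgebra.coeff_add, Finsupp.add_apply, ih,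
      Multiset.count_add, formalSum, Multiset.map_singleton, Multiset.sum_singleton,
      MonoidAlgebra.of_apply, MonoidAlgebra.coeff_single, Finsupp.single_apply,
      Multiset.count_singleton]
    push_cast
    simp [eq_comm]

theorem formalSum_injective : Function.Injective (formalSum (P := P)) := by
  classical
  intro S T h
  ext p
  have hcount := coeff_formalSum S p
  rw [h, coeff_formalSum T p] at hcount
  exact_mod_cast hcount.symm

theorem formalSum_map_mul (p : P) (S : Multiset P) :
    formalSum (S.map fun q => p * q) = MonoidAlgebra.of ℤ P p * formalSum S := by
  rw [formalSum, formalSum, Multiset.map_map, ← Multiset.sum_map_mul_left]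
  simp only [Function.comp_def, map_mul]

/-- The formal differences of multisets with sum `0`. -/
noncomputable def nullSubgroup (P : Type*) [PartialField P] : AddSubgroup (MonoidAlgebra ℤ P) where
  carrier := {x | ∃ S T : Multiset P, SumIs S 0 ∧ SumIs T 0 ∧ x = formalSum S - formalSum T}
  zero_mem' := ⟨0, 0, sumIs_zero, sumIs_zero, by abel⟩
  add_mem' := by
    rintro _ _ ⟨S, T, hS, hT, rfl⟩ ⟨S', T', hS', hT', rfl⟩
    refine ⟨S + S', T + T', hS.add hS', hT.add hT', ?_⟩
    rw [formalSum_add, formalSum_add]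
    abel
  neg_mem' := by
    rintro _ ⟨S, T, hS, hT, rfl⟩
    exact ⟨T, S, hT, hS, by abel⟩

theorem mul_mem_nullSubgroup (a : MonoidAlgebra ℤ P) {x : MonoidAlgebra ℤ P}
    (hx : x ∈ nullSubgroup P) : a * x ∈ nullSubgroup P := by
  induction a using MonoidAlgebra.induction_on with
  | of p =>
    obtain ⟨S, T, hS, hT, rfl⟩ := hx
    refine ⟨_, _, hS.map_mul p, hT.map_mul p, ?_⟩
    rw [formalSum_map_mul, formalSum_map_mul, mul_sub]
  | add a b ha hb =>
    rw [add_mul]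
    exact add_mem ha hb
  | smul n a ha =>
    rw [smul_mul_assoc]
    exact zsmul_mem ha n

theorem mem_nullSubgroup_of_mem_relIdeal {x : MonoidAlgebra ℤ P} (hx : x ∈ relIdeal P) :
    x ∈ nullSubgroup P := by
  induction hx using Submodule.span_induction with
  | mem x hx =>
    obtain ⟨p, q, r, h, rfl⟩ := hx
    refine ⟨_, _, sumIs_pair_add_neg h, sumIs_add_neg r, ?_⟩
    rw [formalSum_add, formalSum_add]
    simp only [formalSum, Multiset.insert_eq_cons, Multiset.map_cons, Multiset.map_singleton,
      Multiset.sum_cons, Multiset.sum_singleton]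
    abel
  | zero => exact zero_mem _
  | add x y _ _ hx hy => exact add_mem hx hy
  | smul a x _ hx => exact mul_mem_nullSubgroup a hx

theorem sumIs_of_toUniversal {S : Multiset P} {d : P}
    (h : (S.map (toUniversal P)).sum = toUniversal P d) : SumIs S d := by
  have hmem : formalSum S - formalSum {d} ∈ relIdeal P := by
    rw [← Ideal.Quotient.eq_zero_iff_mem, map_sub, sub_eq_zero]
    simp only [formalSum, map_multiset_sum, Multiset.map_map, Multiset.map_singleton,
      Multiset.sum_singleton]
    exact h
  obtain ⟨W, W', hW, hW', hdiff⟩ := mem_nullSubgroup_of_mem_relIdeal hmem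
  have hSW' : S + W' = {d} + W := by
    apply formalSum_injective
    rw [formalSum_add, formalSum_add]
    linear_combination hdiff
  have hsum : SumIs (S + W') d := hSW' ▸ (sumIs_singleton d).add hW
  have hneg : SumIs (W'.map fun q => -q) 0 := by
    simpa only [mul_comm (-1 : P), PartialField.mul_neg, mul_one] using hW'.map_mul (-1)
  exact SumIs.cancel (add_assoc S W' _ ▸ hsum.add hneg)

end Universal

end PartialField

/-! ### Determinants and representations -/

namespace PartialField

open MonoidHom (mrange)

/-- The partial addition of `P` is the restriction of the addition of the ring `R`. -/
structure IsEmbedding {P R : Type*} [PartialField P] [CommRing R] (v : P →*₀ R) : Prop where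
  injective : Function.Injective v
  mem_padd : ∀ p q r : P, r ∈ padd p q ↔ v r = v p + v q

section Determinants

theorem sum_map_det_terms {P R : Type*} [PartialField P] [CommRing R] (v : P →*₀ R)
    (hv : ∀ p, v (-p) = -v p) {k : ℕ} (A : Matrix (Fin k) (Fin k) P) :
    (((Finset.univ : Finset (Equiv.Perm (Fin k))).val.map (fun σ =>
      if Equiv.Perm.sign σ = 1 then ∏ i, A i (σ i) else -∏ i, A i (σ i))).map v).sum =
    (A.map v).det := by
  rw [← Matrix.det_transpose, Matrix.det_apply, Multiset.map_map]
  refine Finset.sum_congr rfl fun σ _ => ?_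
  rcases Int.units_eq_one_or (Equiv.Perm.sign σ) with hσ | hσ
  · simp [hσ]
  · have hne : (-1 : ℤˣ) ≠ 1 := by decide
    simp [hσ, hne, hv]

variable {P R X Y : Type*} [PartialField P] [CommRing R] {v : P →*₀ R} {A : Matrix X Y P}

theorem IsEmbedding.map_neg (hv : IsEmbedding v) (p : P) : v (-p) = -v p := by
  have hsum := (hv.mem_padd _ _ _).1 (zero_mem_padd_neg p)
  rw [map_zero] at hsum
  exact eq_neg_of_add_eq_zero_right hsum.symm

theorem IsEmbedding.neg_one_mem (hv : IsEmbedding v) : -1 ∈ mrange v :=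
  ⟨-1, by rw [hv.map_neg, map_one]⟩

theorem DetIs.map_eq_det (hv : IsEmbedding v) {k : ℕ} {A : Matrix (Fin k) (Fin k) P} {d : P}
    (h : DetIs A d) : v d = (A.map v).det := by
  obtain ⟨Z, hZ⟩ := h
  rw [map_association v (fun p q r => (hv.mem_padd p q r).1) hZ, Multiset.map_add,
    Multiset.sum_add, sum_map_det_terms v hv.map_neg]
  simp [Multiset.map_map, hv.map_neg]

theorem detIs_of_toUniversal {k : ℕ} {A : Matrix (Fin k) (Fin k) P} {d : P}
    (h : (A.map (toUniversal P)).det = toUniversal P d) : DetIs A d :=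
  sumIs_of_toUniversal ((sum_map_det_terms _ toUniversal_neg A).trans h)

/-- The relations that define a pivot involve only sums of two elements, so they hold in the
universal ring as soon as they hold in `R`. -/
theorem IsPivot.toUniversal (hv : IsEmbedding v) {A' : Matrix X Y P} {x : X} {y : Y}
    (h : IsPivot v A x y A') : IsPivot (toUniversal P) A x y A' where
  ne_zero := h.ne_zero
  entry := by
    have hentry : A' x y * A x y = -1 := hv.injective (by
      rw [map_mul, h.entry, hv.map_neg, map_one])
    rw [← map_mul, hentry, toUniversal_neg, map_one]
  row := h.row
  col := h.col
  other i j hi hj := by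
    have hother : A' i j ∈ padd (A i j) (-(A i y * A x j * (A x y)⁻¹)) := by
      rw [hv.mem_padd, hv.map_neg, h.other i j hi hj, map_mul, map_mul, sub_eq_add_neg]
    rw [toUniversal_of_mem hother, toUniversal_neg, map_mul, map_mul, sub_eq_add_neg]

theorem MinorsInRange.toUniversal (hv : IsEmbedding v) (hA : MinorsInRange v A) :
    MinorsInRange (toUniversal P) A := by
  have hclosed : PivotClosed (PartialField.toUniversal P) ∅
      {A : Matrix X Y P | MinorsInRange v A} := by
    intro A hA x y _ hxy
    obtain ⟨A', hp⟩ := hA.exists_isPivot hv.neg_one_mem hxy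
    exact ⟨A', hA.of_isPivot hv.neg_one_mem hp, hp.toUniversal hv⟩
  exact hclosed.minorsInRange_of_empty ⟨-1, by rw [toUniversal_neg, map_one]⟩ hA

theorem isPMatrix_iff_minorsInRange (hv : IsEmbedding v) : IsPMatrix A ↔ MinorsInRange v A := by
  constructor
  · intro hA k f g
    refine minor_mem_of_injective fun hf hg => ?_
    obtain ⟨d, hd⟩ := hA k f g hf hg
    exact ⟨d, hd.map_eq_det hv⟩
  · intro hA k f g _ _
    obtain ⟨d, hd⟩ := hA.toUniversal hv k f g
    exact ⟨d, detIs_of_toUniversal hd.symm⟩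

theorem detNeZero_submatrix_iff (hv : IsEmbedding v) (hA : MinorsInRange v A) {k : ℕ}
    (f : Fin k → X) (g : Fin k → Y) : DetNeZero (A.submatrix f g) ↔ minor v A f g ≠ 0 := by
  have map_ne_zero_iff (d : P) : v d ≠ 0 ↔ d ≠ 0 := map_ne_zero_iff v hv.injective
  constructor
  · rintro ⟨d, hd, hdet⟩
    rwa [minor, ← hdet.map_eq_det hv, map_ne_zero_iff]
  · intro hne
    obtain ⟨d, hd⟩ := (isPMatrix_iff_minorsInRange hv).2 (hA.submatrix f g) k id id
      Function.injective_id Function.injective_id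
    refine ⟨d, ?_, hd⟩
    rwa [← map_ne_zero_iff, hd.map_eq_det hv]

theorem rank_eq {r : ℕ} {A : Matrix (Fin r) Y P} {g : Fin r → Y} (hg : g.Injective)
    (h : DetNeZero (A.submatrix id g)) : rank A = r := by
  refine IsGreatest.csSup_eq ⟨⟨id, g, Function.injective_id, hg, h⟩, ?_⟩
  rintro k ⟨f, -, hf, -, -⟩
  simpa using Fintype.card_le_of_injective f hf

end Determinants

section Representations

variable {P R α : Type*} [PartialField P] [CommRing R] {v : P →*₀ R}

theorem mem_basesOf_iff (hv : IsEmbedding v) {E : Set α} {r : ℕ} {A : Matrix (Fin r) E P}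
    (hA : MinorsInRange v A) {B : Set α} : B ∈ basesOf A ↔ ∃ g : Fin r → E,
      Function.Injective g ∧ Set.range (fun i => (g i : α)) = B ∧ minor v A id g ≠ 0 :=
  exists_congr fun g => and_congr_right fun _ => and_congr_right fun _ =>
    detNeZero_submatrix_iff hv hA id g

theorem isRepresentable_iff (hv : IsEmbedding v) (M : Matroid α) :
    IsRepresentable P M ↔ ∃ (r : ℕ) (A : Matrix (Fin r) M.E P), MinorsInRange v A ∧
      ∀ B, M.IsBase B ↔ B ∈ basesOf A := by
  constructor
  · rintro ⟨r, A, hA, -, hB⟩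
    exact ⟨r, A, (isPMatrix_iff_minorsInRange hv).1 hA, hB⟩
  · rintro ⟨r, A, hA, hB⟩
    obtain ⟨B, hBase⟩ := M.exists_isBase
    obtain ⟨g, hg, -, hdet⟩ := (hB B).1 hBase
    exact ⟨r, A, (isPMatrix_iff_minorsInRange hv).2 hA, rank_eq hg hdet, hB⟩

variable {Q RQ : Type*} [PartialField Q] [CommRing RQ] {vQ : Q →*₀ RQ} {φ : Q →*₀ P}
  {ρ : RQ →+* R}

theorem minor_map {X Y : Type*} (hρ : ∀ q, ρ (vQ q) = v (φ q)) (B : Matrix X Y Q) {k : ℕ}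
    (f : Fin k → X) (g : Fin k → Y) : minor v (B.map φ) f g = ρ (minor vQ B f g) := by
  simp only [minor, RingHom.map_det]
  congr 1
  ext i j
  exact (hρ _).symm

theorem MinorsInRange.map {X Y : Type*} (hρ : ∀ q, ρ (vQ q) = v (φ q)) {B : Matrix X Y Q}
    (hB : MinorsInRange vQ B) : MinorsInRange v (B.map φ) := by
  intro k f g
  obtain ⟨d, hd⟩ := hB k f g
  exact ⟨φ d, by rw [minor_map hρ, ← hd, hρ]⟩

theorem basesOf_map (hv : IsEmbedding v) (hvQ : IsEmbedding vQ) (hρ : ∀ q, ρ (vQ q) = v (φ q))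
    {E : Set α} {r : ℕ} {B : Matrix (Fin r) E Q} (hB : MinorsInRange vQ B) :
    basesOf (B.map φ) = basesOf B := by
  ext S
  rw [mem_basesOf_iff hv (hB.map hρ), mem_basesOf_iff hvQ hB]
  refine exists_congr fun g => and_congr_right fun _ => and_congr_right fun _ => ?_
  obtain ⟨d, hd⟩ := hB r id g
  rw [minor_map hρ, ← hd, hρ, map_ne_zero_iff v hv.injective, map_ne_zero_iff vQ hvQ.injective,
    map_ne_zero]

theorem isRepresentable_iff_of_isLifting (hv : IsEmbedding v) (hvQ : IsEmbedding vQ)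
    (h : IsLifting vQ v φ) (hρ : ∀ q, ρ (vQ q) = v (φ q)) (M : Matroid α) [M.Finite] :
    IsRepresentable P M ↔ IsRepresentable Q M := by
  rw [isRepresentable_iff hv, isRepresentable_iff hvQ]
  constructor
  · rintro ⟨r, A, hA, hbase⟩
    have : Finite M.E := M.ground_finite
    obtain ⟨B, hB, rfl⟩ := h.hasLift hA
    exact ⟨r, B, hB, fun S => by rw [hbase, basesOf_map hv hvQ hρ hB]⟩
  · rintro ⟨r, B, hB, hbase⟩
    exact ⟨r, B.map φ, hB.map hρ, fun S => by rw [hbase, basesOf_map hv hvQ hρ hB]⟩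

end Representations

end PartialField

/-! ### Unit equations for `2` and `3` -/

namespace UnitEquation

theorem three_pow_mod (l : ℕ) :
    3 ^ l % 80 = 1 ∨ 3 ^ l % 80 = 3 ∨ 3 ^ l % 80 = 9 ∨ 3 ^ l % 80 = 27 := by
  induction l with
  | zero => simp
  | succ l ih => rw [pow_succ]; omega

theorem two_pow_mod (k : ℕ) :
    2 ^ (k + 4) % 80 = 16 ∨ 2 ^ (k + 4) % 80 = 32 ∨ 2 ^ (k + 4) % 80 = 64 ∨
      2 ^ (k + 4) % 80 = 48 := by
  induction k with
  | zero => simp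
  | succ k ih => rw [Nat.add_right_comm, pow_succ]; omega

/-- The exponents `(k, l)` such that `2 ^ k` and `3 ^ l` are consecutive integers. -/
def consecutivePowers : List (ℤ × ℤ) :=
  [(1, 0), (1, 1), (2, 1), (3, 2)]

theorem mem_consecutivePowers_of_nat {k l : ℕ} (h : 2 ^ k = 3 ^ l + 1 ∨ 2 ^ k + 1 = 3 ^ l) :
    ((k : ℤ), (l : ℤ)) ∈ consecutivePowers := by
  -- Modulo `80`, the powers `2 ^ k` with `4 ≤ k` are not adjacent to any power of `3`.
  have hk : k < 4 := by
    by_contra! hk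
    obtain ⟨j, rfl⟩ := Nat.exists_eq_add_of_le' hk
    have h2 := two_pow_mod j
    have h3 := three_pow_mod l
    omega
  have hl : l < 3 := by
    by_contra! hl
    have h27 : 3 ^ 3 ≤ 3 ^ l := Nat.pow_le_pow_right (by norm_num) hl
    have h8 : 2 ^ k ≤ 2 ^ 3 := Nat.pow_le_pow_right (by norm_num) (by omega)
    omega
  interval_cases k <;> interval_cases l <;> simp_all [consecutivePowers]

theorem mem_consecutivePowers {k l : ℤ} {ε δ γ : ℚ} (hε : ε = 1 ∨ ε = -1) (hδ : δ = 1 ∨ δ = -1)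
    (hγ : γ = 1 ∨ γ = -1) (hk : 0 ≤ k) (hl : 0 ≤ l) (h : ε * 2 ^ k + δ * 3 ^ l = γ) :
    (k, l) ∈ consecutivePowers := by
  lift k to ℕ using hk
  lift l to ℕ using hl
  refine mem_consecutivePowers_of_nat ?_
  have one_le_two_pow : (1 : ℚ) ≤ 2 ^ k := one_le_pow₀ (by norm_num)
  have one_le_three_pow : (1 : ℚ) ≤ 3 ^ l := one_le_pow₀ (by norm_num)
  rw [zpow_natCast, zpow_natCast] at h
  suffices (2 : ℚ) ^ k = 3 ^ l + 1 ∨ (2 : ℚ) ^ k + 1 = 3 ^ l by exact_mod_cast this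
  rcases hε with rfl | rfl <;> rcases hδ with rfl | rfl <;> rcases hγ with rfl | rfl <;>
    first
    | exact Or.inl (by linarith)
    | exact Or.inr (by linarith)

theorem padicValRat_of_add_eq_one (p : ℕ) [Fact p.Prime] {x y : ℚ} (hx : x ≠ 0) (hy : y ≠ 0)
    (h : x + y = 1) :
    padicValRat p x = 0 ∧ 0 ≤ padicValRat p y ∨ padicValRat p y = 0 ∧ 0 ≤ padicValRat p x ∨
      padicValRat p x = padicValRat p y ∧ padicValRat p x ≤ 0 := by
  have hsum : padicValRat p (x + y) = 0 := by rw [h, padicValRat.one]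
  have hsum_ne : x + y ≠ 0 := by rw [h]; exact one_ne_zero
  by_cases hxy : padicValRat p x = padicValRat p y
  · have hmin := padicValRat.min_le_padicValRat_add (p := p) hsum_ne
    rw [hsum, ← hxy, min_self] at hmin
    exact Or.inr (Or.inr ⟨hxy, hmin⟩)
  · have hmin := padicValRat.add_eq_min (p := p) hsum_ne hx hy hxy
    rw [hsum] at hmin
    omega

section SUnits

variable {ε : ℚ} (hε : ε = 1 ∨ ε = -1) (m n : ℤ)
include hε

theorem padicValRat_eq (p : ℕ) [Fact p.Prime] :
    padicValRat p (ε * 2 ^ m * 3 ^ n) = m * padicValRat p 2 + n * padicValRat p 3 := by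
  have hε0 : ε ≠ 0 := by rcases hε with rfl | rfl <;> norm_num
  have hval : padicValRat p ε = 0 := by rcases hε with rfl | rfl <;> simp
  rw [padicValRat.mul (by positivity) (by positivity), padicValRat.mul hε0 (by positivity),
    padicValRat.zpow, padicValRat.zpow, hval, zero_add]

theorem padicValRat_two : padicValRat 2 (ε * 2 ^ m * 3 ^ n) = m := by
  have two_self : padicValRat 2 2 = 1 := mod_cast padicValRat.self (p := 2) (by norm_num)
  have two_three : padicValRat 2 3 = 0 :=
    mod_cast padicValRat.of_nat.trans
      (congrArg Nat.cast (padicValNat.eq_zero_of_not_dvd (p := 2) (n := 3) (by norm_num)))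
  rw [padicValRat_eq hε, two_self, two_three, mul_one, mul_zero, add_zero]

theorem padicValRat_three : padicValRat 3 (ε * 2 ^ m * 3 ^ n) = n := by
  have three_self : padicValRat 3 3 = 1 := mod_cast padicValRat.self (p := 3) (by norm_num)
  have three_two : padicValRat 3 2 = 0 :=
    mod_cast padicValRat.of_nat.trans
      (congrArg Nat.cast (padicValNat.eq_zero_of_not_dvd (p := 3) (n := 2) (by norm_num)))
  rw [padicValRat_eq hε, three_self, three_two, mul_one, mul_zero, zero_add]

variable {m n}

theorem exponents_eq_zero (h : ε * 2 ^ m * 3 ^ n = 1) : m = 0 ∧ n = 0 := by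
  have hm := padicValRat_two hε m n
  have hn := padicValRat_three hε m n
  rw [h, padicValRat.one] at hm hn
  exact ⟨hm.symm, hn.symm⟩

theorem exponents_eq_of_eq_two (h : ε * 2 ^ m * 3 ^ n = 2) : m = 1 ∧ n = 0 := by
  suffices m - 1 = 0 ∧ n = 0 by omega
  refine exponents_eq_zero hε ?_
  rw [zpow_sub_one₀ two_ne_zero]
  linear_combination h / 2

end SUnits

theorem exponent_trichotomy {m n m' n' : ℤ} {ε δ : ℚ} (hε : ε = 1 ∨ ε = -1)
    (hδ : δ = 1 ∨ δ = -1) (h : ε * 2 ^ m * 3 ^ n + δ * 2 ^ m' * 3 ^ n' = 1) :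
    (m = 0 ∧ 0 ≤ m' ∨ m' = 0 ∧ 0 ≤ m ∨ m = m' ∧ m ≤ 0) ∧
      (n = 0 ∧ 0 ≤ n' ∨ n' = 0 ∧ 0 ≤ n ∨ n = n' ∧ n ≤ 0) := by
  have hε0 : ε ≠ 0 := by rcases hε with rfl | rfl <;> norm_num
  have hδ0 : δ ≠ 0 := by rcases hδ with rfl | rfl <;> norm_num
  have two_cases := padicValRat_of_add_eq_one 2 (by positivity) (by positivity) h
  have three_cases := padicValRat_of_add_eq_one 3 (by positivity) (by positivity) h
  rw [padicValRat_two hε, padicValRat_two hδ] at two_cases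
  rw [padicValRat_three hε, padicValRat_three hδ] at three_cases
  exact ⟨two_cases, three_cases⟩

/-- The exponents `(m, n)` of the solutions `x = ± 2 ^ m * 3 ^ n`, `y = ± 2 ^ m' * 3 ^ n'` of
`x + y = 1`. Up to a common factor, `x`, `y` and `1` are `± 2 ^ k`, `± 3 ^ l` and `± 1` in some
order, where `2 ^ k` and `3 ^ l` are consecutive. -/
def exponents : List (ℤ × ℤ) :=
  consecutivePowers.flatMap fun (k, l) => [(0, l), (0, -l), (k, 0), (k, -l), (-k, 0), (-k, l)]

theorem mem_exponents_of_mem_consecutivePowers : ∀ p ∈ consecutivePowers,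
    (0, p.2) ∈ exponents ∧ (0, -p.2) ∈ exponents ∧ (p.1, 0) ∈ exponents ∧
      (p.1, -p.2) ∈ exponents ∧ (-p.1, 0) ∈ exponents ∧ (-p.1, p.2) ∈ exponents := by
  decide

theorem mem_exponents {m n m' n' : ℤ} {ε δ : ℚ} (hε : ε = 1 ∨ ε = -1) (hδ : δ = 1 ∨ δ = -1)
    (h : ε * 2 ^ m * 3 ^ n + δ * 2 ^ m' * 3 ^ n' = 1) : (m, n) ∈ exponents := by
  have hone : (1 : ℚ) = 1 ∨ (1 : ℚ) = -1 := Or.inl rfl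
  have hε' : -ε = 1 ∨ -ε = -1 := by rcases hε with rfl | rfl <;> simp
  have hδ' : -δ = 1 ∨ -δ = -1 := by rcases hδ with rfl | rfl <;> simp
  have ⟨two_cases, three_cases⟩ := exponent_trichotomy hε hδ h
  have inv_two (j : ℤ) : (2 : ℚ) ^ j * 2 ^ (-j) = 1 := by
    rw [← zpow_add₀ two_ne_zero, add_neg_cancel, zpow_zero]
  have inv_three (j : ℤ) : (3 : ℚ) ^ j * 3 ^ (-j) = 1 := by
    rw [← zpow_add₀ three_ne_zero, add_neg_cancel, zpow_zero]
  rcases two_cases with ⟨rfl, hm⟩ | ⟨rfl, hm⟩ | ⟨rfl, hm⟩ <;>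
    rcases three_cases with ⟨rfl, hn⟩ | ⟨rfl, hn⟩ | ⟨rfl, hn⟩ <;>
    try simp only [zpow_zero, mul_one] at h
  · decide
  · exact (mem_exponents_of_mem_consecutivePowers _ <| mem_consecutivePowers hδ hε hone hm hn
      (by linear_combination h)).1
  · simpa using (mem_exponents_of_mem_consecutivePowers _ <| mem_consecutivePowers hδ' hone hε hm
      (neg_nonneg.2 hn) (by
        linear_combination (-3 ^ (-n)) * h + (ε + δ * 2 ^ m') * inv_three n)).2.1
  · exact (mem_exponents_of_mem_consecutivePowers _ <| mem_consecutivePowers hε hδ hone hm hn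
      h).2.2.1
  · rcases hδ with rfl | rfl
    · have hε0 : ε ≠ 0 := by rcases hε with rfl | rfl <;> norm_num
      exact absurd (add_eq_right.1 h) (by positivity)
    · obtain ⟨rfl, rfl⟩ := exponents_eq_of_eq_two hε (m := m) (n := n) (by linear_combination h)
      decide
  · simpa using (mem_exponents_of_mem_consecutivePowers _ <| mem_consecutivePowers hε' hone hδ hm
      (neg_nonneg.2 hn) (by
        linear_combination (-3 ^ (-n)) * h + (ε * 2 ^ m + δ) * inv_three n)).2.2.2.1
  · simpa using (mem_exponents_of_mem_consecutivePowers _ <| mem_consecutivePowers hone hδ' hε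
      (neg_nonneg.2 hm) hn (by
        linear_combination (-2 ^ (-m)) * h + (ε + δ * 3 ^ n') * inv_two m)).2.2.2.2.1
  · simpa using (mem_exponents_of_mem_consecutivePowers _ <| mem_consecutivePowers hone hε' hδ
      (neg_nonneg.2 hm) hn (by
        linear_combination (-2 ^ (-m)) * h + (ε * 3 ^ n + δ) * inv_two m)).2.2.2.2.2
  · obtain rfl : δ = ε := by rcases hε with rfl | rfl <;> rcases hδ with rfl | rfl <;> simp_all
    obtain ⟨hm₁, rfl⟩ := exponents_eq_zero hδ (m := m + 1) (n := n) (by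
      rw [zpow_add_one₀ two_ne_zero]
      linear_combination h)
    obtain rfl : m = -1 := by omega
    decide

end UnitEquation

/-! ### A unit equation in `ℤ[i, 1/2]` -/

theorem zpow_eq_zpow_iff_of_isPrimitiveRoot {G : Type*} [CommGroupWithZero G] {ζ : G} {n : ℕ}
    (hζ : IsPrimitiveRoot ζ n) (hζ0 : ζ ≠ 0) (k l : ℤ) : ζ ^ k = ζ ^ l ↔ (n : ℤ) ∣ k - l := by
  rw [← hζ.zpow_eq_one_iff_dvd, zpow_sub₀ hζ0, div_eq_one_iff_eq (zpow_ne_zero _ hζ0)]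

namespace GaussianUnits

open Complex

theorem one_add_I_ne_zero : (1 + I : ℂ) ≠ 0 := fun h => by simpa using congrArg re h

theorem I_zpow_two : I ^ (2 : ℤ) = -1 := mod_cast I_sq

theorem I_zpow_three : I ^ (3 : ℤ) = -I := mod_cast I_pow_three

theorem normSq_one_add_I : normSq (1 + I) = 2 := by
  norm_num [normSq_apply]

theorem normSq_I_zpow_mul (k n : ℤ) : normSq (I ^ k * (1 + I) ^ n) = 2 ^ n := by
  rw [map_mul, map_zpow₀, map_zpow₀, normSq_I, one_zpow, one_mul, normSq_one_add_I]

theorem I_zpow_mul_ne_zero (k n : ℤ) : I ^ k * (1 + I) ^ n ≠ 0 :=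
  mul_ne_zero (zpow_ne_zero _ I_ne_zero) (zpow_ne_zero _ one_add_I_ne_zero)

theorem I_zpow_mul_eq_iff (k n l m : ℤ) :
    I ^ k * (1 + I) ^ n = I ^ l * (1 + I) ^ m ↔ 4 ∣ k - l ∧ n = m := by
  have I_zpow_eq_iff := zpow_eq_zpow_iff_of_isPrimitiveRoot isPrimitiveRoot_I I_ne_zero k l
  constructor
  · intro h
    have hnorm := congrArg normSq h
    rw [normSq_I_zpow_mul, normSq_I_zpow_mul] at hnorm
    obtain rfl := zpow_right_injective₀ (by norm_num : (0 : ℝ) < 2) (by norm_num) hnorm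
    exact ⟨I_zpow_eq_iff.1 (mul_right_cancel₀ (zpow_ne_zero _ one_add_I_ne_zero) h), rfl⟩
  · rintro ⟨h, rfl⟩
    rw [I_zpow_eq_iff.2 h]

theorem mem_range_toComplex (k : ℤ) (n : ℕ) :
    I ^ k * (1 + I) ^ n ∈ GaussianInt.toComplex.range := by
  have hI : I ∈ GaussianInt.toComplex.range := ⟨⟨0, 1⟩, by simp [GaussianInt.toComplex_def]⟩
  rw [I_zpow_eq_zpow_mod, ← Int.toNat_of_nonneg (Int.emod_nonneg k four_ne_zero), zpow_natCast]
  exact mul_mem (pow_mem hI _) (pow_mem (add_mem (one_mem _) hI) _)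

theorem add_ne_I_zpow (k l j : ℤ) {n m : ℤ} (hn : 0 < n) (hm : 0 < m) :
    I ^ k * (1 + I) ^ n + I ^ l * (1 + I) ^ m ≠ I ^ j := by
  -- The left side is a Gaussian integer of even norm.
  intro h
  obtain ⟨a, rfl⟩ : ∃ a : ℕ, n = a + 1 := ⟨(n - 1).toNat, by omega⟩
  obtain ⟨b, rfl⟩ : ∃ b : ℕ, m = b + 1 := ⟨(m - 1).toNat, by omega⟩
  obtain ⟨x, hx⟩ := add_mem (mem_range_toComplex k a) (mem_range_toComplex l b)
  have hfactor : (1 + I) * GaussianInt.toComplex x = I ^ j := by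
    rw [hx, ← h, zpow_add_one₀ one_add_I_ne_zero, zpow_add_one₀ one_add_I_ne_zero, zpow_natCast,
      zpow_natCast]
    ring
  have hnorm := congrArg normSq hfactor
  rw [map_mul, map_zpow₀, normSq_I, one_zpow, ← GaussianInt.intCast_real_norm,
    normSq_one_add_I] at hnorm
  have htwo : 2 * x.norm = 1 := by exact_mod_cast hnorm
  omega

theorem not_neg_and_lt {k l n m : ℤ} (h : I ^ k * (1 + I) ^ n + I ^ l * (1 + I) ^ m = 1) :
    ¬(n < 0 ∧ n < m) := by
  rintro ⟨hn, hm⟩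
  refine add_ne_I_zpow 0 (l + 2) k (n := -n) (m := m - n) (by omega) (by omega) ?_
  have hz := zpow_ne_zero n one_add_I_ne_zero
  rw [zpow_add₀ I_ne_zero, I_zpow_two, zpow_sub₀ one_add_I_ne_zero, zpow_neg, zpow_zero]
  field_simp
  linear_combination -h

theorem exponent_trichotomy {k l n m : ℤ} (h : I ^ k * (1 + I) ^ n + I ^ l * (1 + I) ^ m = 1) :
    n = 0 ∨ m = 0 ∨ n = m := by
  have hnm := not_neg_and_lt h
  have hmn := not_neg_and_lt ((add_comm _ _).trans h)
  by_contra! hne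
  exact add_ne_I_zpow k l 0 (n := n) (m := m) (by omega) (by omega) (h.trans (zpow_zero I).symm)

theorem I_zpow_cases (k : ℤ) : k % 4 = 0 ∧ I ^ k = 1 ∨ k % 4 = 1 ∧ I ^ k = I ∨
    k % 4 = 2 ∧ I ^ k = -1 ∨ k % 4 = 3 ∧ I ^ k = -I := by
  have hnonneg := Int.emod_nonneg k four_ne_zero
  have hlt := Int.emod_lt_of_pos k four_pos
  rw [I_zpow_eq_zpow_mod]
  generalize k % 4 = r at *
  interval_cases r
  · exact Or.inl ⟨rfl, zpow_zero I⟩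
  · exact Or.inr (Or.inl ⟨rfl, zpow_one I⟩)
  · exact Or.inr (Or.inr (Or.inl ⟨rfl, I_zpow_two⟩))
  · exact Or.inr (Or.inr (Or.inr ⟨rfl, I_zpow_three⟩))

theorem one_sub_I_zpow_cases (l : ℤ) :
    1 - I ^ l = 0 ∨ 1 - I ^ l = I ^ (3 : ℤ) * (1 + I) ^ (1 : ℤ) ∨
      1 - I ^ l = I ^ (3 : ℤ) * (1 + I) ^ (2 : ℤ) ∨
        1 - I ^ l = I ^ (0 : ℤ) * (1 + I) ^ (1 : ℤ) := by
  rw [I_zpow_three, zpow_one, zpow_zero, zpow_ofNat]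
  rcases I_zpow_cases l with ⟨-, hl⟩ | ⟨-, hl⟩ | ⟨-, hl⟩ | ⟨-, hl⟩ <;> rw [hl]
  · exact Or.inl (sub_self 1)
  · exact Or.inr (Or.inl (by linear_combination I_sq))
  · exact Or.inr (Or.inr (Or.inl (by linear_combination (2 + I) * I_sq)))
  · exact Or.inr (Or.inr (Or.inr (by ring)))

theorem exponents_of_eq_one_sub {k n l : ℤ} (h : I ^ k * (1 + I) ^ n = 1 - I ^ l) :
    k % 4 = 3 ∧ n = 1 ∨ k % 4 = 3 ∧ n = 2 ∨ k % 4 = 0 ∧ n = 1 := by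
  rcases one_sub_I_zpow_cases l with hl | hl | hl | hl <;> rw [hl] at h
  · exact absurd h (I_zpow_mul_ne_zero k n)
  all_goals
    rw [I_zpow_mul_eq_iff] at h
    omega

/-- The exponents `(k, n)`, where `0 ≤ k < 4`, of the solutions `x = I ^ k * (1 + I) ^ n`,
`y = I ^ l * (1 + I) ^ m` of `x + y = 1`. -/
def exponents : List (ℤ × ℤ) :=
  [(1, 0), (2, 0), (3, 0), (3, 1), (3, 2), (0, 1), (0, -1), (1, -1), (1, -2)]

theorem mem_exponents {k l n m : ℤ} (h : I ^ k * (1 + I) ^ n + I ^ l * (1 + I) ^ m = 1) :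
    (k % 4, n) ∈ exponents := by
  simp only [exponents, List.mem_cons, Prod.mk.injEq, List.not_mem_nil, or_false]
  rcases exponent_trichotomy h with rfl | rfl | rfl
  · rcases I_zpow_cases k with ⟨-, hone⟩ | ⟨hk, -⟩ | ⟨hk, -⟩ | ⟨hk, -⟩
    · rw [hone, zpow_zero, mul_one, add_eq_left] at h
      exact absurd h (I_zpow_mul_ne_zero l m)
    all_goals simp [hk]
  · rw [zpow_zero, mul_one] at h
    rcases exponents_of_eq_one_sub (eq_sub_of_add_eq h) with h | h | h <;> omega
  · have hn := zpow_ne_zero n one_add_I_ne_zero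
    have hk := zpow_ne_zero k I_ne_zero
    have hinv : I ^ (-k) * (1 + I) ^ (-n) = 1 - I ^ (l - k + 2) := by
      rw [zpow_add₀ I_ne_zero, zpow_sub₀ I_ne_zero, I_zpow_two, zpow_neg, zpow_neg]
      field_simp
      linear_combination -h
    rcases exponents_of_eq_one_sub hinv with h | h | h <;> omega

end GaussianUnits

/-! ### The 2-cyclotomic partial field -/

namespace RingPartialField

variable {R : Type*} [CommRing R] [Nontrivial R] {S : Set Rˣ}

/-- The inclusion of `ℙ(R, S)` in `R`. -/
def valHom : RingPartialField R S →*₀ R where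
  toFun := val
  map_zero' := rfl
  map_one' := rfl
  map_mul' _ _ := rfl

theorem valHom_apply (x : RingPartialField R S) : valHom x = x.val := rfl

theorem exists_isEmbedding {A : Type*} [CommRing A] (E : A →+* R) (hE : Function.Injective E)
    (hS : ∀ u ∈ S, ∃ w : Aˣ, E w = u) :
    ∃ v : RingPartialField R S →*₀ A, PartialField.IsEmbedding v ∧ ∀ q, E (v q) = q.val := by
  have closure_le : Subgroup.closure (S ∪ {-1}) ≤ (Units.map (E : A →* R)).range := by
    rw [Subgroup.closure_le]
    rintro u (hu | rfl)
    · obtain ⟨w, hw⟩ := hS u hu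
      exact ⟨w, Units.ext hw⟩
    · exact ⟨-1, Units.ext (by simp)⟩
  have exists_preimage : ∀ q : RingPartialField R S, ∃ a, E a = q.val := by
    rintro ⟨_, rfl | ⟨u, hu, rfl⟩⟩
    · exact ⟨0, map_zero E⟩
    · obtain ⟨w, rfl⟩ := closure_le hu
      exact ⟨w, rfl⟩
  choose v hv using exists_preimage
  refine ⟨⟨⟨v, ?_⟩, ?_, ?_⟩, ⟨?_, ?_⟩, hv⟩
  · exact hE (by rw [hv, map_zero]; rfl)
  · exact hE (by rw [hv, map_one]; rfl)
  · intro p q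
    exact hE (by rw [hv, map_mul, hv, hv]; rfl)
  · intro p q h
    exact RingPartialField.ext (by rw [← hv, ← hv]; exact congrArg E h)
  · intro p q r
    refine mem_add.trans ?_
    rw [← hv, ← hv, ← hv, ← map_add]
    exact hE.eq_iff

end RingPartialField

namespace TwoCyclotomic

open Polynomial

/-- The ring `ℤ[α, 1 / α, 1 / (α - 1), 1 / (α + 1)]`, which contains `𝕂₂` and maps to any field by
evaluation at an element other than `0`, `1` and `-1`. -/
abbrev Loc : Type := Localization.Away (X * (X - 1) * (X + 1) : ℤ[X])

section Evaluation

variable {K : Type*} [Field K] (z : K) (hz : z * (z - 1) * (z + 1) ≠ 0)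

/-- Evaluation at `z`. -/
noncomputable def ev : Loc →+* K :=
  IsLocalization.Away.lift (X * (X - 1) * (X + 1) : ℤ[X])
    (g := eval₂RingHom (Int.castRingHom K) z) (by simpa using hz)

theorem ev_algebraMap (p : ℤ[X]) :
    ev z hz (algebraMap ℤ[X] Loc p) = p.eval₂ (Int.castRingHom K) z :=
  IsLocalization.Away.lift_eq _ _ _

end Evaluation

theorem ratFunc_ne_zero : (RatFunc.X * (RatFunc.X - 1) * (RatFunc.X + 1) : RatFunc ℚ) ≠ 0 :=
  mul_ne_zero (mul_ne_zero RatFunc.X_ne_zero ratFunc_X_sub_one_ne_zero) ratFunc_X_add_one_ne_zero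

/-- The inclusion of `ℤ[α, 1 / α, 1 / (α - 1), 1 / (α + 1)]` in `ℚ(α)`. -/
noncomputable def toRatFunc : Loc →+* RatFunc ℚ := ev RatFunc.X ratFunc_ne_zero

theorem toRatFunc_algebraMap (p : ℤ[X]) : toRatFunc (algebraMap ℤ[X] Loc p) =
    algebraMap ℚ[X] (RatFunc ℚ) (p.map (Int.castRingHom ℚ)) := by
  have eval₂_eq : eval₂RingHom (Int.castRingHom (RatFunc ℚ)) RatFunc.X =
      (algebraMap ℚ[X] (RatFunc ℚ)).comp (mapRingHom (Int.castRingHom ℚ)) := by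
    ext <;> simp
  exact (ev_algebraMap _ _ _).trans (DFunLike.congr_fun eval₂_eq p)

theorem toRatFunc_injective : Function.Injective toRatFunc := by
  refine IsLocalization.injective_of_map_algebraMap_zero
    (M := Submonoid.powers (X * (X - 1) * (X + 1) : ℤ[X])) Loc _ fun p hp => ?_
  rw [toRatFunc_algebraMap, map_eq_zero_iff _ (RatFunc.algebraMap_injective ℚ),
    Polynomial.map_eq_zero_iff Int.cast_injective] at hp
  rw [hp, map_zero]

theorem isUnit_factors : IsUnit (algebraMap ℤ[X] Loc X) ∧
    IsUnit (algebraMap ℤ[X] Loc (X - 1)) ∧ IsUnit (algebraMap ℤ[X] Loc (X + 1)) := by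
  have isUnit_mul : IsUnit (algebraMap ℤ[X] Loc (X * (X - 1) * (X + 1))) :=
    IsLocalization.Away.algebraMap_isUnit _
  rwa [map_mul, map_mul, IsUnit.mul_iff, IsUnit.mul_iff, and_assoc] at isUnit_mul

theorem exists_isEmbedding : ∃ v : TwoCyclotomicPF →*₀ Loc, PartialField.IsEmbedding v ∧
    ∀ q, toRatFunc (v q) = q.val := by
  refine RingPartialField.exists_isEmbedding _ toRatFunc_injective ?_
  obtain ⟨⟨a, ha⟩, ⟨b, hb⟩, ⟨c, hc⟩⟩ := isUnit_factors
  rintro u (rfl | rfl | rfl)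
  · exact ⟨a, by simp [ha, toRatFunc_algebraMap]⟩
  · exact ⟨b, by simp [hb, toRatFunc_algebraMap]⟩
  · exact ⟨c, by simp [hc, toRatFunc_algebraMap]⟩

/-- The embedding of `𝕂₂` in `ℤ[α, 1 / α, 1 / (α - 1), 1 / (α + 1)]`. -/
noncomputable def val : TwoCyclotomicPF →*₀ Loc := exists_isEmbedding.choose

theorem isEmbedding_val : PartialField.IsEmbedding val := exists_isEmbedding.choose_spec.1

theorem toRatFunc_val (q : TwoCyclotomicPF) : toRatFunc (val q) = q.val :=
  exists_isEmbedding.choose_spec.2 q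

/-- The element `α`. -/
noncomputable def gen : TwoCyclotomicPF :=
  ⟨RatFunc.X, Or.inr ⟨_, Subgroup.subset_closure (Or.inl (Or.inl rfl)), rfl⟩⟩

/-- The element `α - 1`. -/
noncomputable def genSubOne : TwoCyclotomicPF :=
  ⟨RatFunc.X - 1, Or.inr ⟨_, Subgroup.subset_closure (Or.inl (Or.inr (Or.inl rfl))), rfl⟩⟩

/-- The element `α + 1`. -/
noncomputable def genAddOne : TwoCyclotomicPF :=
  ⟨RatFunc.X + 1, Or.inr ⟨_, Subgroup.subset_closure (Or.inl (Or.inr (Or.inr rfl))), rfl⟩⟩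

/-- Exponents `(e, a, b, c)` of an element `(-1) ^ e * α ^ a * (α - 1) ^ b * (α + 1) ^ c`. -/
abbrev Exponents : Type := ℤ × ℤ × ℤ × ℤ

/-- The element of `𝕂₂` with given exponents. -/
noncomputable def el : Exponents → TwoCyclotomicPF
  | (e, a, b, c) => (-1) ^ e * gen ^ a * genSubOne ^ b * genAddOne ^ c

theorem el_val (e a b c : ℤ) : (el (e, a, b, c)).val =
    (-1) ^ e * RatFunc.X ^ a * (RatFunc.X - 1) ^ b * (RatFunc.X + 1) ^ c := by
  rw [← RingPartialField.valHom_apply, el]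
  simp only [map_mul, map_zpow₀]
  rfl

theorem el_zero : el 0 = 1 := by
  change (-1) ^ (0 : ℤ) * gen ^ (0 : ℤ) * genSubOne ^ (0 : ℤ) * genAddOne ^ (0 : ℤ) = 1
  simp only [zpow_zero, mul_one]

theorem el_ne_zero (s : Exponents) : el s ≠ 0 := by
  obtain ⟨e, a, b, c⟩ := s
  refine fun h => ?_
  have hval := el_val e a b c
  rw [h] at hval
  exact mul_ne_zero (mul_ne_zero (mul_ne_zero (zpow_ne_zero e (neg_ne_zero.2 one_ne_zero))
    (zpow_ne_zero a RatFunc.X_ne_zero)) (zpow_ne_zero b ratFunc_X_sub_one_ne_zero))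
    (zpow_ne_zero c ratFunc_X_add_one_ne_zero) hval.symm

theorem el_sub (s t : Exponents) : el (s - t) = el s / el t := by
  obtain ⟨e, a, b, c⟩ := s
  obtain ⟨e', a', b', c'⟩ := t
  apply RingPartialField.ext
  rw [← RingPartialField.valHom_apply (_ / _), map_div₀, RingPartialField.valHom_apply,
    RingPartialField.valHom_apply, Prod.mk_sub_mk, Prod.mk_sub_mk, Prod.mk_sub_mk, el_val, el_val,
    el_val, zpow_sub₀ (neg_ne_zero.2 one_ne_zero), zpow_sub₀ RatFunc.X_ne_zero,
    zpow_sub₀ ratFunc_X_sub_one_ne_zero, zpow_sub₀ ratFunc_X_add_one_ne_zero, div_mul_div_comm,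
    div_mul_div_comm, div_mul_div_comm]

theorem el_add (s t : Exponents) : el (s + t) = el s * el t :=
  (div_eq_iff (el_ne_zero t)).1 (by rw [← el_sub, add_sub_cancel_right])

theorem exists_eq_el {q : TwoCyclotomicPF} (hq : q ≠ 0) : ∃ s, q = el s := by
  obtain ⟨x, rfl | ⟨u, hu, rfl⟩⟩ := q
  · exact absurd rfl hq
  suffices h : ∃ s, (u : RatFunc ℚ) = (el s).val from h.imp fun _ => RingPartialField.ext
  clear hq
  induction hu using Subgroup.closure_induction with
  | mem u hu =>
    rcases hu with (rfl | rfl | rfl) | rfl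
    · exact ⟨(0, 1, 0, 0), by simp [el_val]⟩
    · exact ⟨(0, 0, 1, 0), by simp [el_val]⟩
    · exact ⟨(0, 0, 0, 1), by simp [el_val]⟩
    · exact ⟨(1, 0, 0, 0), by simp [el_val]⟩
  | one => exact ⟨0, by rw [el_zero]; rfl⟩
  | mul u w _ _ hu hw =>
    obtain ⟨s, hs⟩ := hu
    obtain ⟨t, ht⟩ := hw
    exact ⟨s + t, by rw [Units.val_mul, hs, ht, el_add]; rfl⟩
  | inv u _ hu =>
    obtain ⟨s, hs⟩ := hu
    refine ⟨0 - s, ?_⟩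
    rw [Units.val_inv_eq_inv_val, hs, el_sub, el_zero, one_div,
      ← RingPartialField.valHom_apply (el s)⁻¹, map_inv₀, RingPartialField.valHom_apply]

/-- The exponents of the same element of `𝕂₂` in which the exponent of `-1` is `0` or `1`. -/
def reduce : Exponents → Exponents
  | (e, a, b, c) => (e % 2, a, b, c)

theorem el_reduce (s : Exponents) : el (reduce s) = el s := by
  obtain ⟨e, a, b, c⟩ := s
  apply RingPartialField.ext
  rw [reduce, el_val, el_val]
  congr 3
  conv_rhs => rw [← Int.emod_add_mul_ediv e 2, zpow_add₀ (neg_ne_zero.2 one_ne_zero), zpow_mul]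
  norm_num

theorem ev_val_el {K : Type*} [Field K] (z : K) (hz : z * (z - 1) * (z + 1) ≠ 0)
    (e a b c : ℤ) : ev z hz (val (el (e, a, b, c))) =
      (-1) ^ e * z ^ a * (z - 1) ^ b * (z + 1) ^ c := by
  have val_gen : val gen = algebraMap ℤ[X] Loc X :=
    toRatFunc_injective (by rw [toRatFunc_val, toRatFunc_algebraMap]; simp [gen])
  have val_genSubOne : val genSubOne = algebraMap ℤ[X] Loc (X - 1) :=
    toRatFunc_injective (by rw [toRatFunc_val, toRatFunc_algebraMap]; simp [genSubOne])
  have val_genAddOne : val genAddOne = algebraMap ℤ[X] Loc (X + 1) :=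
    toRatFunc_injective (by rw [toRatFunc_val, toRatFunc_algebraMap]; simp [genAddOne])
  have val_neg_one : val (-1) = -1 := by rw [isEmbedding_val.map_neg, map_one]
  let evHom : TwoCyclotomicPF →*₀ K := (ev z hz).toMonoidWithZeroHom.comp val
  change evHom (el (e, a, b, c)) = _
  have evHom_apply (q : TwoCyclotomicPF) : evHom q = ev z hz (val q) := rfl
  simp only [el, map_mul, map_zpow₀]
  simp only [evHom_apply, val_gen, val_genSubOne, val_genAddOne, val_neg_one, ev_algebraMap,
    map_neg, map_one, eval₂_X, eval₂_sub, eval₂_add, eval₂_one]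

end TwoCyclotomic

/-! ### The homomorphism from `𝕂₂` to `GF(4) ⊗ ℍ₂` -/

namespace GF4

theorem card_units : Nat.card GF4ˣ = 3 := by
  rw [Nat.card_units, GaloisField.card 2 2 two_ne_zero]
  rfl

theorem exists_isPrimitiveRoot : ∃ w : GF4, IsPrimitiveRoot w 3 := by
  obtain ⟨u, hu⟩ := IsCyclic.exists_ofOrder_eq_natCard (α := GF4ˣ)
  rw [card_units] at hu
  exact ⟨u, IsPrimitiveRoot.coe_units_iff.2 (hu ▸ IsPrimitiveRoot.orderOf u)⟩

/-- A primitive third root of unity `ω` in `GF(4)`. -/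
noncomputable def omega : GF4 := exists_isPrimitiveRoot.choose

theorem isPrimitiveRoot_omega : IsPrimitiveRoot omega 3 := exists_isPrimitiveRoot.choose_spec

theorem omega_ne_zero : omega ≠ 0 := isPrimitiveRoot_omega.ne_zero three_ne_zero

theorem omega_add_one : omega + 1 = omega⁻¹ := by
  have geom_sum := isPrimitiveRoot_omega.geom_sum_eq_zero (by norm_num)
  simp only [Finset.sum_range_succ, Finset.sum_range_zero, zero_add, pow_zero, pow_one] at geom_sum
  refine eq_inv_of_mul_eq_one_left ?_
  linear_combination geom_sum - CharTwo.two_eq_zero (R := GF4)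

theorem omega_sub_one : omega - 1 = omega⁻¹ := by
  rw [CharTwo.sub_eq_add, omega_add_one]

theorem omega_admissible : omega * (omega - 1) * (omega + 1) ≠ 0 := by
  rw [omega_sub_one, omega_add_one]
  exact mul_ne_zero (mul_ne_zero omega_ne_zero (inv_ne_zero omega_ne_zero))
    (inv_ne_zero omega_ne_zero)

theorem exists_eq_omega_zpow {x : GF4} (hx : x ≠ 0) : ∃ k : ℤ, x = omega ^ k := by
  have pow_three : Units.mk0 x hx ^ 3 = 1 := card_units ▸ pow_card_eq_one'
  obtain ⟨k, -, hk⟩ := isPrimitiveRoot_omega.eq_pow_of_pow_eq_one (congrArg Units.val pow_three)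
  exact ⟨k, by rw [zpow_natCast, hk, Units.val_mk0]⟩

end GF4

namespace GaussianUnits

open Complex

theorem I_admissible : (I : ℂ) * (I - 1) * (I + 1) ≠ 0 := by
  have hI : I * (I - 1) * (I + 1) = -2 * I := by linear_combination I * I_sq
  rw [hI]
  exact mul_ne_zero (neg_ne_zero.2 two_ne_zero) I_ne_zero

theorem exists_val_eq (k n : ℤ) : ∃ x : GaussianPF, x.val = I ^ k * (1 + I) ^ n := by
  let i : GaussianPF := ⟨I, Or.inr ⟨_, Subgroup.subset_closure (Or.inl (Or.inl rfl)), rfl⟩⟩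
  let j : GaussianPF := ⟨1 - I, Or.inr ⟨_, Subgroup.subset_closure (Or.inl (Or.inr rfl)), rfl⟩⟩
  have hij : I * (1 - I) = 1 + I := by linear_combination -I_sq
  refine ⟨i ^ k * (i * j) ^ n, ?_⟩
  rw [← RingPartialField.valHom_apply, map_mul, map_zpow₀, map_zpow₀, map_mul, ← hij]
  rfl

theorem exists_eq_zpow_mul {x : GaussianPF} (hx : x ≠ 0) :
    ∃ k n : ℤ, x.val = I ^ k * (1 + I) ^ n := by
  obtain ⟨x, rfl | ⟨u, hu, rfl⟩⟩ := x
  · exact absurd rfl hx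
  clear hx
  change ∃ k n : ℤ, (u : ℂ) = I ^ k * (1 + I) ^ n
  induction hu using Subgroup.closure_induction with
  | mem u hu =>
    rcases hu with (rfl | rfl) | rfl
    · exact ⟨1, 0, by simp⟩
    · refine ⟨-1, 1, ?_⟩
      rw [zpow_neg_one, zpow_one, Units.val_mk0, inv_I]
      linear_combination I_sq
    · exact ⟨2, 0, by simp⟩
  | one => exact ⟨0, 0, by simp⟩
  | mul u w _ _ hu hw =>
    obtain ⟨k, n, hkn⟩ := hu
    obtain ⟨l, m, hlm⟩ := hw
    refine ⟨k + l, n + m, ?_⟩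
    rw [Units.val_mul, hkn, hlm, zpow_add₀ I_ne_zero, zpow_add₀ one_add_I_ne_zero,
      mul_mul_mul_comm]
  | inv u _ hu =>
    obtain ⟨k, n, hkn⟩ := hu
    exact ⟨-k, -n, by rw [Units.val_inv_eq_inv_val, hkn, zpow_neg, zpow_neg, mul_inv]⟩

end GaussianUnits

namespace TwoCyclotomic

open Complex GF4 GaussianUnits

theorem ev_omega_el (e a b c : ℤ) :
    ev omega omega_admissible (val (el (e, a, b, c))) = omega ^ (a - b - c) := by
  rw [ev_val_el, omega_sub_one, omega_add_one, CharTwo.neg_eq, one_zpow, one_mul, inv_zpow,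
    inv_zpow, zpow_sub₀ omega_ne_zero, zpow_sub₀ omega_ne_zero, div_eq_mul_inv, div_eq_mul_inv]

theorem ev_I_el (e a b c : ℤ) : ev I I_admissible (val (el (e, a, b, c))) =
    I ^ (2 * e + a + b) * (1 + I) ^ (b + c) := by
  have I_sub_one : I - 1 = I * (1 + I) := by linear_combination -I_sq
  rw [ev_val_el, ← I_zpow_two, I_sub_one, mul_zpow, ← zpow_mul, zpow_add₀ I_ne_zero,
    zpow_add₀ I_ne_zero, zpow_add₀ one_add_I_ne_zero, add_comm I 1]
  ring

/-- The embedding of `GF(4) ⊗ ℍ₂` in `GF(4) × ℂ`. -/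
def prodVal : ProdPartialField GF4 GaussianPF →*₀ GF4 × ℂ where
  toFun x := (x.fst, x.snd.val)
  map_zero' := rfl
  map_one' := rfl
  map_mul' _ _ := rfl

theorem prodVal_apply (x : ProdPartialField GF4 GaussianPF) : prodVal x = (x.fst, x.snd.val) := rfl

theorem isEmbedding_prodVal : PartialField.IsEmbedding prodVal where
  injective x y h := by
    rw [prodVal_apply, prodVal_apply, Prod.mk.injEq] at h
    exact ProdPartialField.ext h.1 (RingPartialField.ext h.2)
  mem_padd p q r := by
    refine ProdPartialField.mem_add.trans ?_
    rw [prodVal_apply, prodVal_apply, prodVal_apply, Prod.mk_add_mk, Prod.mk.injEq]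
    exact and_congr Part.mem_some_iff RingPartialField.mem_add

/-- Simultaneous evaluation at `ω` and at `i`. -/
noncomputable def evProd : Loc →+* GF4 × ℂ :=
  (ev omega omega_admissible).prod (ev I I_admissible)

theorem exists_prodVal_eq (q : TwoCyclotomicPF) : ∃ x, prodVal x = evProd (val q) := by
  by_cases hq : q = 0
  · exact ⟨0, by rw [hq, map_zero, map_zero, map_zero]⟩
  obtain ⟨⟨e, a, b, c⟩, rfl⟩ := exists_eq_el hq
  obtain ⟨y, hy⟩ := exists_val_eq (2 * e + a + b) (b + c)
  have y_ne_zero : y ≠ 0 := fun h => I_zpow_mul_ne_zero (2 * e + a + b) (b + c) (by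
    rw [← hy, h]
    rfl)
  exact ⟨⟨omega ^ (a - b - c), y, iff_of_true (zpow_ne_zero _ omega_ne_zero) y_ne_zero⟩,
    Prod.ext (ev_omega_el e a b c).symm (hy.trans (ev_I_el e a b c).symm)⟩

/-- The homomorphism from `𝕂₂` to `GF(4) ⊗ ℍ₂` that sends `α` to `(ω, i)`. -/
noncomputable def toProd : TwoCyclotomicPF →*₀ ProdPartialField GF4 GaussianPF where
  toFun q := (exists_prodVal_eq q).choose
  map_zero' := isEmbedding_prodVal.injective (by
    rw [(exists_prodVal_eq 0).choose_spec, map_zero, map_zero, map_zero])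
  map_one' := isEmbedding_prodVal.injective (by
    rw [(exists_prodVal_eq 1).choose_spec, map_one, map_one, map_one])
  map_mul' p q := isEmbedding_prodVal.injective (by
    rw [(exists_prodVal_eq _).choose_spec, map_mul, map_mul, map_mul,
      (exists_prodVal_eq p).choose_spec, (exists_prodVal_eq q).choose_spec])

theorem prodVal_toProd (q : TwoCyclotomicPF) : prodVal (toProd q) = evProd (val q) :=
  (exists_prodVal_eq q).choose_spec

theorem prodVal_toProd_el (e a b c : ℤ) : prodVal (toProd (el (e, a, b, c))) =
    (omega ^ (a - b - c), I ^ (2 * e + a + b) * (1 + I) ^ (b + c)) := by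
  rw [prodVal_toProd, ← ev_omega_el e, ← ev_I_el]
  rfl

/-- The exponents `(j, k, n)` of the image `(ω ^ j, i ^ k * (1 + i) ^ n)` in `GF(4) ⊗ ℍ₂` of an
element of `𝕂₂`, where `j` is reduced modulo `3` and `k` modulo `4`. -/
def key : Exponents → ℤ × ℤ × ℤ
  | (e, a, b, c) => ((a - b - c) % 3, (2 * e + a + b) % 4, b + c)

theorem key_reduce (s : Exponents) : key (reduce s) = key s := by
  obtain ⟨e, a, b, c⟩ := s
  change ((a - b - c) % 3, (2 * (e % 2) + a + b) % 4, b + c) = _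
  rw [key]
  congr 2
  omega

theorem toProd_el_eq_iff (s t : Exponents) : toProd (el s) = toProd (el t) ↔ key s = key t := by
  obtain ⟨e, a, b, c⟩ := s
  obtain ⟨e', a', b', c'⟩ := t
  rw [← isEmbedding_prodVal.injective.eq_iff, prodVal_toProd_el, prodVal_toProd_el, Prod.mk.injEq,
    zpow_eq_zpow_iff_of_isPrimitiveRoot isPrimitiveRoot_omega omega_ne_zero, I_zpow_mul_eq_iff]
  simp only [key, Prod.mk.injEq]
  omega

theorem exists_eq_toProd_el {x : ProdPartialField GF4 GaussianPF} (hx : x ≠ 0) :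
    ∃ s, x = toProd (el s) := by
  obtain ⟨hfst, hsnd⟩ := ProdPartialField.ne_zero_and_ne_zero hx
  obtain ⟨j, hj⟩ := exists_eq_omega_zpow hfst
  obtain ⟨k, n, hkn⟩ := exists_eq_zpow_mul hsnd
  -- The exponent of `α` is found by the Chinese remainder theorem modulo `3` and `4`.
  refine ⟨(0, 9 * k + 4 * (j + n), 0, n), isEmbedding_prodVal.injective ?_⟩
  rw [prodVal_toProd_el, prodVal_apply, hj, hkn, Prod.mk.injEq,
    zpow_eq_zpow_iff_of_isPrimitiveRoot isPrimitiveRoot_omega omega_ne_zero, I_zpow_mul_eq_iff]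
  omega

end TwoCyclotomic

/-! ### The fundamental elements of `𝕂₂` and of `GF(4) ⊗ ℍ₂` -/

namespace TwoCyclotomic

open PartialField (IsFundamental isFundamental_div_iff map_mem_mrange zero_mem_mrange)
open MonoidHom (mrange)
open GF4 GaussianUnits

/-- The exponents of `p`, `1 - p`, `1 / p`, `1 / (1 - p)`, `(p - 1) / p` and `p / (p - 1)`, where
`p = el s` and `1 - p = el t`. -/
def associates (s t : Exponents) : List Exponents :=
  [s, t, -s, -t, t - s + (1, 0, 0, 0), s - t + (1, 0, 0, 0)]

/-- The exponents of the nonzero fundamental elements of `𝕂₂`: these are `1` and the associates of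
`α`, `-α` and `α ^ 2`. -/
def fundamentals : List Exponents :=
  0 :: (associates (0, 1, 0, 0) (1, 0, 1, 0) ++ associates (1, 1, 0, 0) (0, 0, 0, 1) ++
    associates (0, 2, 0, 0) (1, 0, 1, 1)).map reduce

theorem val_el_add_neg_one (s : Exponents) : val (el (s + (1, 0, 0, 0))) = -val (el s) := by
  have el_neg_one : val (el (1, 0, 0, 0)) = -1 :=
    toRatFunc_injective (by simp [toRatFunc_val, el_val])
  rw [el_add, map_mul, el_neg_one, mul_neg_one]

theorem isFundamental_el_sub {s t : Exponents} (h : val (el t) - val (el s) ∈ mrange val) :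
    IsFundamental val (el (s - t)) := by
  rwa [el_sub, isFundamental_div_iff (el_ne_zero t)]

theorem isFundamental_el_of_mem_associates {r s t : Exponents}
    (h : (el s).val + (el t).val = 1) (hr : r ∈ associates s t) : IsFundamental val (el r) := by
  have hval : val (el s) + val (el t) = 1 := toRatFunc_injective (by
    rw [map_add, toRatFunc_val, toRatFunc_val, h, map_one])
  have neg_mem (u : Exponents) : -val (el u) ∈ mrange val := ⟨_, val_el_add_neg_one u⟩
  simp only [associates, List.mem_cons, List.not_mem_nil, or_false] at hr
  rcases hr with rfl | rfl | rfl | rfl | rfl | rfl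
  · exact ⟨el t, eq_sub_of_add_eq' hval⟩
  · exact ⟨el s, eq_sub_of_add_eq hval⟩
  · rw [← zero_sub]
    apply isFundamental_el_sub
    rw [el_zero, map_one, ← hval, sub_add_cancel_left]
    exact neg_mem t
  · rw [← zero_sub]
    apply isFundamental_el_sub
    rw [el_zero, map_one, ← hval, sub_add_cancel_right]
    exact neg_mem s
  · rw [sub_add_eq_add_sub]
    apply isFundamental_el_sub
    rw [val_el_add_neg_one, sub_neg_eq_add, hval]
    exact one_mem _
  · rw [sub_add_eq_add_sub]
    apply isFundamental_el_sub
    rw [val_el_add_neg_one, sub_neg_eq_add, add_comm (val _), hval]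
    exact one_mem _

theorem isFundamental_el_of_mem {s : Exponents} (hs : s ∈ fundamentals) :
    IsFundamental val (el s) := by
  simp only [fundamentals, List.mem_cons, List.mem_map, List.mem_append] at hs
  obtain rfl | ⟨r, (hr | hr) | hr, rfl⟩ := hs
  · rw [el_zero, IsFundamental, map_one, sub_self]
    exact zero_mem_mrange
  all_goals rw [el_reduce]
  · exact isFundamental_el_of_mem_associates (by simp [el_val]) hr
  · exact isFundamental_el_of_mem_associates (by simp [el_val]) hr
  · refine isFundamental_el_of_mem_associates ?_ hr
    simp only [el_val, zpow_ofNat]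
    ring

theorem key_mem_of_mem_exponents : ∀ j ∈ [1, 2], ∀ p ∈ GaussianUnits.exponents,
    ((j, p) : ℤ × ℤ × ℤ) ∈ fundamentals.map key := by decide

theorem key_mem {s : Exponents} (h : IsFundamental prodVal (toProd (el s))) :
    key s ∈ fundamentals.map key := by
  obtain ⟨y, hy⟩ := h
  by_cases hy0 : y = 0
  · rw [hy0, map_zero, eq_comm, sub_eq_zero, eq_comm] at hy
    have toProd_eq_one : toProd (el s) = toProd (el 0) :=
      isEmbedding_prodVal.injective (by rw [hy, el_zero, map_one, map_one])
    rw [(toProd_el_eq_iff s 0).1 toProd_eq_one]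
    decide
  obtain ⟨⟨e', a', b', c'⟩, rfl⟩ := exists_eq_toProd_el hy0
  obtain ⟨e, a, b, c⟩ := s
  rw [prodVal_toProd_el, prodVal_toProd_el] at hy
  obtain ⟨homega, hI⟩ := Prod.ext_iff.1 hy
  refine key_mem_of_mem_exponents ((a - b - c) % 3) ?_ _
    (GaussianUnits.mem_exponents (add_eq_of_eq_sub' hI))
  have not_dvd : ¬3 ∣ a - b - c := fun hdvd => zpow_ne_zero _ omega_ne_zero <|
    homega.trans (sub_eq_zero.2 ((isPrimitiveRoot_omega.zpow_eq_one_iff_dvd _).2 hdvd).symm)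
  simp only [List.mem_cons, List.not_mem_nil, or_false]
  omega

theorem mem_exponents_of_ev {z : ℚ} {hz : z * (z - 1) * (z + 1) ≠ 0} {m n : Exponents → ℤ}
    (hmn : ∀ s, ∃ ε : ℚ, (ε = 1 ∨ ε = -1) ∧ ev z hz (val (el s)) = ε * 2 ^ m s * 3 ^ n s)
    {s : Exponents} (hs₁ : el s ≠ 1) (hs : IsFundamental val (el s)) :
    (m s, n s) ∈ UnitEquation.exponents := by
  obtain ⟨q, hq⟩ := hs
  have hq0 : q ≠ 0 := by
    rintro rfl
    rw [map_zero] at hq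
    exact hs₁ (isEmbedding_val.injective (by rw [map_one, ← sub_eq_zero.1 hq.symm]))
  obtain ⟨t, rfl⟩ := exists_eq_el hq0
  obtain ⟨ε, hε, hs⟩ := hmn s
  obtain ⟨δ, hδ, ht⟩ := hmn t
  refine UnitEquation.mem_exponents hε hδ (m' := m t) (n' := n t) ?_
  rw [← hs, ← ht, hq, map_sub, map_one, add_sub_cancel]

theorem neg_one_zpow_eq_or (e : ℤ) : (-1 : ℚ) ^ e = 1 ∨ (-1 : ℚ) ^ e = -1 :=
  (Int.even_or_odd e).imp Even.neg_one_zpow Odd.neg_one_zpow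

section Evaluations

variable {e a b c : ℤ} (h₁ : el (e, a, b, c) ≠ 1) (h : IsFundamental val (el (e, a, b, c)))

include h₁ h

theorem mem_exponents_of_ev_two : (a, c) ∈ UnitEquation.exponents := by
  refine mem_exponents_of_ev (z := 2) (hz := by norm_num) (m := fun (_, a, _, _) => a)
    (n := fun (_, _, _, c) => c) (fun (e, a, b, c) => ⟨_, neg_one_zpow_eq_or e, ?_⟩) h₁ h
  rw [ev_val_el]
  norm_num

theorem mem_exponents_of_ev_half : (-a - b - c, c) ∈ UnitEquation.exponents := by
  refine mem_exponents_of_ev (z := 2⁻¹) (hz := by norm_num)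
    (m := fun (_, a, b, c) => -a - b - c) (n := fun (_, _, _, c) => c)
    (fun (e, a, b, c) => ⟨_, neg_one_zpow_eq_or (e + b), ?_⟩) h₁ h
  have half_sub_one : (2⁻¹ - 1 : ℚ) = -1 * 2⁻¹ := by norm_num
  have half_add_one : (2⁻¹ + 1 : ℚ) = 3 * 2⁻¹ := by norm_num
  change _ = (-1) ^ (e + b) * 2 ^ (-a - b - c) * 3 ^ c
  rw [ev_val_el, half_sub_one, half_add_one, mul_zpow, mul_zpow, inv_zpow', inv_zpow', inv_zpow',
    zpow_add₀ (by norm_num), sub_eq_add_neg, sub_eq_add_neg, zpow_add₀ (by norm_num),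
    zpow_add₀ (by norm_num)]
  ring

theorem mem_exponents_of_ev_three : (b + 2 * c, a) ∈ UnitEquation.exponents := by
  refine mem_exponents_of_ev (z := 3) (hz := by norm_num) (m := fun (_, _, b, c) => b + 2 * c)
    (n := fun (_, a, _, _) => a) (fun (e, a, b, c) => ⟨_, neg_one_zpow_eq_or e, ?_⟩) h₁ h
  have three_sub_one : (3 - 1 : ℚ) = 2 := by norm_num
  have three_add_one : (3 + 1 : ℚ) = 2 ^ (2 : ℤ) := by norm_num
  rw [ev_val_el, three_sub_one, three_add_one, ← zpow_mul, zpow_add₀ (by norm_num)]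
  ring

end Evaluations

theorem mem_fundamentals_of_mem_exponents : ∀ p ∈ UnitEquation.exponents,
    ∀ q ∈ UnitEquation.exponents, p.2 = q.2 →
      (p.2 - q.1 - p.1, p.1) ∈ UnitEquation.exponents → ∀ e ∈ ([0, 1] : List ℤ),
        key (e, p.1, -q.1 - p.1 - p.2, p.2) ∈ fundamentals.map key →
          key (e, p.1, -q.1 - p.1 - p.2, p.2) ≠ key 0 →
            (e, p.1, -q.1 - p.1 - p.2, p.2) ∈ fundamentals := by
  decide

theorem map_add_toProd {p q r : TwoCyclotomicPF} (h : val r = val p + val q) :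
    prodVal (toProd r) = prodVal (toProd p) + prodVal (toProd q) := by
  rw [prodVal_toProd, prodVal_toProd, prodVal_toProd, h, map_add]

theorem isFundamental_toProd {q : TwoCyclotomicPF} (h : IsFundamental val q) :
    IsFundamental prodVal (toProd q) := by
  obtain ⟨r, hr⟩ := h
  exact ⟨toProd r, by rw [prodVal_toProd, prodVal_toProd, hr, map_sub, map_one]⟩

theorem eq_one_of_toProd {q : TwoCyclotomicPF} (h : IsFundamental val q) (hq : toProd q = 1) :
    q = 1 := by
  obtain ⟨r, hr⟩ := h
  have toProd_eq_zero : toProd r = 0 := isEmbedding_prodVal.injective (by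
    rw [prodVal_toProd, hr, map_sub, ← prodVal_toProd, hq, map_one, map_one, sub_self, map_zero])
  rw [(map_eq_zero toProd).1 toProd_eq_zero, map_zero] at hr
  exact isEmbedding_val.injective (by rw [map_one, ← sub_eq_zero.1 hr.symm])

theorem reduce_mem_fundamentals {s : Exponents} (hs₁ : el s ≠ 1) (hs : IsFundamental val (el s)) :
    reduce s ∈ fundamentals := by
  have key_mem_map : key (reduce s) ∈ fundamentals.map key := by
    rw [key_reduce]
    exact key_mem (isFundamental_toProd hs)
  have key_ne : key (reduce s) ≠ key 0 := fun hkey => hs₁ (eq_one_of_toProd hs (by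
    rw [← el_reduce, (toProd_el_eq_iff _ 0).2 hkey, el_zero, map_one]))
  obtain ⟨e, a, b, c⟩ := s
  have h_b : -(-a - b - c) - a - c = b := by ring
  have h_three : c - (-a - b - c) - a = b + 2 * c := by ring
  have mem_of_exponents := mem_fundamentals_of_mem_exponents _ (mem_exponents_of_ev_two hs₁ hs) _
    (mem_exponents_of_ev_half hs₁ hs) rfl
  simp only [h_b, h_three] at mem_of_exponents
  exact mem_of_exponents (mem_exponents_of_ev_three hs₁ hs) (e % 2)
    (by simpa using Int.emod_two_eq_zero_or_one e) key_mem_map key_ne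

theorem exists_mem_fundamentals {q : TwoCyclotomicPF} (hq : q ≠ 0) (h : IsFundamental val q) :
    ∃ s ∈ fundamentals, q = el s := by
  by_cases hq₁ : q = 1
  · exact ⟨0, List.mem_cons_self, by rw [hq₁, el_zero]⟩
  obtain ⟨s, rfl⟩ := exists_eq_el hq
  exact ⟨reduce s, reduce_mem_fundamentals hq₁ h, (el_reduce s).symm⟩

theorem key_injOn_fundamentals :
    ∀ s ∈ fundamentals, ∀ t ∈ fundamentals, key s = key t → s = t := by decide

theorem reduce_sub_mem_fundamentals : ∀ s ∈ fundamentals, ∀ t ∈ fundamentals,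
    key (s - t) ∈ fundamentals.map key → reduce (s - t) ∈ fundamentals := by decide

theorem reduce_add_neg_one_mem_fundamentals : ∀ s ∈ fundamentals,
    key (s + (1, 0, 0, 0)) ∈ fundamentals.map key → reduce (s + (1, 0, 0, 0)) ∈ fundamentals := by
  decide

theorem isFundamental_zero : IsFundamental val 0 := by
  rw [IsFundamental, map_zero, sub_zero]
  exact one_mem _

theorem toProd_surjective : Function.Surjective toProd := by
  intro x
  by_cases hx : x = 0
  · exact ⟨0, by rw [map_zero, hx]⟩
  obtain ⟨s, rfl⟩ := exists_eq_toProd_el hx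
  exact ⟨el s, rfl⟩

theorem exists_isFundamental_toProd_eq {x : ProdPartialField GF4 GaussianPF}
    (h : IsFundamental prodVal x) : ∃ q, IsFundamental val q ∧ toProd q = x := by
  by_cases hx : x = 0
  · exact ⟨0, isFundamental_zero, by rw [map_zero, hx]⟩
  obtain ⟨s, rfl⟩ := exists_eq_toProd_el hx
  obtain ⟨t, ht, hkey⟩ := List.mem_map.1 (key_mem h)
  exact ⟨el t, isFundamental_el_of_mem ht, (toProd_el_eq_iff t s).2 hkey⟩

theorem eq_of_toProd_eq {p q : TwoCyclotomicPF} (hp : IsFundamental val p)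
    (hq : IsFundamental val q) (h : toProd p = toProd q) : p = q := by
  by_cases hp0 : p = 0
  · rw [hp0, map_zero, eq_comm, map_eq_zero] at h
    rw [hp0, h]
  have hq0 : q ≠ 0 := (map_ne_zero toProd).1 (h ▸ (map_ne_zero toProd).2 hp0)
  obtain ⟨s, hs, rfl⟩ := exists_mem_fundamentals hp0 hp
  obtain ⟨t, ht, rfl⟩ := exists_mem_fundamentals hq0 hq
  rw [key_injOn_fundamentals s hs t ht ((toProd_el_eq_iff s t).1 h)]

theorem isFundamental_div {p q : TwoCyclotomicPF} (hp0 : p ≠ 0) (hq0 : q ≠ 0)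
    (hp : IsFundamental val p) (hq : IsFundamental val q)
    (h : IsFundamental prodVal (toProd (p / q))) : IsFundamental val (p / q) := by
  obtain ⟨s, hs, rfl⟩ := exists_mem_fundamentals hp0 hp
  obtain ⟨t, ht, rfl⟩ := exists_mem_fundamentals hq0 hq
  rw [← el_sub] at h ⊢
  rw [← el_reduce]
  exact isFundamental_el_of_mem (reduce_sub_mem_fundamentals s hs t ht (key_mem h))

theorem isFundamental_of_one_add_mem {q : TwoCyclotomicPF} (hq : 1 + val q ∈ mrange val)
    (h : IsFundamental prodVal (toProd q)) : IsFundamental val q := by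
  by_cases hq0 : q = 0
  · rw [hq0]
    exact isFundamental_zero
  obtain ⟨s, rfl⟩ := exists_eq_el hq0
  have isFundamental_neg : IsFundamental val (el (s + (1, 0, 0, 0))) := by
    rwa [IsFundamental, val_el_add_neg_one, sub_neg_eq_add]
  obtain ⟨t, ht, hst⟩ := exists_mem_fundamentals (el_ne_zero _) isFundamental_neg
  have el_eq : el s = el (t + (1, 0, 0, 0)) := isEmbedding_val.injective (by
    rw [val_el_add_neg_one, ← hst, val_el_add_neg_one, neg_neg])
  rw [el_eq] at h ⊢
  rw [← el_reduce]
  exact isFundamental_el_of_mem (reduce_add_neg_one_mem_fundamentals t ht (key_mem h))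

theorem isLifting_toProd : PartialField.IsLifting val prodVal toProd where
  source_injective := isEmbedding_val.injective
  target_injective := isEmbedding_prodVal.injective
  source_neg_one_mem := isEmbedding_val.neg_one_mem
  target_neg_one_mem := isEmbedding_prodVal.neg_one_mem
  map_add _ _ _ := map_add_toProd
  surjective := toProd_surjective
  exists_isFundamental _ := exists_isFundamental_toProd_eq
  eq_of_isFundamental _ _ := eq_of_toProd_eq
  isFundamental_div _ _ := isFundamental_div
  isFundamental_of_one_add_mem _ := isFundamental_of_one_add_mem

end TwoCyclotomic

theorem mainTheorem11 {α : Type*} (M : Matroid α) [M.Finite] :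
    PartialField.IsRepresentable (ProdPartialField GF4 GaussianPF) M ↔
      PartialField.IsRepresentable TwoCyclotomicPF M :=
  PartialField.isRepresentable_iff_of_isLifting TwoCyclotomic.isEmbedding_prodVal
    TwoCyclotomic.isEmbedding_val TwoCyclotomic.isLifting_toProd
    (fun q => (TwoCyclotomic.prodVal_toProd q).symm) M
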